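/- **Setting.** Let $\mathfrak g$ be a finite-dimensional simple non-compact real Lie algebra and $G^\uparrow=\mathrm{Inn}(\mathfrak g)$ the group generated by $e^{\mathrm{ad}\,\mathfrak g}$. An *Euler element* is an $x\in\mathfrak g$ such that $\mathrm{ad}\,x$ is non-zero and diagonalizable with eigenvalues in $\{-1,0,1\}$; it is *symmetric* if $-x\in \mathrm{Inn}(\mathfrak g)x$. Let $\sigma_x=e^{\pi i\,\mathrm{ad}\,x}$, acting by $(-1)^j$ on the $j$-eigenspace of $\mathrm{ad}\,x$. Fix an Euler element $x$ and let $G=G^\uparrow\rtimes\{1,\sigma\}$, where $\mathrm{Ad}(\sigma)=\sigma_x$ and $\sigma$ acts on $G^\uparrow$ by conjugation with $\sigma_x$; put $G^\downarrow=G\setminus G^\uparrow$. Let $\mathcal G(G)$ be the set of pairs $W=(k_W,\sigma_W)\in\mathfrak g\times G^\downarrow$ with $\sigma_W^2=e$ and $\mathrm{Ad}(\sigma_W)k_W=k_W$. Let $h\in\mathfrak g$ be a non-symmetric Euler element for which there is $\sigma_h\in G^\downarrow$ with $\mathrm{Ad}(\sigma_h)=e^{\pi i\,\mathrm{ad}\,h}$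 and $W_h=(h,\sigma_h)\in\mathcal G(G)$ (for instance $x=h$, $\sigma_h=\sigma$). Let $U$ be an (anti-)unitary representation of $G$ on a complex Hilbert space $\mathcal H$ (strongly continuous, unitary on $G^\uparrow$, antiunitary on $G^\downarrow$) that is non-trivial on $G^\uparrow$ (equivalently, since $\mathfrak g$ is simple, with discrete kernel). A closed real subspace $\mathsf K\subseteq\mathcal H$ is *standard* if $\mathsf K\cap i\mathsf K=\{0\}$ and $\mathsf K+i\mathsf K$ is dense. Its modular objects $(\Delta_{\mathsf K},J_{\mathsf K})$ are given by the polar decomposition $S_{\mathsf K}=J_{\mathsf K}\Delta_{\mathsf K}^{1/2}$ of the closed operator $S_{\mathsf K}(\xi+i\eta)=\xi-i\eta$ on $\mathsf K+i\mathsf K$. The *BGL net* of $U$ assigns to $W\in\mathcal G(G)$ the standard subspace $\mathsf N_U(W)$ with $J_{\mathsf N_U(W)}=U(\sigma_W)$ and $\Delta_{\mathsf N_U(W)}^{-it/2\pi}=U(\exp t k_W)$ for all $t\in\mathbb R$. Let $\mathrm{dS}^2=\{x\in\mathbb R^{1+2}: x_1^2+x_2^2-x_0^2=1\}$ and $W^{\mathrm{dS}}_{x_1}=\{x\in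 \mathrm{dS}^2:|x_0|<x_1\}$. For $g\in \mathrm{SL}_2(\mathbb R)$ define the Lorentz transformation $\Lambda(g)$ by $(\Lambda(g)x)^\sim=g\tilde x g^{-1}$, where $\tilde x=\frac12\begin{pmatrix}x_1&-x_0-x_2\\x_0-x_2&-x_1\end{pmatrix}$. Let $\mathcal W^{\mathrm{dS}}=\{\Lambda(g)W^{\mathrm{dS}}_{x_1}:g\in \mathrm{SL}_2(\mathbb R)\}$ and $\sigma_1=\frac12\begin{pmatrix}0&1\\1&0\end{pmatrix}$. The boost group of $W=\Lambda(g)W_{x_1}^{\mathrm{dS}}$ is $\lambda_W(t)=\Lambda(g\exp(t\sigma_1)g^{-1})$. **Theorem.** 1. There is a subalgebra $\mathfrak b\cong\mathfrak{gl}_2(\mathbb R)$ of $\mathfrak g$ containing $h$, together with isomorphisms $\varphi:\mathfrak{sl}_2(\mathbb R)\to\mathfrak h:=[\mathfrak b,\mathfrak b]$ and $\Phi:\mathrm{SL}_2(\mathbb R)\to H^\uparrow:=\mathrm{Inn}_{\mathfrak g}(\mathfrak h)=\langle e^{\mathrm{ad}\,\mathfrak h}\rangle$ with $\Phi(\exp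 X)=e^{\mathrm{ad}\,\varphi(X)}$ for all $X\in\mathfrak{sl}_2(\mathbb R)$, such that $h=h_c-h_1$ with $h_c$ central in $\mathfrak b$ and $h_1=\varphi(\sigma_1)$. 2. The BGL net $\mathsf N_U$ on $\mathcal G(G)$ exists and is unique. 3. For every $(\mathfrak b,\varphi,\Phi)$ as in 1, put $V(g)=U(\Phi(g))$ for $g\in\mathrm{SL}_2(\mathbb R)$. Then $$\mathsf H^{\mathrm{dS}}(\Lambda(g)W^{\mathrm{dS}}_{x_1}):=V(g)\mathsf N_U(W_h),\qquad g\in \mathrm{SL}_2(\mathbb R),$$ is a well-defined net $\mathsf H^{\mathrm{dS}}$ of standard subspaces of $\mathcal H$ indexed by $\mathcal W^{\mathrm{dS}}$. It is Lorentz covariant: $V(g)\mathsf H^{\mathrm{dS}}(W)=\mathsf H^{\mathrm{dS}}(\Lambda(g)W)$ for all $g\in \mathrm{SL}_2(\mathbb R)$, $W\in\mathcal W^{\mathrm{dS}}$. It is not modular covariant, i.e. it is not true that $\Delta_{\mathsf H^{\mathrm{dS}}(W_a)}^{-it}\mathsf H^{\mathrm{dS}}(W_b)=\mathsf H^{\mathrm{dS}}(\lambda_{W_a}(2\pi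 t)W_b)$ for all $W_a,W_b\in\mathcal W^{\mathrm{dS}}$ and $t\in\mathbb R$. -/

import Mathlib

open scoped ComplexConjugate InnerProductSpace MatrixGroups

noncomputable section

namespace ModCov

attribute [local instance 100] LieRing.ofAssociativeRing

/-! ### Inner automorphisms and Euler elements -/

section Lie

variable {𝔤 : Type*} [LieRing 𝔤] [LieAlgebra ℝ 𝔤] [FiniteDimensional ℝ 𝔤]

/-- The exponential `e^A = ∑ Aⁿ / n!` of an endomorphism of a finite-dimensional real vector
space, computed through its matrix with respect to a basis. -/
def expEnd (A : Module.End ℝ 𝔤) : Module.End ℝ 𝔤 :=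
  (LinearMap.toMatrixAlgEquiv (Module.finBasis ℝ 𝔤)).symm
    (NormedSpace.exp (LinearMap.toMatrixAlgEquiv (Module.finBasis ℝ 𝔤) A))

lemma expEnd_mul_neg (A : Module.End ℝ 𝔤) : expEnd A * expEnd (-A) = 1 := by
  unfold expEnd
  generalize hM : LinearMap.toMatrixAlgEquiv (Module.finBasis ℝ 𝔤) A = M
  rw [← map_mul, map_neg, hM, ← Matrix.exp_add_of_commute _ _ (Commute.refl M).neg_right,
    add_neg_cancel, NormedSpace.exp_zero, map_one]

/-- `e^{ad x}` as an element of `GL(𝔤)`. -/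
def expAd (x : 𝔤) : 𝔤 ≃ₗ[ℝ] 𝔤 :=
  LinearEquiv.ofLinearMap (expEnd (LieAlgebra.ad ℝ 𝔤 x)) (expEnd (-LieAlgebra.ad ℝ 𝔤 x))
    (expEnd_mul_neg _) (by simpa using! expEnd_mul_neg (-LieAlgebra.ad ℝ 𝔤 x))

/-- `Inn_𝔤(𝔰)`, the group generated by `e^{ad 𝔰}`, for a subalgebra `𝔰` of `𝔤`. -/
def InnSub (𝔰 : LieSubalgebra ℝ 𝔤) : Subgroup (𝔤 ≃ₗ[ℝ] 𝔤) :=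
  Subgroup.closure {φ | ∃ x ∈ 𝔰, φ = expAd x}

variable (𝔤) in
/-- The group `Inn(𝔤)` of inner automorphisms. -/
def Inn : Subgroup (𝔤 ≃ₗ[ℝ] 𝔤) := InnSub (⊤ : LieSubalgebra ℝ 𝔤)

lemma innSub_le (𝔰 : LieSubalgebra ℝ 𝔤) : InnSub 𝔰 ≤ Inn 𝔤 :=
  Subgroup.closure_mono fun _ ⟨x, _, hx⟩ => ⟨x, LieSubalgebra.mem_top x, hx⟩

lemma expAd_mem_inn (x : 𝔤) : expAd x ∈ Inn 𝔤 :=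
  Subgroup.subset_closure ⟨x, LieSubalgebra.mem_top x, rfl⟩

/-- `x` is an Euler element: `ad x` is non-zero and diagonalizable with spectrum contained
in `{-1, 0, 1}`. -/
def IsEulerElement (x : 𝔤) : Prop :=
  LieAlgebra.ad ℝ 𝔤 x ≠ 0 ∧
    (LieAlgebra.ad ℝ 𝔤 x).eigenspace (-1) ⊔ (LieAlgebra.ad ℝ 𝔤 x).eigenspace 0 ⊔
      (LieAlgebra.ad ℝ 𝔤 x).eigenspace 1 = ⊤

/-- `x` is symmetric: `-x` lies in the orbit of `x` under inner automorphisms. -/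
def IsSymmetricElement (x : 𝔤) : Prop := ∃ φ ∈ Inn 𝔤, φ x = -x

/-- `σ = σ_x = e^{π i ad x}`: the linear map `σ` acts by `(-1)^j` on the `j`-eigenspace of `ad x`
for `j = -1, 0, 1`. This determines `σ` if `x` is an Euler element. -/
def IsEulerReflection (x : 𝔤) (σ : 𝔤 ≃ₗ[ℝ] 𝔤) : Prop :=
  ∀ y : 𝔤, (⁅x, y⁆ = 0 → σ y = y) ∧ (⁅x, y⁆ = y → σ y = -y) ∧ (⁅x, y⁆ = -y → σ y = -y)

/-! ### The graded group and its wedge space -/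

/-- The graded group `G = G↑ ⋊ {1, σ}` with `G↑ = Inn(𝔤)`, for an involution `σ` of `𝔤` that
normalizes `Inn(𝔤)`. It is realized by pairs `(Ad g, ε(g))`, where `ε` is the grading:
`(φ, 1)` with `φ ∈ Inn(𝔤)`, and `(φ ∘ σ, -1)` with `φ ∈ Inn(𝔤)`. The grading is recorded
separately, so that this is the semidirect product even when `σ` itself lies in `Inn(𝔤)`. -/
def GradedGroup (σ : 𝔤 ≃ₗ[ℝ] 𝔤) : Subgroup ((𝔤 ≃ₗ[ℝ] 𝔤) × ℤˣ) :=
  Subgroup.closure ({p | p.1 ∈ Inn 𝔤 ∧ p.2 = 1} ∪ {(σ, -1)})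

variable {σ : 𝔤 ≃ₗ[ℝ] 𝔤}

/-- The adjoint action of `G` on `𝔤`. -/
def GradedGroup.Ad (g : GradedGroup σ) : 𝔤 ≃ₗ[ℝ] 𝔤 := g.1.1

/-- The grading `ε : G → {1, -1}`. -/
def GradedGroup.grading (g : GradedGroup σ) : ℤˣ := g.1.2

/-- The inclusion of `Inn(𝔤) = G↑` in `G`. -/
def GradedGroup.ofInn (σ : 𝔤 ≃ₗ[ℝ] 𝔤) (φ : 𝔤 ≃ₗ[ℝ] 𝔤) (hφ : φ ∈ Inn 𝔤) : GradedGroup σ :=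
  ⟨(φ, 1), Subgroup.subset_closure (Or.inl ⟨hφ, rfl⟩)⟩

/-- The exponential function `𝔤 → G`. -/
def GradedGroup.exp (σ : 𝔤 ≃ₗ[ℝ] 𝔤) (x : 𝔤) : GradedGroup σ :=
  GradedGroup.ofInn σ (expAd x) (expAd_mem_inn x)

/-- The topology of `G`: the coarsest one for which the grading and the matrix coefficients
`g ↦ f (Ad(g) y)` are continuous. -/
@[reducible]
def GradedGroup.topology (σ : 𝔤 ≃ₗ[ℝ] 𝔤) : TopologicalSpace (GradedGroup σ) :=
  TopologicalSpace.induced GradedGroup.grading ⊥ ⊓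
    ⨅ (f : Module.Dual ℝ 𝔤) (y : 𝔤),
      TopologicalSpace.induced (fun g : GradedGroup σ => f (GradedGroup.Ad g y)) inferInstance

/-- The abstract wedge space `𝒢(G)`: pairs `(x, s)` with `x ∈ 𝔤`, `s` an odd element of `G`,
`s² = e` and `Ad(s) x = x`. -/
structure Wedge (σ : 𝔤 ≃ₗ[ℝ] 𝔤) where
  /-- the Lie algebra component -/
  x : 𝔤
  /-- the odd involution -/
  s : GradedGroup σ
  odd : GradedGroup.grading s = -1
  sq : s * s = 1
  fix : GradedGroup.Ad s x = x

/-- `W = (x, s)` is an Euler couple: `x` is an Euler element and `Ad(s) = e^{π i ad x}`. -/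
def Wedge.IsEulerCouple (W : Wedge σ) : Prop :=
  IsEulerElement W.x ∧ IsEulerReflection W.x (GradedGroup.Ad W.s)

end Lie

/-! ### Modular objects of standard subspaces -/

section Hilbert

variable {ℋ : Type*} [NormedAddCommGroup ℋ] [InnerProductSpace ℂ ℋ] [CompleteSpace ℋ]

/-- The graph of the Tomita operator `S : K + iK → K + iK`, `ξ + iη ↦ ξ - iη`. -/
def tomitaGraph (K : StandardSubspace ℋ) : Set (ℋ × ℋ) :=
  {p | ∃ ξ ∈ K.toClosedSubmodule, ∃ η ∈ K.toClosedSubmodule,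
    p.1 = ξ + Complex.I • η ∧ p.2 = ξ - Complex.I • η}

/-- `S = J A` is the polar decomposition of the Tomita operator of `K`: `J` is an antiunitary
involution (a conjugation) and `A`, which is `Δ^{1/2}`, is a positive self-adjoint operator. -/
structure IsPolarDecomposition (K : StandardSubspace ℋ) (J : ℋ ≃ₗᵢ[ℝ] ℋ) (A : ℋ →ₗ.[ℂ] ℋ) :
    Prop where
  antilinear : ∀ (c : ℂ) (v : ℋ), J (c • v) = conj c • J v
  involutive : ∀ v, J (J v) = v
  selfAdjoint : IsSelfAdjoint A
  nonneg : ∀ ζ : A.domain, 0 ≤ (inner ℂ (ζ : ℋ) (A ζ)).re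
  polar : ∀ p q : ℋ, (p, q) ∈ tomitaGraph K ↔ ∃ ζ : A.domain, (ζ : ℋ) = p ∧ J (A ζ) = q

/-- The strip `{z : -1/2 ≤ Im z ≤ 0}`. -/
def strip : Set ℂ := {z | -(1 / 2) ≤ z.im ∧ z.im ≤ 0}

/-- `(D t)` is the group `(Δ^{it})` of imaginary powers of the positive self-adjoint injective
operator `Δ = A²`: it is the strongly continuous one-parameter group of unitary operators whose
analytic continuation to `t = -i/2` is `Δ^{1/2} = A`. -/
structure IsImaginaryPowers (A : ℋ →ₗ.[ℂ] ℋ) (D : ℝ → ℋ ≃ₗᵢ[ℂ] ℋ) : Prop where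
  add : ∀ s t : ℝ, ∀ v, D (s + t) v = D s (D t v)
  continuous : ∀ v, Continuous fun t => D t v
  continuation : ∀ v w : ℋ, (∃ ζ : A.domain, (ζ : ℋ) = v ∧ A ζ = w) ↔
    ∃ F : ℂ → ℋ, ContinuousOn F strip ∧ DifferentiableOn ℂ F (interior strip) ∧
      (∀ t : ℝ, F t = D t v) ∧ F (-(Complex.I / 2)) = w

/-- `J` and `D t = Δ^{it}` are the modular conjugation and the modular group of `K`. -/
def IsModularData (K : StandardSubspace ℋ) (J : ℋ ≃ₗᵢ[ℝ] ℋ) (D : ℝ → ℋ ≃ₗᵢ[ℂ] ℋ) : Prop :=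
  ∃ A : ℋ →ₗ.[ℂ] ℋ, IsPolarDecomposition K J A ∧ IsImaginaryPowers A D

end Hilbert

/-! ### (Anti-)unitary representations and the Brunetti-Guido-Longo net -/

section Rep

variable {𝔤 : Type*} [LieRing 𝔤] [LieAlgebra ℝ 𝔤] [FiniteDimensional ℝ 𝔤]

/-- An (anti-)unitary representation of the graded group `G` on `ℋ`: a strongly continuous
homomorphism under which even elements act by unitary and odd ones by antiunitary operators. -/
structure AntiunitaryRep (σ : 𝔤 ≃ₗ[ℝ] 𝔤) (ℋ : Type*) [NormedAddCommGroup ℋ]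
    [InnerProductSpace ℂ ℋ] where
  /-- the underlying homomorphism to real-linear surjective isometries -/
  toHom : GradedGroup σ →* (ℋ ≃ₗᵢ[ℝ] ℋ)
  unitary : ∀ g : GradedGroup σ, GradedGroup.grading g = 1 →
    ∀ (c : ℂ) (v : ℋ), toHom g (c • v) = c • toHom g v
  antiunitary : ∀ g : GradedGroup σ, GradedGroup.grading g = -1 →
    ∀ (c : ℂ) (v : ℋ), toHom g (c • v) = conj c • toHom g v
  continuous : ∀ v : ℋ, @Continuous _ _ (GradedGroup.topology σ) _ fun g => toHom g v

variable {σ : 𝔤 ≃ₗ[ℝ] 𝔤} {ℋ : Type*} [NormedAddCommGroup ℋ] [InnerProductSpace ℂ ℋ]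

/-- `U` is non-trivial on the identity component `G↑`. -/
def AntiunitaryRep.NontrivialOnEven (U : AntiunitaryRep σ ℋ) : Prop :=
  ∃ g : GradedGroup σ, GradedGroup.grading g = 1 ∧ U.toHom g ≠ 1

/-- `N` is the Brunetti-Guido-Longo net of `U`: for `W = (x, s)`, the standard subspace `N(W)`
has modular conjugation `U(s)` and modular group given by `Δ^{-it/2π} = U(exp(t x))`. -/
def IsBGLNet [CompleteSpace ℋ] (U : AntiunitaryRep σ ℋ) (N : Wedge σ → StandardSubspace ℋ) :
    Prop :=
  ∀ W : Wedge σ, ∃ D : ℝ → ℋ ≃ₗᵢ[ℂ] ℋ, IsModularData (N W) (U.toHom W.s) D ∧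
    ∀ (t : ℝ) (v : ℋ), D (-t / (2 * Real.pi)) v = U.toHom (GradedGroup.exp σ (t • W.x)) v

end Rep

/-! ### Two-dimensional de Sitter space -/

section DeSitter

/-- The Lie algebra `sl₂(ℝ)`. -/
abbrev sl2 : LieSubalgebra ℝ (Matrix (Fin 2) (Fin 2) ℝ) := LieAlgebra.SpecialLinear.sl (Fin 2) ℝ

lemma det_exp_sl2 (X : sl2) : (NormedSpace.exp (X : Matrix (Fin 2) (Fin 2) ℝ)).det = 1 := by
  obtain ⟨X, hX⟩ := X
  have htr : X 0 0 + X 1 1 = 0 := by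
    have h : X.trace = 0 := hX
    rwa [Matrix.trace_fin_two] at h
  have hinv : (NormedSpace.exp X).det * (NormedSpace.exp X).det = 1 := by
    let J : Matrix (Fin 2) (Fin 2) ℝ := !![0, 1; -1, 0]
    have hJ : IsUnit J := by
      rw [Matrix.isUnit_iff_isUnit_det]; simp [J, Matrix.det_fin_two]
    have hJi : J⁻¹ = !![0, -1; 1, 0] := by
      apply Matrix.inv_eq_right_inv
      ext i j; fin_cases i <;> fin_cases j <;> simp [J, Matrix.mul_apply, Fin.sum_univ_two]
    have hc : J * X * J⁻¹ = (-X).transpose := by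
      rw [hJi]
      ext i j
      fin_cases i <;> fin_cases j <;>
        simp [J, Matrix.mul_apply, Fin.sum_univ_two, Matrix.vecMul, dotProduct] <;> linarith
    have h1 : (NormedSpace.exp X).det = (NormedSpace.exp (-X)).det := by
      rw [← Matrix.det_transpose (NormedSpace.exp (-X)), ← Matrix.exp_transpose, ← hc,
        Matrix.exp_conj _ _ hJ, Matrix.det_conj hJ]
    nth_rewrite 2 [h1]
    rw [← Matrix.det_mul, ← Matrix.exp_add_of_commute _ _ (Commute.refl X).neg_right, add_neg_cancel,
      NormedSpace.exp_zero, Matrix.det_one]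
  have hpos : 0 ≤ (NormedSpace.exp X).det := by
    have h2 : NormedSpace.exp X =
        NormedSpace.exp ((1 / 2 : ℝ) • X) * NormedSpace.exp ((1 / 2 : ℝ) • X) := by
      rw [← Matrix.exp_add_of_commute _ _ rfl, ← add_smul]; norm_num
    rw [h2, Matrix.det_mul]; exact mul_self_nonneg _
  show (NormedSpace.exp X).det = 1
  nlinarith

/-- The exponential function `sl₂(ℝ) → SL₂(ℝ)`. -/
def expSL (X : sl2) : SL(2, ℝ) := ⟨NormedSpace.exp (X : Matrix (Fin 2) (Fin 2) ℝ), det_exp_sl2 X⟩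

/-- The element `σ₁ = ½ (0 1; 1 0)` of `sl₂(ℝ)`. -/
def sigma1 : sl2 :=
  ⟨!![0, 1 / 2; 1 / 2, 0], by
    show Matrix.trace (!![0, 1 / 2; 1 / 2, 0] : Matrix (Fin 2) (Fin 2) ℝ) = 0
    simp [Matrix.trace_fin_two]⟩

/-- The matrix picture `x ↦ x̃` of Minkowski space `ℝ^{1+2}`, with coordinates
`(x₀, x₁, x₂)`. -/
def tilde (x : Fin 3 → ℝ) : Matrix (Fin 2) (Fin 2) ℝ :=
  (1 / 2 : ℝ) • !![x 1, -x 0 - x 2; x 0 - x 2, -x 1]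

/-- The inverse of `x ↦ x̃` on trace-free matrices. -/
def untilde (X : Matrix (Fin 2) (Fin 2) ℝ) : Fin 3 → ℝ :=
  ![X 1 0 - X 0 1, X 0 0 - X 1 1, -X 0 1 - X 1 0]

lemma tilde_untilde (X : Matrix (Fin 2) (Fin 2) ℝ) (hX : X.trace = 0) : tilde (untilde X) = X := by
  rw [Matrix.trace_fin_two] at hX
  ext i j
  fin_cases i <;> fin_cases j <;> simp [tilde, untilde] <;> linarith

lemma trace_conj_tilde (g : SL(2, ℝ)) (x : Fin 3 → ℝ) :
    ((g : Matrix (Fin 2) (Fin 2) ℝ) * tilde x * (g⁻¹ : SL(2, ℝ))).trace = 0 := by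
  rw [Matrix.trace_mul_comm, ← mul_assoc, ← Matrix.SpecialLinearGroup.coe_mul]
  simp [tilde, Matrix.trace_fin_two]

/-- The covering homomorphism `Λ` from `SL₂(ℝ)` to the Lorentz group of `ℝ^{1+2}`, given by
`(Λ(g) x)~ = g x̃ g⁻¹`. -/
def lorentz (g : SL(2, ℝ)) (x : Fin 3 → ℝ) : Fin 3 → ℝ :=
  untilde ((g : Matrix (Fin 2) (Fin 2) ℝ) * tilde x * (g⁻¹ : SL(2, ℝ)))

lemma tilde_lorentz (g : SL(2, ℝ)) (x : Fin 3 → ℝ) :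
    tilde (lorentz g x) = (g : Matrix (Fin 2) (Fin 2) ℝ) * tilde x * (g⁻¹ : SL(2, ℝ)) :=
  tilde_untilde _ (trace_conj_tilde g x)

lemma lorentz_mul (g g' : SL(2, ℝ)) (x : Fin 3 → ℝ) :
    lorentz (g * g') x = lorentz g (lorentz g' x) := by
  rw [lorentz.eq_def g (lorentz g' x), tilde_lorentz, lorentz, mul_inv_rev,
    Matrix.SpecialLinearGroup.coe_mul, Matrix.SpecialLinearGroup.coe_mul]
  simp only [mul_assoc]

/-- De Sitter space `{x : x₁² + x₂² - x₀² = 1}`. -/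
def deSitter : Set (Fin 3 → ℝ) := {x | x 1 ^ 2 + x 2 ^ 2 - x 0 ^ 2 = 1}

/-- The right wedge `{x : |x₀| < x₁}` intersected with de Sitter space. -/
def rightWedge : Set (Fin 3 → ℝ) := {x | |x 0| < x 1} ∩ deSitter

/-- The set of wedge regions of de Sitter space, the Lorentz transforms of the right wedge. -/
def DSWedges : Set (Set (Fin 3 → ℝ)) := {W | ∃ g : SL(2, ℝ), W = lorentz g '' rightWedge}

/-- The wedge region `Λ(g) W_{x₁}`. -/
def dsWedge (g : SL(2, ℝ)) : DSWedges := ⟨lorentz g '' rightWedge, g, rfl⟩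

/-- The action of `SL₂(ℝ)` on wedge regions, `W ↦ Λ(g) W`. -/
def DSWedges.act (g : SL(2, ℝ)) (W : DSWedges) : DSWedges :=
  ⟨lorentz g '' W.1, by
    obtain ⟨W, g', rfl⟩ := W
    exact ⟨g * g', by simp [Set.image_image, lorentz_mul]⟩⟩

variable {ℋ : Type*} [NormedAddCommGroup ℋ] [InnerProductSpace ℂ ℋ]

/-- `L = V K` for a real-linear surjective isometry `V`. -/
def IsImage (V : ℋ ≃ₗᵢ[ℝ] ℋ) (K L : StandardSubspace ℋ) : Prop :=
  (L.toClosedSubmodule : Set ℋ) = V '' (K.toClosedSubmodule : Set ℋ)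

/-- Lorentz covariance of a net on de Sitter space with respect to `V : SL₂(ℝ) → U(ℋ)`:
`N(Λ(g) W) = V(g) N(W)`. -/
def LorentzCovariant (V : SL(2, ℝ) → ℋ ≃ₗᵢ[ℝ] ℋ) (N : DSWedges → StandardSubspace ℋ) : Prop :=
  ∀ (g : SL(2, ℝ)) (W : DSWedges), IsImage (V g) (N W) (N (DSWedges.act g W))

/-- Modular covariance of a net on de Sitter space:
`Δ_{N(Wₐ)}^{-it} N(W_b) = N(λ_{Wₐ}(2πt) W_b)`, where the boost group of `Wₐ = Λ(g) W_{x₁}`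
is `λ_{Wₐ}(t) = Λ(g exp(t σ₁) g⁻¹)`. -/
def ModularCovariant [CompleteSpace ℋ] (N : DSWedges → StandardSubspace ℋ) : Prop :=
  ∀ (g : SL(2, ℝ)) (J : ℋ ≃ₗᵢ[ℝ] ℋ) (D : ℝ → ℋ ≃ₗᵢ[ℂ] ℋ), IsModularData (N (dsWedge g)) J D →
    ∀ (W : DSWedges) (t : ℝ),
      (D (-t)) '' ((N W).toClosedSubmodule : Set ℋ) =
        ((N (DSWedges.act (g * expSL ((2 * Real.pi * t) • sigma1) * g⁻¹) W)).toClosedSubmodule : Set ℋ)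

end DeSitter

/-! ### The subalgebra `𝔟 ≅ gl₂(ℝ)` -/

section Gl2

variable {𝔤 : Type*} [LieRing 𝔤] [LieAlgebra ℝ 𝔤] [FiniteDimensional ℝ 𝔤]

/-- The commutator algebra `[𝔟, 𝔟]`, as a subalgebra of `𝔤`. -/
def commutatorAlgebra (𝔟 : LieSubalgebra ℝ 𝔤) : LieSubalgebra ℝ 𝔤 :=
  LieSubalgebra.lieSpan ℝ 𝔤 {z | ∃ x ∈ 𝔟, ∃ y ∈ 𝔟, z = ⁅x, y⁆}

/-- A subalgebra `𝔟 ≅ gl₂(ℝ)` of `𝔤` that contains `h`, with identifications of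
`𝔥 = [𝔟, 𝔟]` with `sl₂(ℝ)` and of `H↑ = Inn_𝔤(𝔥)` with `SL₂(ℝ)` that fit together and for which
`h = h_c - h₁`, where `h_c` is central in `𝔟` and `h₁ ∈ 𝔥` corresponds to `σ₁`. -/
structure Gl2Datum (h : 𝔤) where
  /-- the subalgebra -/
  𝔟 : LieSubalgebra ℝ 𝔤
  mem : h ∈ 𝔟
  isoGl : Nonempty (𝔟 ≃ₗ⁅ℝ⁆ Matrix (Fin 2) (Fin 2) ℝ)
  /-- the identification `sl₂(ℝ) ≅ 𝔥` -/
  φ : sl2 ≃ₗ⁅ℝ⁆ commutatorAlgebra 𝔟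
  /-- the identification `SL₂(ℝ) ≅ H↑` -/
  Φ : SL(2, ℝ) ≃* InnSub (commutatorAlgebra 𝔟)
  Φ_exp : ∀ X : sl2, (Φ (expSL X) : 𝔤 ≃ₗ[ℝ] 𝔤) = expAd (φ X : 𝔤)
  central : ∀ y ∈ 𝔟, ⁅h + (φ sigma1 : 𝔤), y⁆ = 0

/-- The representation `V = U|_{H↑}` of `SL₂(ℝ) ≅ H↑`. -/
def Gl2Datum.restrict {h : 𝔤} (d : Gl2Datum h) {σ : 𝔤 ≃ₗ[ℝ] 𝔤} {ℋ : Type*} [NormedAddCommGroup ℋ]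
    [InnerProductSpace ℂ ℋ] (U : AntiunitaryRep σ ℋ) (g : SL(2, ℝ)) : ℋ ≃ₗᵢ[ℝ] ℋ :=
  U.toHom (GradedGroup.ofInn σ (d.Φ g) (innSub_le _ (d.Φ g).2))

end Gl2

end ModCov

end

/-!
The theorem combines a structural fact about Euler elements, a construction of standard subspaces
from unitary one-parameter groups, and a rigidity property of modular groups.

*The subalgebra `𝔟`.* The Euler element `h` grades `𝔤` by `-1, 0, 1`. By a Jacobson-Morozov argument
that respects the grading, a non-zero `e` of degree `1` lies in an `sl₂`-triple `(e, k, f)` with `k`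
of degree `0`. For a triple with `dim {v ∈ 𝔤₁ : [k, v] = 2v}` maximal, the weights of `k` on `𝔤₁`
are `1` and `2`. If only `2` occurred, then `k = 2h`, and three exponentials of the triple would
carry `h` to `-h`. Hence for non-symmetric `h` there is a vector of odd weight
(`GradedTriple.exists_odd_weight`). It makes the central part `h - k/2` non-zero, so that `h` and
the triple span a copy of `gl₂(ℝ)`, and it makes the group generated by the triple a copy of
`SL₂(ℝ)` instead of `PSL₂(ℝ)` (`GradedTriple.nonempty_gl2Datum`).

*The Brunetti-Guido-Longo net.* For a unitary one-parameter group `D` the continuation of orbit maps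
to `-i/2` defines an operator `A`. Arguments on the strip (uniqueness of continuation,
the three lines theorem, constancy of pairings that are invariant under translations) show that `A`
is closed, symmetric and non-negative; Gaussian averages show that it is self-adjoint
(`IsUnitaryGroup.isSelfAdjoint_generator`). If a conjugation `J` commutes with `D`, then
`J A J = A⁻¹`, and the fixed points of `J A` form the standard subspace with modular data `(J, D)`
(`IsModularPair.isModularData`). A standard subspace is determined by its modular data
(`IsModularData.mem_iff`), which gives existence and uniqueness of the net.

*Stabilizers.* A unitary operator that preserves a standard subspace commutes with its modular group
(`IsModularPair.comm_of_image_eq`). Since a representation that is non-trivial on the even part is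
infinitesimally faithful (`AntiunitaryRep.eq_of_exp_eq`), an even element of `G` preserves the
subspace of an Euler wedge if and only if it fixes the Euler element
(`IsBGLNet.mem_stabilizer_iff`). For elements of `SL₂(ℝ)` this means that they commute with the
boosts `exp(sσ₁)`, as the central part of `h` is fixed anyway. The stabilizer of the right wedge of
de Sitter space also commutes with the boosts (`mul_sigma1_of_image_rightWedge`), so that the net is
well defined.

*Failure of modular covariance.* Write `h = h_c - h₁`. The modular group of the right wedge is
generated by `h`, whereas its boosts are generated by `h₁` and act in the opposite direction; the
two differ by the group of `h_c`, which commutes with `SL₂(ℝ)`. Modular covariance would therefore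
imply that certain boosts of translated wedges stabilize the subspace of the right wedge, and
such elements do not commute with the boosts (`conj_expSL_not_comm`).
-/

open scoped ComplexConjugate InnerProductSpace MatrixGroups

noncomputable section

namespace ModCov

attribute [local instance 100] LieRing.ofAssociativeRing

/-! ### Exponentials of endomorphisms -/

section Exponential

variable {V W : Type*} [AddCommGroup V] [Module ℝ V] [FiniteDimensional ℝ V]
  [AddCommGroup W] [Module ℝ W] [FiniteDimensional ℝ W]

/-- The operator norm of matrices, transported to endomorphisms by means of a basis. Only the
topology it induces matters. -/
@[reducible]
def endNormedRing (V : Type*) [AddCommGroup V] [Module ℝ V] [FiniteDimensional ℝ V] :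
    NormedRing (Module.End ℝ V) :=
  letI := Matrix.linftyOpNormedRing (n := Fin (Module.finrank ℝ V)) (α := ℝ)
  NormedRing.induced (Module.End ℝ V) (Matrix (Fin (Module.finrank ℝ V)) (Fin (Module.finrank ℝ V)) ℝ)
    (LinearMap.toMatrixAlgEquiv (Module.finBasis ℝ V)) (LinearMap.toMatrixAlgEquiv _).injective

attribute [local instance] endNormedRing

/-- The norm on endomorphisms is an algebra norm. -/
@[reducible]
def endNormedAlgebra (V : Type*) [AddCommGroup V] [Module ℝ V] [FiniteDimensional ℝ V] :
    NormedAlgebra ℝ (Module.End ℝ V) :=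
  letI := Matrix.linftyOpNormedRing (n := Fin (Module.finrank ℝ V)) (α := ℝ)
  letI := Matrix.linftyOpNormedAlgebra (n := Fin (Module.finrank ℝ V)) (R := ℝ) (α := ℝ)
  NormedAlgebra.induced ℝ (Module.End ℝ V)
    (Matrix (Fin (Module.finrank ℝ V)) (Fin (Module.finrank ℝ V)) ℝ)
    (LinearMap.toMatrixAlgEquiv (Module.finBasis ℝ V))

attribute [local instance] endNormedAlgebra

instance endCompleteSpace : CompleteSpace (Module.End ℝ V) := FiniteDimensional.complete ℝ _

lemma eq_of_forall_dual {a b : V} (h : ∀ ξ : Module.Dual ℝ V, ξ a = ξ b) : a = b := by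
  rw [← sub_eq_zero, ← Module.forall_dual_apply_eq_zero_iff ℝ]
  intro ξ
  rw [map_sub, h, sub_self]

lemma hasSum_exp_map {𝒜 : Type*} [NormedRing 𝒜] [NormedAlgebra ℝ 𝒜] [FiniteDimensional ℝ 𝒜]
    (ℓ : 𝒜 →ₗ[ℝ] ℝ) (a : 𝒜) :
    HasSum (fun n : ℕ => ((n.factorial : ℝ)⁻¹) * ℓ (a ^ n)) (ℓ (NormedSpace.exp a)) := by
  have : CompleteSpace 𝒜 := FiniteDimensional.complete ℝ _
  have h := NormedSpace.exp_series_hasSum_exp' (𝕂 := ℝ) a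
  have := h.mapL (LinearMap.toContinuousLinearMap ℓ)
  simpa using this

/-- The matrix coefficients of an exponential. -/
lemma hasSum_exp_apply (A : Module.End ℝ V) (ξ : Module.Dual ℝ V) (v : V) :
    HasSum (fun n : ℕ => ((n.factorial : ℝ)⁻¹) * ξ ((A ^ n) v)) (ξ (NormedSpace.exp A v)) :=
  hasSum_exp_map (ξ ∘ₗ LinearMap.applyₗ v) A

/-- Intertwining operators intertwine exponentials. -/
lemma exp_intertwine (T : V →ₗ[ℝ] W) {A : Module.End ℝ V} {B : Module.End ℝ W}
    (h : ∀ v, T (A v) = B (T v)) (v : V) :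
    T (NormedSpace.exp A v) = NormedSpace.exp B (T v) := by
  have hn : ∀ (n : ℕ) v, T ((A ^ n) v) = (B ^ n) (T v) := by
    intro n
    induction n with
    | zero => simp
    | succ n ih => intro v; rw [pow_succ, pow_succ, Module.End.mul_apply, Module.End.mul_apply, ih, h]
  refine eq_of_forall_dual fun ξ => ?_
  have h1 := hasSum_exp_apply A (ξ ∘ₗ T) v
  have h2 := hasSum_exp_apply B ξ (T v)
  simp only [LinearMap.comp_apply, hn] at h1
  exact h1.unique h2

lemma expEnd_eq_exp {𝔤 : Type*} [LieRing 𝔤] [LieAlgebra ℝ 𝔤] [FiniteDimensional ℝ 𝔤]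
    (A : Module.End ℝ 𝔤) : expEnd A = NormedSpace.exp A := by
  let := Matrix.linftyOpNormedRing (n := Fin (Module.finrank ℝ 𝔤)) (α := ℝ)
  let := Matrix.linftyOpNormedAlgebra (n := Fin (Module.finrank ℝ 𝔤)) (R := ℝ) (α := ℝ)
  refine LinearMap.ext fun v => eq_of_forall_dual fun ξ => ?_
  have h1 := hasSum_exp_apply A ξ v
  have h2 := hasSum_exp_map ((ξ ∘ₗ LinearMap.applyₗ v) ∘ₗ
    (LinearMap.toMatrixAlgEquiv (Module.finBasis ℝ 𝔤)).symm.toLinearMap)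
    (LinearMap.toMatrixAlgEquiv (Module.finBasis ℝ 𝔤) A)
  simp only [← map_pow, LinearMap.comp_apply, AlgEquiv.toLinearMap_apply,
    AlgEquiv.symm_apply_apply] at h2
  exact h2.unique h1

/-- `e^{L_a - R_a} b = e^a b e^{-a}` in a finite-dimensional algebra. -/
lemma exp_mulLeft_sub_mulRight {𝒜 : Type*} [NormedRing 𝒜] [NormedAlgebra ℝ 𝒜]
    [FiniteDimensional ℝ 𝒜] (a b : 𝒜) :
    NormedSpace.exp (LinearMap.mulLeft ℝ a - LinearMap.mulRight ℝ a) b =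
      NormedSpace.exp a * b * NormedSpace.exp (-a) := by
  have hL : ∀ a b : 𝒜, NormedSpace.exp (LinearMap.mulLeft ℝ a) b = NormedSpace.exp a * b := by
    intro a b
    refine eq_of_forall_dual fun ξ => ?_
    have h1 := hasSum_exp_apply (LinearMap.mulLeft ℝ a) ξ b
    have h2 := hasSum_exp_map (ξ ∘ₗ LinearMap.mulRight ℝ b) a
    simp only [LinearMap.pow_mulLeft, LinearMap.mulLeft_apply, LinearMap.comp_apply,
      LinearMap.mulRight_apply] at h1 h2
    exact h1.unique h2
  have hR : ∀ a b : 𝒜, NormedSpace.exp (LinearMap.mulRight ℝ a) b = b * NormedSpace.exp a := by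
    intro a b
    refine eq_of_forall_dual fun ξ => ?_
    have h1 := hasSum_exp_apply (LinearMap.mulRight ℝ a) ξ b
    have h2 := hasSum_exp_map (ξ ∘ₗ LinearMap.mulLeft ℝ b) a
    simp only [LinearMap.pow_mulRight, LinearMap.mulLeft_apply, LinearMap.comp_apply,
      LinearMap.mulRight_apply] at h1 h2
    exact h1.unique h2
  have hneg : LinearMap.mulLeft ℝ a - LinearMap.mulRight ℝ a =
      LinearMap.mulRight ℝ (-a) + LinearMap.mulLeft ℝ a := by
    ext; simp; abel
  have hc : Commute (LinearMap.mulRight ℝ (-a)) (LinearMap.mulLeft ℝ a) := by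
    ext; simp [mul_assoc]
  let := NormedAlgebra.restrictScalars ℚ ℝ (Module.End ℝ 𝒜)
  rw [hneg, NormedSpace.exp_add_of_commute hc, Module.End.mul_apply, hL, hR]

lemma hasDerivAt_exp_map {𝒜 : Type*} [NormedRing 𝒜] [NormedAlgebra ℝ 𝒜] [FiniteDimensional ℝ 𝒜]
    (ℓ : 𝒜 →ₗ[ℝ] ℝ) (a : 𝒜) (t : ℝ) :
    HasDerivAt (fun s : ℝ => ℓ (NormedSpace.exp (s • a))) (ℓ (a * NormedSpace.exp (t • a))) t := by
  have : CompleteSpace 𝒜 := FiniteDimensional.complete ℝ _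
  exact (LinearMap.toContinuousLinearMap ℓ).hasFDerivAt.comp_hasDerivAt t
    (hasDerivAt_exp_smul_const' a t)

end Exponential

/-! ### Inner automorphisms -/

section Inner

attribute [local instance] endNormedRing endNormedAlgebra

variable {𝔤 : Type*} [LieRing 𝔤] [LieAlgebra ℝ 𝔤] [FiniteDimensional ℝ 𝔤]

lemma expAd_apply (x y : 𝔤) : expAd x y = NormedSpace.exp (LieAlgebra.ad ℝ 𝔤 x) y := by
  rw [← expEnd_eq_exp]; rfl

lemma expAd_apply_eq_self {x y : 𝔤} (h : ⁅x, y⁆ = 0) : expAd x y = y := by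
  have := exp_intertwine (LinearMap.toSpanSingleton ℝ 𝔤 y) (A := 0) (B := LieAlgebra.ad ℝ 𝔤 x)
    (by simp [h]) 1
  simpa [expAd_apply] using this.symm

@[simp] lemma expAd_zero : expAd (0 : 𝔤) = 1 := by
  ext y; simpa using expAd_apply_eq_self (zero_lie y)

lemma expAd_symm (x : 𝔤) : (expAd x)⁻¹ = expAd (-x) := by
  ext y
  change expEnd (-LieAlgebra.ad ℝ 𝔤 x) y = expEnd (LieAlgebra.ad ℝ 𝔤 (-x)) y
  rw [map_neg]

lemma expAd_add {x y : 𝔤} (h : ⁅x, y⁆ = 0) : expAd (x + y) = expAd x * expAd y := by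
  have hc : Commute (LieAlgebra.ad ℝ 𝔤 x) (LieAlgebra.ad ℝ 𝔤 y) := by
    rw [commute_iff_lie_eq, ← LieHom.map_lie, h, map_zero]
  ext z
  change _ = expAd x (expAd y z)
  simp only [expAd_apply]
  let := NormedAlgebra.restrictScalars ℚ ℝ (Module.End ℝ 𝔤)
  rw [map_add, NormedSpace.exp_add_of_commute hc, Module.End.mul_apply]

lemma expAd_add_smul (x : 𝔤) (s t : ℝ) : expAd ((s + t) • x) = expAd (s • x) * expAd (t • x) := by
  rw [add_smul, expAd_add (by simp)]

lemma ad_expAd (x y : 𝔤) (z : 𝔤) :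
    ⁅expAd x y, z⁆ = expAd x ⁅y, (expAd x)⁻¹ z⁆ := by
  have h := exp_intertwine (LieAlgebra.ad ℝ 𝔤 : 𝔤 →ₗ[ℝ] Module.End ℝ 𝔤) (A := LieAlgebra.ad ℝ 𝔤 x)
    (B := LinearMap.mulLeft ℝ (LieAlgebra.ad ℝ 𝔤 x) - LinearMap.mulRight ℝ (LieAlgebra.ad ℝ 𝔤 x))
    (fun y => by ext z; simp) y
  rw [exp_mulLeft_sub_mulRight] at h
  have h2 := LinearMap.congr_fun h z
  rw [expAd_symm, expAd_apply x, expAd_apply x, expAd_apply (-x), map_neg]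
  simpa using h2

lemma expAd_lie (x y z : 𝔤) : expAd x ⁅y, z⁆ = ⁅expAd x y, expAd x z⁆ := by
  rw [ad_expAd]
  congr 2
  exact ((expAd x).symm_apply_apply z).symm

lemma inn_lie {φ : 𝔤 ≃ₗ[ℝ] 𝔤} (hφ : φ ∈ Inn 𝔤) (y z : 𝔤) : φ ⁅y, z⁆ = ⁅φ y, φ z⁆ := by
  induction hφ using Subgroup.closure_induction generalizing y z with
  | mem φ h => obtain ⟨x, -, rfl⟩ := h; exact expAd_lie x y z
  | one => rfl
  | mul φ ψ _ _ h1 h2 => change φ (ψ _) = ⁅φ (ψ _), φ (ψ _)⁆; rw [h2, h1]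
  | inv φ _ h =>
    apply φ.injective
    rw [h]
    change φ (φ.symm _) = ⁅φ (φ.symm _), φ (φ.symm _)⁆
    simp

/-- Automorphisms conjugate exponentials into exponentials. -/
lemma conj_expAd {φ : 𝔤 ≃ₗ[ℝ] 𝔤} (hφ : ∀ y z, φ ⁅y, z⁆ = ⁅φ y, φ z⁆) (x : 𝔤) :
    φ * expAd x * φ⁻¹ = expAd (φ x) := by
  rw [mul_inv_eq_iff_eq_mul]
  ext y
  change φ (expAd x y) = expAd (φ x) (φ y)
  rw [expAd_apply, expAd_apply]
  exact exp_intertwine (φ : 𝔤 →ₗ[ℝ] 𝔤) (by simp [hφ]) y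

lemma hasDerivAt_expAd (x y : 𝔤) (ξ : Module.Dual ℝ 𝔤) (t : ℝ) :
    HasDerivAt (fun s : ℝ => ξ (expAd (s • x) y)) (ξ ⁅x, expAd (t • x) y⁆) t := by
  simp only [expAd_apply, map_smul]
  exact hasDerivAt_exp_map (ξ ∘ₗ LinearMap.applyₗ y) (LieAlgebra.ad ℝ 𝔤 x) t

lemma hasDerivAt_expAd_zero (x y : 𝔤) (ξ : Module.Dual ℝ 𝔤) :
    HasDerivAt (fun s : ℝ => ξ (expAd (s • x) y)) (ξ ⁅x, y⁆) 0 := by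
  simpa using hasDerivAt_expAd x y ξ 0

lemma lie_eq_of_expAd_eq {a b : 𝔤} (h : ∀ t : ℝ, expAd (t • a) = expAd (t • b)) (y : 𝔤) :
    ⁅a, y⁆ = ⁅b, y⁆ := by
  refine eq_of_forall_dual fun ξ => ?_
  have h1 := hasDerivAt_expAd_zero a y ξ
  simp only [h] at h1
  exact h1.unique (hasDerivAt_expAd_zero b y ξ)

/-- `e^{ad x} y` is a finite sum when `(ad x)³ y = 0`. -/
lemma expAd_apply_of_nilpotent {x y : 𝔤} (h : ⁅x, ⁅x, ⁅x, y⁆⁆⁆ = 0) :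
    expAd x y = y + ⁅x, y⁆ + (1 / 2 : ℝ) • ⁅x, ⁅x, y⁆⁆ := by
  refine eq_of_forall_dual fun ξ => ?_
  have h1 := hasSum_exp_apply (LieAlgebra.ad ℝ 𝔤 x) ξ y
  rw [← expAd_apply] at h1
  refine h1.unique ?_
  have h3 : ∀ n ∉ Finset.range 3,
      ((n.factorial : ℝ)⁻¹) * ξ (((LieAlgebra.ad ℝ 𝔤 x) ^ n) y) = 0 := by
    intro n hn
    obtain ⟨m, rfl⟩ : ∃ m, n = m + 3 := ⟨n - 3, by simp at hn; omega⟩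
    rw [pow_add, Module.End.mul_apply]
    simp [pow_succ, h]
  have h4 : HasSum (fun n : ℕ => ((n.factorial : ℝ)⁻¹) * ξ (((LieAlgebra.ad ℝ 𝔤 x) ^ n) y))
    (∑ n ∈ Finset.range 3, ((n.factorial : ℝ)⁻¹) * ξ (((LieAlgebra.ad ℝ 𝔤 x) ^ n) y)) :=
    hasSum_sum_of_ne_finset_zero h3
  convert h4 using 1
  simp [Finset.sum_range_succ, pow_succ, Nat.factorial]

/-- A simple Lie algebra has trivial center. -/
lemma eq_zero_of_forall_lie_eq_zero {𝔤 : Type*} [LieRing 𝔤] [LieAlgebra ℝ 𝔤]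
    [LieAlgebra.IsSimple ℝ 𝔤] {a : 𝔤} (h : ∀ y : 𝔤, ⁅a, y⁆ = 0) :
    a = 0 := by
  have : a ∈ LieAlgebra.center ℝ 𝔤 := by
    rw [LieModule.mem_maxTrivSubmodule]
    intro y; rw [← lie_skew, h, neg_zero]
  rw [LieAlgebra.center_eq_bot] at this
  simpa using this

lemma eq_of_expAd_eq [LieAlgebra.IsSimple ℝ 𝔤] {a b : 𝔤}
    (h : ∀ t : ℝ, expAd (t • a) = expAd (t • b)) : a = b := by
  rw [← sub_eq_zero]
  refine eq_zero_of_forall_lie_eq_zero fun y => ?_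
  rw [sub_lie, lie_eq_of_expAd_eq h, sub_self]

end Inner

/-! ### The 3-grading of an Euler element -/

section Grading

variable {𝔤 : Type*} [LieRing 𝔤] [LieAlgebra ℝ 𝔤] {h : 𝔤}

lemma IsEulerElement.decomp (hh : IsEulerElement h) (y : 𝔤) :
    ∃ a b c : 𝔤, ⁅h, a⁆ = -a ∧ ⁅h, b⁆ = 0 ∧ ⁅h, c⁆ = c ∧ y = a + b + c := by
  have hy : y ∈ (⊤ : Submodule ℝ 𝔤) := trivial
  rw [← hh.2] at hy
  obtain ⟨ab, hab, c, hc, rfl⟩ := Submodule.mem_sup.1 hy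
  obtain ⟨a, ha, b, hb, rfl⟩ := Submodule.mem_sup.1 hab
  rw [Module.End.mem_eigenspace_iff] at ha hb hc
  exact ⟨a, b, c, by simpa using ha, by simpa using hb, by simpa using hc, rfl⟩

lemma IsEulerElement.neg (hh : IsEulerElement h) : IsEulerElement (-h) := by
  refine ⟨by simpa using hh.1, eq_top_iff.2 fun y _ => ?_⟩
  obtain ⟨a, b, c, ha, hb, hc, rfl⟩ := hh.decomp y
  have ha' : a ∈ (LieAlgebra.ad ℝ 𝔤 (-h)).eigenspace 1 := by
    rw [Module.End.mem_eigenspace_iff]; simp [ha]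
  have hb' : b ∈ (LieAlgebra.ad ℝ 𝔤 (-h)).eigenspace 0 := by
    rw [Module.End.mem_eigenspace_iff]; simp [hb]
  have hc' : c ∈ (LieAlgebra.ad ℝ 𝔤 (-h)).eigenspace (-1) := by
    rw [Module.End.mem_eigenspace_iff]; simp [hc]
  exact add_mem (add_mem (Submodule.mem_sup_right ha')
    (Submodule.mem_sup_left (Submodule.mem_sup_right hb')))
    (Submodule.mem_sup_left (Submodule.mem_sup_left hc'))

/-- The degree of an eigenvector of an Euler element is `-1`, `0` or `1`. -/
lemma IsEulerElement.eq_zero_of_lie_eq_smul (hh : IsEulerElement h) {μ : ℝ} {w : 𝔤}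
    (hw : ⁅h, w⁆ = μ • w) (hμ : μ ^ 3 ≠ μ) : w = 0 := by
  have hcube : ⁅h, ⁅h, ⁅h, w⁆⁆⁆ = ⁅h, w⁆ := by
    obtain ⟨a, b, c, ha, hb, hc, rfl⟩ := hh.decomp w
    simp [ha, hb, hc]
  simp only [hw, lie_smul] at hcube
  have : (μ ^ 3 - μ) • w = 0 := by linear_combination (norm := module) hcube
  exact (smul_eq_zero.1 this).resolve_left (sub_ne_zero.2 hμ)

lemma lie_lie_of_degree {i j : ℝ} {a b : 𝔤} (ha : ⁅h, a⁆ = i • a) (hb : ⁅h, b⁆ = j • b) :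
    ⁅h, ⁅a, b⁆⁆ = (i + j) • ⁅a, b⁆ := by
  rw [leibniz_lie, ha, hb, smul_lie, lie_smul, add_smul]

lemma IsEulerElement.lie_eq_zero (hh : IsEulerElement h) {i j : ℝ} {a b : 𝔤}
    (ha : ⁅h, a⁆ = i • a) (hb : ⁅h, b⁆ = j • b) (hij : (i + j) ^ 3 ≠ i + j) : ⁅a, b⁆ = 0 :=
  hh.eq_zero_of_lie_eq_smul (lie_lie_of_degree ha hb) hij

/-- The subspace of degree `1` is abelian. -/
lemma IsEulerElement.lie_pos_pos (hh : IsEulerElement h) {a b : 𝔤}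
    (ha : ⁅h, a⁆ = a) (hb : ⁅h, b⁆ = b) : ⁅a, b⁆ = 0 :=
  hh.lie_eq_zero (i := 1) (j := 1) (by simpa using ha) (by simpa using hb) (by norm_num)

/-- The subspace of degree `-1` is abelian. -/
lemma IsEulerElement.lie_neg_neg (hh : IsEulerElement h) {a b : 𝔤}
    (ha : ⁅h, a⁆ = -a) (hb : ⁅h, b⁆ = -b) : ⁅a, b⁆ = 0 :=
  hh.lie_eq_zero (i := -1) (j := -1) (by simpa using ha) (by simpa using hb) (by norm_num)

lemma lie_zero_of_degree {𝔤 : Type*} [LieRing 𝔤] {h a b : 𝔤} (ha : ⁅h, a⁆ = a)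
    (hb : ⁅h, b⁆ = -b) : ⁅h, ⁅a, b⁆⁆ = 0 := by
  rw [leibniz_lie, ha, hb, lie_neg, add_neg_cancel]

lemma lie_pos_of_degree {𝔤 : Type*} [LieRing 𝔤] {h a b : 𝔤} (ha : ⁅h, a⁆ = a)
    (hb : ⁅h, b⁆ = 0) : ⁅h, ⁅a, b⁆⁆ = ⁅a, b⁆ := by
  rw [leibniz_lie, ha, hb, lie_zero, add_zero]

lemma lie_neg_of_degree {𝔤 : Type*} [LieRing 𝔤] {h a b : 𝔤} (ha : ⁅h, a⁆ = -a)
    (hb : ⁅h, b⁆ = 0) :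
    ⁅h, ⁅a, b⁆⁆ = -⁅a, b⁆ := by
  rw [leibniz_lie, ha, hb, lie_zero, add_zero, neg_lie]

lemma lie_neutral_of_degree {𝔤 : Type*} [LieRing 𝔤] {h a b : 𝔤} (ha : ⁅h, a⁆ = 0)
    (hb : ⁅h, b⁆ = 0) : ⁅h, ⁅a, b⁆⁆ = 0 := by
  rw [leibniz_lie, ha, hb, lie_zero, add_zero, zero_lie]

lemma IsEulerElement.ad_pow_three (hh : IsEulerElement h) {e : 𝔤} (he : ⁅h, e⁆ = e) :
    (LieAlgebra.ad ℝ 𝔤 e) ^ 3 = 0 := by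
  ext y
  obtain ⟨a, b, c, ha, hb, hc, rfl⟩ := hh.decomp y
  have h1 : ⁅e, ⁅e, ⁅e, a⁆⁆⁆ = 0 :=
    hh.lie_pos_pos he (lie_pos_of_degree he (lie_zero_of_degree he ha))
  have h2 : ⁅e, ⁅e, b⁆⁆ = 0 := hh.lie_pos_pos he (lie_pos_of_degree he hb)
  have h3 : ⁅e, c⁆ = 0 := hh.lie_pos_pos he hc
  simp [pow_succ, h1, h2, h3]

/-- The reflection `e^{πi ad x}` of an Euler element is an automorphism. -/
lemma IsEulerReflection.map_lie {x : 𝔤} (hx : IsEulerElement x) {σ : 𝔤 ≃ₗ[ℝ] 𝔤}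
    (hσ : IsEulerReflection x σ) (y z : 𝔤) : σ ⁅y, z⁆ = ⁅σ y, σ z⁆ := by
  obtain ⟨a, b, c, ha, hb, hc, rfl⟩ := hx.decomp y
  obtain ⟨a', b', c', ha', hb', hc', rfl⟩ := hx.decomp z
  have sk : ∀ u v : 𝔤, ⁅u, v⁆ = -⁅v, u⁆ := fun u v => (lie_skew u v).symm
  have s1 := (hσ _).2.2 ha
  have s2 := (hσ _).1 hb
  have s3 := (hσ _).2.1 hc
  have s1' := (hσ _).2.2 ha'
  have s2' := (hσ _).1 hb'
  have s3' := (hσ _).2.1 hc'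
  have aa := hx.lie_neg_neg ha ha'
  have ab := (hσ _).2.2 (lie_neg_of_degree ha hb')
  have ac : σ ⁅a, c'⁆ = ⁅a, c'⁆ := by
    rw [sk, map_neg, (hσ _).1 (lie_zero_of_degree hc' ha)]
  have ba : σ ⁅b, a'⁆ = -⁅b, a'⁆ := by
    rw [sk, map_neg, (hσ _).2.2 (lie_neg_of_degree ha' hb)]
  have bb := (hσ _).1 (lie_neutral_of_degree hb hb')
  have bc : σ ⁅b, c'⁆ = -⁅b, c'⁆ := by
    rw [sk, map_neg, (hσ _).2.1 (lie_pos_of_degree hc' hb)]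
  have ca := (hσ _).1 (lie_zero_of_degree hc ha')
  have cb := (hσ _).2.1 (lie_pos_of_degree hc hb')
  have cc := hx.lie_pos_pos hc hc'
  simp only [add_lie, lie_add, map_add, s1, s2, s3, s1', s2', s3', aa, ab, ac, ba, bb, bc, ca, cb,
    cc, map_zero, neg_lie, lie_neg]
  abel

/-- An automorphism that fixes an Euler element commutes with its reflection. -/
lemma IsEulerReflection.comm {x : 𝔤} (hx : IsEulerElement x) {σ : 𝔤 ≃ₗ[ℝ] 𝔤}
    (hσ : IsEulerReflection x σ) {φ : 𝔤 ≃ₗ[ℝ] 𝔤} (hφ : ∀ y z, φ ⁅y, z⁆ = ⁅φ y, φ z⁆)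
    (hfix : φ x = x) : φ * σ = σ * φ := by
  ext y
  change φ (σ y) = σ (φ y)
  obtain ⟨a, b, c, ha, hb, hc, rfl⟩ := hx.decomp y
  have k : ∀ v, ⁅x, φ v⁆ = φ ⁅x, v⁆ := fun v => by rw [hφ, hfix]
  simp only [map_add, (hσ _).2.2 ha, (hσ _).1 hb, (hσ _).2.1 hc,
    (hσ (φ a)).2.2 (by rw [k, ha, map_neg]), (hσ (φ b)).1 (by rw [k, hb, map_zero]),
    (hσ (φ c)).2.1 (by rw [k, hc]), map_neg]

/-- If `E³ = 0` and `[E, Y]` commutes with `E`, then `[E, Y]` is nilpotent. -/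
lemma isNilpotent_commutator {R : Type*} [Ring R] [Algebra ℝ R] {E Y : R} (hE : E ^ 3 = 0)
    (hc : E * (E * Y - Y * E) = (E * Y - Y * E) * E) : IsNilpotent (E * Y - Y * E) := by
  obtain ⟨C, hC⟩ : ∃ C, C = E * Y - Y * E := ⟨_, rfl⟩
  rw [← hC] at hc ⊢
  have cancel : ∀ (r : ℝ) (a : R), r ≠ 0 → r • a = 0 → a = 0 := fun r a hr h => by
    have : r⁻¹ • (r • a) = 0 := by rw [h, smul_zero]
    rwa [smul_smul, inv_mul_cancel₀ hr, one_smul] at this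
  have hEY : E * Y = C + Y * E := by rw [hC]; abel
  have hEYx : ∀ z, E * (Y * z) = C * z + Y * (E * z) := fun z => by
    rw [← mul_assoc, hEY, add_mul, mul_assoc]
  have hcx : ∀ z, E * (C * z) = C * (E * z) := fun z => by rw [← mul_assoc, hc, mul_assoc]
  have hEx : ∀ z, E * (E * (E * z)) = 0 := fun z => by
    rw [← mul_assoc, ← mul_assoc, ← pow_two, ← pow_succ, hE, zero_mul]
  have hE1 : E * (E * E) = 0 := by simpa using hEx 1
  -- Commuting `E³ = 0` with `Y` gives `E² C = 0`.
  have h1 : C * (E * E) = 0 := by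
    apply cancel 3 _ (by norm_num)
    have : E * (E * (E * Y)) = 0 := hEx Y
    simp only [hEY, hEYx, mul_add, hcx, hc, hE1, mul_zero] at this
    linear_combination (norm := module) this
  have h1x : ∀ z, C * (E * (E * z)) = 0 := fun z => by
    rw [← mul_assoc E, ← mul_assoc, h1, zero_mul]
  -- Commuting `E² C = 0` with `Y` gives `E C³ = 0`.
  have h2 : C * (C * (C * E)) = 0 := by
    apply cancel 2 _ (by norm_num)
    have h3 : C * (E * (E * (Y * C))) = 0 := h1x _
    simp only [hEYx, mul_add, hcx, hc, h1, mul_zero] at h3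
    linear_combination (norm := module) h3
  have h2x : ∀ z, C * (C * (C * (E * z))) = 0 := fun z => by
    simpa only [mul_assoc, zero_mul] using congrArg (· * z) h2
  -- Commuting `E C³ = 0` with `Y` gives `C⁷ = 0`.
  refine ⟨7, ?_⟩
  have h3 : C * (C * (C * (E * (Y * (C * (C * C)))))) = 0 := h2x _
  simp only [hEYx, hcx, hc, h2, mul_zero, add_zero] at h3
  simpa [pow_succ, mul_assoc] using h3

end Grading

/-! ### Graded `sl₂`-triples -/

section Triples

variable {𝔤 : Type*} [LieRing 𝔤] [LieAlgebra ℝ 𝔤] {h e k f : 𝔤}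

/-- `(e, k, f)` is an `sl₂`-triple (possibly zero) with `e` of degree `1` and `f` of degree `-1`
with respect to `h`. -/
structure GradedTriple (h e k f : 𝔤) : Prop where
  he : ⁅h, e⁆ = e
  hf : ⁅h, f⁆ = -f
  ef : ⁅e, f⁆ = k
  ke : ⁅k, e⁆ = (2 : ℝ) • e
  kf : ⁅k, f⁆ = (-2 : ℝ) • f

namespace GradedTriple

lemma symm (T : GradedTriple h e k f) : GradedTriple (-h) f (-k) e where
  he := by rw [neg_lie, T.hf, neg_neg]
  hf := by rw [neg_lie, T.he]
  ef := by rw [← lie_skew, T.ef]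
  ke := by rw [neg_lie, T.kf, neg_smul, neg_neg]
  kf := by rw [neg_lie, T.ke, neg_smul]

lemma hk (T : GradedTriple h e k f) : ⁅h, k⁆ = 0 := by
  rw [← T.ef]; exact lie_zero_of_degree T.he T.hf

lemma lie_ef (T : GradedTriple h e k f) (v : 𝔤) : ⁅e, ⁅f, v⁆⁆ = ⁅f, ⁅e, v⁆⁆ + ⁅k, v⁆ := by
  rw [leibniz_lie, T.ef, add_comm]

lemma lie_ke (T : GradedTriple h e k f) (v : 𝔤) : ⁅k, ⁅e, v⁆⁆ = ⁅e, ⁅k, v⁆⁆ + (2 : ℝ) • ⁅e, v⁆ := by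
  rw [leibniz_lie, T.ke, add_comm, smul_lie]

lemma lie_kf (T : GradedTriple h e k f) (v : 𝔤) :
    ⁅k, ⁅f, v⁆⁆ = ⁅f, ⁅k, v⁆⁆ - (2 : ℝ) • ⁅f, v⁆ := by
  rw [leibniz_lie, T.kf, smul_lie]; module

lemma k_pos (T : GradedTriple h e k f) {v : 𝔤} (hv : ⁅h, v⁆ = v) : ⁅h, ⁅k, v⁆⁆ = ⁅k, v⁆ := by
  rw [leibniz_lie, T.hk, hv, zero_lie, zero_add]

/-- The weights of `k` in degree `1` are `0`, `1` and `2`. -/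
lemma weights_pos (hh : IsEulerElement h) (T : GradedTriple h e k f) {v : 𝔤} (hv : ⁅h, v⁆ = v) :
    ⁅k, ⁅k, ⁅k, v⁆⁆⁆ - (3 : ℝ) • ⁅k, ⁅k, v⁆⁆ + (2 : ℝ) • ⁅k, v⁆ = 0 := by
  have ev : ∀ {v : 𝔤}, ⁅h, v⁆ = v → ⁅e, v⁆ = 0 := fun hv => hh.lie_pos_pos T.he hv
  have fz : ∀ {v : 𝔤}, ⁅h, v⁆ = -v → ⁅f, v⁆ = 0 := fun hv => hh.lie_neg_neg T.hf hv
  have fp : ∀ {v : 𝔤}, ⁅h, v⁆ = v → ⁅h, ⁅f, v⁆⁆ = 0 := fun hv => by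
    rw [leibniz_lie, T.hf, hv, neg_lie, neg_add_cancel]
  -- If `F³ v = 0` then `F² (k - 2) v = 0`, and so on.
  have r3 : ∀ {v : 𝔤}, ⁅h, v⁆ = v → ⁅f, ⁅f, ⁅k, v⁆ - (2 : ℝ) • v⁆⁆ = 0 := by
    intro v hv
    have h0 : ⁅f, ⁅f, ⁅f, v⁆⁆⁆ = 0 := fz (lie_neg_of_degree T.hf (fp hv))
    have h1 : ⁅e, ⁅f, ⁅f, ⁅f, v⁆⁆⁆⁆ = 0 := by rw [h0, lie_zero]
    simp only [T.lie_ef, T.lie_kf, ev hv, lie_zero, lie_add, lie_sub, lie_smul] at h1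
    rw [lie_sub, lie_sub, lie_smul, lie_smul]
    linear_combination (norm := module) (1 / 3 : ℝ) • h1
  have r2 : ∀ {v : 𝔤}, ⁅h, v⁆ = v → ⁅f, ⁅f, v⁆⁆ = 0 → ⁅f, ⁅k, v⁆ - v⁆ = 0 := by
    intro v hv h0
    have h1 : ⁅e, ⁅f, ⁅f, v⁆⁆⁆ = 0 := by rw [h0, lie_zero]
    simp only [T.lie_ef, T.lie_kf, ev hv, lie_zero, lie_add] at h1
    rw [lie_sub]
    linear_combination (norm := module) (1 / 2 : ℝ) • h1
  have r1 : ∀ {v : 𝔤}, ⁅h, v⁆ = v → ⁅f, v⁆ = 0 → ⁅k, v⁆ = 0 := by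
    intro v hv h0
    have h1 : ⁅e, ⁅f, v⁆⁆ = 0 := by rw [h0, lie_zero]
    rwa [T.lie_ef, ev hv, lie_zero, zero_add] at h1
  have d2 : ⁅h, ⁅k, v⁆ - (2 : ℝ) • v⁆ = ⁅k, v⁆ - (2 : ℝ) • v := by
    rw [lie_sub, lie_smul, T.k_pos hv, hv]
  have d1 : ⁅h, ⁅k, ⁅k, v⁆ - (2 : ℝ) • v⁆ - (⁅k, v⁆ - (2 : ℝ) • v)⁆ =
      ⁅k, ⁅k, v⁆ - (2 : ℝ) • v⁆ - (⁅k, v⁆ - (2 : ℝ) • v) := by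
    rw [lie_sub, T.k_pos d2, d2]
  have h1 := r1 d1 (r2 d2 (r3 hv))
  simp only [lie_sub, lie_smul] at h1
  linear_combination (norm := module) h1

/-- The weights of `k` in degree `-1` are `0`, `-1` and `-2`. -/
lemma weights_neg (hh : IsEulerElement h) (T : GradedTriple h e k f) {v : 𝔤} (hv : ⁅h, v⁆ = -v) :
    ⁅k, ⁅k, ⁅k, v⁆⁆⁆ + (3 : ℝ) • ⁅k, ⁅k, v⁆⁆ + (2 : ℝ) • ⁅k, v⁆ = 0 := by
  have := T.symm.weights_pos hh.neg (v := v) (by rw [neg_lie, hv, neg_neg])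
  simp only [neg_lie, lie_neg] at this
  linear_combination (norm := module) (-1 : ℝ) • this

/-- The weights of `k` in degree `0` are `0`, `1` and `-1`. -/
lemma weights_zero (hh : IsEulerElement h) (T : GradedTriple h e k f) {v : 𝔤} (hv : ⁅h, v⁆ = 0) :
    ⁅k, ⁅k, ⁅k, v⁆⁆⁆ = ⁅k, v⁆ := by
  have kz : ∀ {v : 𝔤}, ⁅h, v⁆ = 0 → ⁅h, ⁅k, v⁆⁆ = 0 := fun hv => lie_neutral_of_degree T.hk hv
  have ee : ∀ {v : 𝔤}, ⁅h, v⁆ = 0 → ⁅e, ⁅e, v⁆⁆ = 0 := fun hv =>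
    hh.lie_pos_pos T.he (lie_pos_of_degree T.he hv)
  have ff : ⁅f, ⁅f, v⁆⁆ = 0 := hh.lie_neg_neg T.hf (lie_neg_of_degree T.hf hv)
  -- `2 F E k = - k (k - 1)` in degree zero
  have A : ∀ {v : 𝔤}, ⁅h, v⁆ = 0 →
      (2 : ℝ) • ⁅f, ⁅e, ⁅k, v⁆⁆⁆ + ⁅k, ⁅k, v⁆⁆ - ⁅k, v⁆ = 0 := by
    intro v hv
    have ff : ⁅f, ⁅f, v⁆⁆ = 0 := hh.lie_neg_neg T.hf (lie_neg_of_degree T.hf hv)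
    have h1 : ⁅e, ⁅e, ⁅f, ⁅f, v⁆⁆⁆⁆ = 0 := by rw [ff, lie_zero, lie_zero]
    simp only [T.lie_ef, T.lie_kf, T.lie_ke, ee hv, lie_zero, lie_add, lie_sub,
      lie_smul] at h1
    linear_combination (norm := module) (1 / 2 : ℝ) • h1
  -- `E k (k + 1) = 0` in degree zero
  have B : ⁅e, ⁅k, ⁅k, v⁆⁆⁆ + ⁅e, ⁅k, v⁆⁆ = 0 := by
    have h1 := congrArg (fun w => ⁅e, w⁆) (A hv)
    simp only [T.lie_ef, T.lie_ke, ee (kz hv), lie_zero, lie_add, lie_sub, lie_smul] at h1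
    linear_combination (norm := module) (1 / 3 : ℝ) • h1
  have h1 := A (v := ⁅k, v⁆ + v) (by rw [lie_add, kz hv, hv, add_zero])
  simp only [lie_add, B, lie_zero, smul_zero] at h1
  linear_combination (norm := module) h1

/-- The weights of `k` are `0`, `±1` and `±2`. -/
lemma weights (hh : IsEulerElement h) (T : GradedTriple h e k f) (v : 𝔤) :
    ⁅k, ⁅k, ⁅k, ⁅k, ⁅k, v⁆⁆⁆⁆⁆ - (5 : ℝ) • ⁅k, ⁅k, ⁅k, v⁆⁆⁆ + (4 : ℝ) • ⁅k, v⁆ = 0 := by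
  obtain ⟨a, b, c, ha, hb, hc, rfl⟩ := hh.decomp v
  have h1 := T.weights_neg hh ha
  have h2 := T.weights_zero hh hb
  have h3 := T.weights_pos hh hc
  have h1' := congrArg (fun w => ⁅k, w⁆) h1
  have h1'' := congrArg (fun w => ⁅k, w⁆) h1'
  have h2' := congrArg (fun w => ⁅k, ⁅k, w⁆⁆) h2
  have h3' := congrArg (fun w => ⁅k, w⁆) h3
  have h3'' := congrArg (fun w => ⁅k, w⁆) h3'
  simp only [lie_add, lie_sub, lie_smul, lie_zero] at *
  linear_combination (norm := module) h1'' - (3 : ℝ) • h1' + (2 : ℝ) • h1 + h2' - (4 : ℝ) • h2 +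
    h3'' + (3 : ℝ) • h3' + (2 : ℝ) • h3

/-- If `[k, f] = -2 f` fails, it can be achieved by changing `f`. -/
lemma of_lie (hh : IsEulerElement h) (he : ⁅h, e⁆ = e) (hf : ⁅h, f⁆ = -f)
    (hefe : ⁅⁅e, f⁆, e⁆ = (2 : ℝ) • e) :
    GradedTriple h e ⁅e, f⁆ ((-1 / 2 : ℝ) • ⁅⁅e, f⁆, f⁆) := by
  obtain ⟨k, hk⟩ : ∃ k, k = ⁅e, f⁆ := ⟨_, rfl⟩
  have hk0 : ⁅h, k⁆ = 0 := hk ▸ lie_zero_of_degree he hf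
  have hkf : ⁅h, ⁅k, f⁆⁆ = -⁅k, f⁆ := by rw [leibniz_lie, hk0, hf, zero_lie, zero_add, lie_neg]
  rw [← hk] at hefe ⊢
  have hek : ⁅e, k⁆ = (-2 : ℝ) • e := by rw [← lie_skew, hefe, neg_smul]
  have hekf : ⁅e, ⁅k, f⁆⁆ = (-2 : ℝ) • k := by
    rw [leibniz_lie, hek, smul_lie, ← hk, lie_self, add_zero]
  refine ⟨he, by rw [lie_smul, hkf, smul_neg], ?_, hefe, ?_⟩
  · rw [lie_smul, hekf, smul_smul]; norm_num
  · obtain ⟨w, hw⟩ : ∃ w, w = ⁅k, f⁆ + (2 : ℝ) • f := ⟨_, rfl⟩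
    have hew : ⁅e, w⁆ = 0 := by rw [hw, lie_add, lie_smul, hekf, ← hk]; module
    have hfw : ⁅f, w⁆ = 0 := hh.lie_neg_neg hf (by rw [hw, lie_add, lie_smul, hkf, hf]; module)
    have hkw : ⁅k, w⁆ = 0 := by rw [hk, lie_lie, hfw, hew, lie_zero, lie_zero, sub_zero]
    rw [hw, lie_add, lie_smul] at hkw
    rw [lie_smul]
    linear_combination (norm := module) (-1 / 2 : ℝ) • hkw

end GradedTriple

lemma killingForm_lie_left (a b c : 𝔤) :
    killingForm ℝ 𝔤 ⁅a, b⁆ c = -killingForm ℝ 𝔤 b ⁅a, c⁆ := by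
  rw [← lie_skew, map_neg, LinearMap.neg_apply]
  exact congrArg _ (LieModule.traceForm_apply_lie_apply ℝ 𝔤 𝔤 b a c)

/-- Homogeneous components are Killing orthogonal unless their degrees add up to `0`. -/
lemma killingForm_eq_zero_of_degree {i j : ℝ} {a b : 𝔤} (ha : ⁅h, a⁆ = i • a) (hb : ⁅h, b⁆ = j • b)
    (hij : i + j ≠ 0) : killingForm ℝ 𝔤 a b = 0 := by
  have h1 := killingForm_lie_left h a b
  rw [ha, hb, map_smul, map_smul, LinearMap.smul_apply, smul_eq_mul, smul_eq_mul] at h1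
  have : (i + j) * killingForm ℝ 𝔤 a b = 0 := by linear_combination h1
  exact (mul_eq_zero.1 this).resolve_left hij

/-- For `e` of degree `1`, elements of `ker (ad e)²` of degree `-1` are Killing orthogonal to `e`. -/
lemma killingForm_eq_zero_of_lie_lie_eq_zero (hh : IsEulerElement h) (he : ⁅h, e⁆ = e) {z : 𝔤}
    (hz : ⁅h, z⁆ = -z) (hez : ⁅e, ⁅e, z⁆⁆ = 0) : killingForm ℝ 𝔤 e z = 0 := by
  have h1 : killingForm ℝ 𝔤 e z = killingForm ℝ 𝔤 h ⁅e, z⁆ := by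
    conv_lhs => rw [← he]
    exact LieModule.traceForm_apply_lie_apply ℝ 𝔤 𝔤 h e z
  have had : LieAlgebra.ad ℝ 𝔤 ⁅e, z⁆ = LieAlgebra.ad ℝ 𝔤 e * LieAlgebra.ad ℝ 𝔤 z -
      LieAlgebra.ad ℝ 𝔤 z * LieAlgebra.ad ℝ 𝔤 e := by
    rw [LieHom.map_lie]; rfl
  have hnil : IsNilpotent (LieAlgebra.ad ℝ 𝔤 ⁅e, z⁆) := by
    rw [had]
    refine isNilpotent_commutator (hh.ad_pow_three he) ?_
    rw [← had, ← sub_eq_zero]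
    change ⁅LieAlgebra.ad ℝ 𝔤 e, LieAlgebra.ad ℝ 𝔤 ⁅e, z⁆⁆ = 0
    rw [← LieHom.map_lie, hez, map_zero]
  have hcomm : Commute (LieAlgebra.ad ℝ 𝔤 h) (LieAlgebra.ad ℝ 𝔤 ⁅e, z⁆) := by
    rw [commute_iff_lie_eq, ← LieHom.map_lie, lie_zero_of_degree he hz, map_zero]
  rw [h1, killingForm_apply_apply]
  exact (LinearMap.isNilpotent_trace_of_isNilpotent (hcomm.isNilpotent_mul_left hnil)).eq_zero

namespace GradedTriple

/-- The Peirce-2 space of a graded triple: the vectors of degree `1` and of `k`-weight `2`. -/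
def peirceTwo (h k : 𝔤) : Submodule ℝ 𝔤 :=
  LinearMap.ker (LieAlgebra.ad ℝ 𝔤 h - 1) ⊓ LinearMap.ker (LieAlgebra.ad ℝ 𝔤 k - 2)

lemma mem_peirceTwo {v : 𝔤} : v ∈ peirceTwo h k ↔ ⁅h, v⁆ = v ∧ ⁅k, v⁆ = (2 : ℝ) • v := by
  simp only [peirceTwo, Submodule.mem_inf, LinearMap.mem_ker, LinearMap.sub_apply,
    LieAlgebra.ad_apply, Module.End.one_apply, sub_eq_zero]
  refine and_congr_right fun _ => ?_
  rw [show ((2 : Module.End ℝ 𝔤) v) = (2 : ℝ) • v by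
    rw [← one_add_one_eq_two, LinearMap.add_apply, Module.End.one_apply, two_smul]]

/-- If `k = 2 h`, then the Weyl reflection `e^{ad e} e^{-ad f} e^{ad e}` maps `h` to `-h`. -/
lemma isSymmetricElement [FiniteDimensional ℝ 𝔤] (T : GradedTriple h e ((2 : ℝ) • h) f) : IsSymmetricElement h := by
  refine ⟨expAd e * expAd (-f) * expAd e,
    mul_mem (mul_mem (expAd_mem_inn _) (expAd_mem_inn _)) (expAd_mem_inn _), ?_⟩
  have eh : ⁅e, h⁆ = -e := by rw [← lie_skew, T.he]
  have fh : ⁅f, h⁆ = f := by rw [← lie_skew, T.hf, neg_neg]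
  have fe : ⁅f, e⁆ = (-2 : ℝ) • h := by rw [← lie_skew, T.ef, neg_smul]
  have h1 : expAd e h = h - e := by
    rw [expAd_apply_of_nilpotent (by simp [eh]), eh]
    simp [sub_eq_add_neg]
  have h2 : expAd (-f) (h - e) = -h - e := by
    rw [expAd_apply_of_nilpotent (by simp [fh, fe])]
    simp only [neg_lie, lie_neg, lie_sub, lie_smul, lie_self, fh, fe]
    module
  have h3 : expAd e (-h - e) = -h := by
    rw [expAd_apply_of_nilpotent (by simp [eh])]
    simp [eh]
  change expAd e (expAd (-f) (expAd e h)) = -h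
  rw [h1, h2, h3]

end GradedTriple

/-- An element of degree `0` that commutes with everything of degree `±1` vanishes, because such
elements form a proper ideal. -/
lemma IsEulerElement.eq_zero_of_lie_eq_zero [LieAlgebra.IsSimple ℝ 𝔤] (hh : IsEulerElement h) {c : 𝔤}
    (hc : ⁅h, c⁆ = 0) (hpos : ∀ v : 𝔤, ⁅h, v⁆ = v → ⁅c, v⁆ = 0)
    (hneg : ∀ v : 𝔤, ⁅h, v⁆ = -v → ⁅c, v⁆ = 0) : c = 0 := by
  let I : LieIdeal ℝ 𝔤 :=
    { carrier := {c | ⁅h, c⁆ = 0 ∧ (∀ v : 𝔤, ⁅h, v⁆ = v → ⁅c, v⁆ = 0) ∧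
        ∀ v : 𝔤, ⁅h, v⁆ = -v → ⁅c, v⁆ = 0}
      add_mem' := fun {a b} ha hb => ⟨by rw [lie_add, ha.1, hb.1, add_zero],
        fun v hv => by rw [add_lie, ha.2.1 v hv, hb.2.1 v hv, add_zero],
        fun v hv => by rw [add_lie, ha.2.2 v hv, hb.2.2 v hv, add_zero]⟩
      zero_mem' := by simp
      smul_mem' := fun r a ha => ⟨by rw [lie_smul, ha.1, smul_zero],
        fun v hv => by rw [smul_lie, ha.2.1 v hv, smul_zero],
        fun v hv => by rw [smul_lie, ha.2.2 v hv, smul_zero]⟩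
      lie_mem := by
        rintro y m ⟨hm0, hm1, hm2⟩
        obtain ⟨a, b, c, ha, hb, hc, rfl⟩ := hh.decomp y
        have e1 : ⁅a, m⁆ = 0 := by rw [← lie_skew, hm2 a ha, neg_zero]
        have e2 : ⁅c, m⁆ = 0 := by rw [← lie_skew, hm1 c hc, neg_zero]
        rw [add_lie, add_lie, e1, e2, zero_add, add_zero]
        refine ⟨lie_neutral_of_degree hb hm0, fun v hv => ?_, fun v hv => ?_⟩
        · rw [lie_lie, hm1 v hv, lie_zero, zero_sub,
            hm1 _ (by rw [leibniz_lie, hb, hv, zero_lie, zero_add]), neg_zero]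
        · rw [lie_lie, hm2 v hv, lie_zero, zero_sub,
            hm2 _ (by rw [leibniz_lie, hb, hv, zero_lie, zero_add, lie_neg]), neg_zero] }
  have hcI : c ∈ I := ⟨hc, hpos, hneg⟩
  rcases LieAlgebra.IsSimple.eq_bot_or_eq_top (R := ℝ) I with hI | hI
  · rw [hI] at hcI; simpa using hcI
  · have hhI : h ∈ I := by rw [hI]; trivial
    refine absurd ?_ hh.1
    ext y
    obtain ⟨a, b, c, ha, hb, hc, rfl⟩ := hh.decomp y
    simp [hhI.2.1 c hc, hhI.2.2 a ha, hb]

variable [FiniteDimensional ℝ 𝔤] [LieAlgebra.IsSimple ℝ 𝔤]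

/-- A graded version of the Jacobson-Morozov theorem. -/
lemma exists_lie_lie_eq (hh : IsEulerElement h) (he : ⁅h, e⁆ = e) :
    ∃ f : 𝔤, ⁅h, f⁆ = -f ∧ ⁅⁅e, f⁆, e⁆ = (2 : ℝ) • e := by
  have hdeg : ∀ y a b c : 𝔤, ⁅h, a⁆ = -a → ⁅h, b⁆ = 0 → ⁅h, c⁆ = c → y = a + b + c →
      ⁅e, ⁅e, y⁆⁆ = ⁅e, ⁅e, a⁆⁆ := by
    rintro _ a b c ha hb hc rfl
    rw [lie_add, lie_add, hh.lie_pos_pos he hc, lie_zero, add_zero, lie_add, lie_add,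
      hh.lie_pos_pos he (lie_pos_of_degree he hb), add_zero]
  have hmem : e ∈ LinearMap.range ((LieAlgebra.ad ℝ 𝔤 e) ^ 2) := by
    by_contra hne
    obtain ⟨ξ, hξe, hξ⟩ := Submodule.exists_le_ker_of_notMem hne
    have hnd : (killingForm ℝ 𝔤).Nondegenerate := LieAlgebra.IsKilling.killingForm_nondegenerate ℝ 𝔤
    obtain ⟨z, rfl⟩ := (LinearMap.BilinForm.toDual (killingForm ℝ 𝔤) hnd).surjective ξ
    have hz : ⁅e, ⁅e, z⁆⁆ = 0 := by
      apply (LinearMap.BilinForm.toDual (killingForm ℝ 𝔤) hnd).injective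
      ext y
      have h1 := hξ (LinearMap.mem_range_self _ y)
      simp only [LinearMap.mem_ker, LinearMap.BilinForm.toDual_def, pow_two, Module.End.mul_apply,
        LieAlgebra.ad_apply, map_zero, LinearMap.zero_apply] at h1 ⊢
      rw [killingForm_lie_left, killingForm_lie_left, neg_neg, h1]
    obtain ⟨a, b, c, ha, hb, hc, hd⟩ := hh.decomp z
    apply hξe
    rw [LinearMap.BilinForm.toDual_def]
    rw [hdeg z a b c ha hb hc hd] at hz
    have h1 := killingForm_eq_zero_of_lie_lie_eq_zero hh he ha hz
    have h2 := killingForm_eq_zero_of_degree (h := h) (i := 1) (j := 0) (a := e) (b := b)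
      (by simpa using he) (by simpa using hb) (by norm_num)
    have h3 := killingForm_eq_zero_of_degree (h := h) (i := 1) (j := 1) (a := e) (b := c)
      (by simpa using he) (by simpa using hc) (by norm_num)
    rw [hd, map_add, map_add, LinearMap.add_apply, LinearMap.add_apply,
      LieModule.traceForm_comm, h1, LieModule.traceForm_comm, h2, LieModule.traceForm_comm, h3]
    simp
  obtain ⟨y, hy⟩ := hmem
  obtain ⟨a, b, c, ha, hb, hc, hd⟩ := hh.decomp y
  refine ⟨(-2 : ℝ) • a, by rw [lie_smul, ha, smul_neg], ?_⟩
  have h1 : ⁅e, ⁅e, a⁆⁆ = e := by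
    rw [← hdeg y a b c ha hb hc hd]
    simpa only [pow_two, Module.End.mul_apply, LieAlgebra.ad_apply] using hy
  rw [lie_smul, smul_lie, ← lie_skew, h1]
  module

namespace GradedTriple

/-- A vector `e'` of degree `1` and `k`-weight `0` allows to enlarge the Peirce-2 space: complete
`e'` to a graded triple that commutes with the given one, and add the two triples. -/
lemma exists_peirceTwo_lt (hh : IsEulerElement h) (T : GradedTriple h e k f) {e' : 𝔤}
    (he' : ⁅h, e'⁆ = e') (hke' : ⁅k, e'⁆ = 0) (hne : e' ≠ 0) :
    ∃ e₁ k₁ f₁, GradedTriple h e₁ k₁ f₁ ∧ peirceTwo h k < peirceTwo h k₁ := by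
  obtain ⟨f₀, hf₀, hef₀⟩ := exists_lie_lie_eq hh he'
  have kdeg : ∀ {v : 𝔤}, ⁅h, v⁆ = -v → ⁅h, ⁅k, v⁆⁆ = -⁅k, v⁆ := fun hv => by
    rw [leibniz_lie, T.hk, hv, zero_lie, zero_add, lie_neg]
  -- the component of `k`-weight `0` of `f₀`
  obtain ⟨f₁, hf₁⟩ : ∃ f₁, f₁ = (1 / 2 : ℝ) • (⁅k, ⁅k, f₀⁆⁆ + (3 : ℝ) • ⁅k, f₀⁆) + f₀ := ⟨_, rfl⟩
  have hhf₁ : ⁅h, f₁⁆ = -f₁ := by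
    rw [hf₁]; simp only [lie_add, lie_smul, kdeg (kdeg hf₀), kdeg hf₀, hf₀]; module
  have hkf₁ : ⁅k, f₁⁆ = 0 := by
    have := T.weights_neg hh hf₀
    rw [hf₁]; simp only [lie_add, lie_smul]
    linear_combination (norm := module) (1 / 2 : ℝ) • this
  have comm : ∀ v : 𝔤, ⁅⁅e', ⁅k, v⁆⁆, e'⁆ = ⁅k, ⁅⁅e', v⁆, e'⁆⁆ := by
    intro v
    rw [leibniz_lie k, leibniz_lie k, hke', zero_lie, zero_add, lie_zero, add_zero]
  have hef₁ : ⁅⁅e', f₁⁆, e'⁆ = (2 : ℝ) • e' := by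
    rw [hf₁]
    simp only [lie_add, lie_smul, add_lie, smul_lie, comm, hef₀, hke', lie_zero, smul_zero]
    module
  have T' := of_lie hh he' hhf₁ hef₁
  obtain ⟨k', hk'⟩ : ∃ k', k' = ⁅e', f₁⁆ := ⟨_, rfl⟩
  obtain ⟨f', hf'⟩ : ∃ f', f' = (-1 / 2 : ℝ) • ⁅⁅e', f₁⁆, f₁⁆ := ⟨_, rfl⟩
  rw [← hf', ← hk'] at T'
  have hkk' : ⁅k, k'⁆ = 0 := by rw [hk', leibniz_lie, hke', hkf₁, lie_zero, zero_lie, add_zero]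
  have hkf' : ⁅k, f'⁆ = 0 := by
    rw [hf', lie_smul, leibniz_lie, ← hk', hkk', hkf₁, lie_zero, zero_lie, add_zero, smul_zero]
  -- vectors of degree `0` and weight `±2` vanish
  have van : ∀ {w : 𝔤} {μ : ℝ}, ⁅h, w⁆ = 0 → ⁅k, w⁆ = μ • w → μ ^ 3 ≠ μ → w = 0 := by
    intro w μ hw hkw hμ
    have := T.weights_zero hh hw
    simp only [hkw, lie_smul] at this
    have h0 : (μ ^ 3 - μ) • w = 0 := by linear_combination (norm := module) this
    exact (smul_eq_zero.1 h0).resolve_left (sub_ne_zero.2 hμ)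
  have hef' : ⁅e, f'⁆ = 0 := by
    refine van (μ := 2) (lie_zero_of_degree T.he T'.hf) ?_ (by norm_num)
    rw [leibniz_lie, T.ke, hkf', lie_zero, add_zero, smul_lie]
  have he'f : ⁅e', f⁆ = 0 := by
    refine van (μ := -2) (lie_zero_of_degree he' T.hf) ?_ (by norm_num)
    rw [leibniz_lie, T.kf, hke', zero_lie, zero_add, lie_smul]
  have hee' : ⁅e', e⁆ = 0 := hh.lie_pos_pos he' T.he
  have hff' : ⁅f', f⁆ = 0 := hh.lie_neg_neg T'.hf T.hf
  have hk'e : ⁅k', e⁆ = 0 := by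
    rw [← T'.ef, lie_lie, hee', lie_zero, sub_zero, ← lie_skew f' e, hef', neg_zero, lie_zero]
  have hk'f : ⁅k', f⁆ = 0 := by
    rw [← T'.ef, lie_lie, he'f, hff', lie_zero, lie_zero, sub_zero]
  have hsum : GradedTriple h (e + e') (k + k') (f + f') := by
    refine ⟨by rw [lie_add, T.he, he'], by rw [lie_add, T.hf, T'.hf, neg_add], ?_, ?_, ?_⟩
    · rw [add_lie, lie_add, lie_add, T.ef, T'.ef, hef', he'f, add_zero, zero_add]
    · rw [add_lie, lie_add, lie_add, T.ke, T'.ke, hk'e, hke', add_zero, zero_add, smul_add]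
    · rw [add_lie, lie_add, lie_add, T.kf, T'.kf, hk'f, hkf', add_zero, zero_add, smul_add]
  refine ⟨_, _, _, hsum, lt_of_le_of_ne (fun v hv => ?_) fun heq => ?_⟩
  · rw [mem_peirceTwo] at hv ⊢
    obtain ⟨hv1, hv2⟩ := hv
    refine ⟨hv1, ?_⟩
    have swap : ∀ v : 𝔤, ⁅k, ⁅k', v⁆⁆ = ⁅k', ⁅k, v⁆⁆ := fun v => by
      rw [leibniz_lie, hkk', zero_lie, zero_add]
    -- `k'` satisfies both `x (x - 1) (x - 2) = 0` and `x (x + 1) (x + 2) = 0` at `v`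
    have h1 := T'.weights_pos hh hv1
    have h2 := hsum.weights_pos hh hv1
    simp only [add_lie, lie_add, swap, hv2, lie_smul] at h2
    have h3 : ⁅k', ⁅k', v⁆⁆ = 0 := by
      linear_combination (norm := module) (1 / 6 : ℝ) • h2 - (1 / 6 : ℝ) • h1
    have h4 : ⁅k', v⁆ = 0 := by
      rw [h3, lie_zero] at h1
      linear_combination (norm := module) (1 / 2 : ℝ) • h1
    rw [add_lie, hv2, h4, add_zero]
  · have h1 : e' ∈ peirceTwo h k := by
      rw [heq, mem_peirceTwo, add_lie, hke', T'.ke, zero_add]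
      exact ⟨he', rfl⟩
    rw [mem_peirceTwo, hke'] at h1
    exact hne ((smul_eq_zero.1 h1.2.symm).resolve_left (by norm_num))

/-- Around a non-symmetric Euler element there is a graded triple with an odd weight. Indeed, if the
Peirce-2 space is maximal, then there is no weight `0` in degree `1`; and without the weight `1`,
`k` would be `2 h`. -/
lemma exists_odd_weight (hh : IsEulerElement h) (hns : ¬ IsSymmetricElement h) :
    ∃ e k f v : 𝔤, GradedTriple h e k f ∧ ⁅h, v⁆ = v ∧ ⁅k, v⁆ = v ∧ v ≠ 0 := by
  obtain ⟨n, ⟨⟨e, k, f⟩, T, hn⟩, hmax⟩ := BddAbove.exists_isGreatest_of_nonempty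
    (S := {n : ℕ | ∃ t : 𝔤 × 𝔤 × 𝔤, GradedTriple h t.1 t.2.1 t.2.2 ∧
      Module.finrank ℝ (peirceTwo h t.2.1) = n})
    ⟨Module.finrank ℝ 𝔤, by rintro _ ⟨t, -, rfl⟩; exact Submodule.finrank_le _⟩
    ⟨_, (0, 0, 0), ⟨by simp, by simp, by simp, by simp, by simp⟩, rfl⟩
  dsimp only at T hn
  have w0 : ∀ v : 𝔤, ⁅h, v⁆ = v → ⁅k, v⁆ = 0 → v = 0 := by
    intro v hv hkv
    by_contra hne
    obtain ⟨e₁, k₁, f₁, T₁, hlt⟩ := T.exists_peirceTwo_lt hh hv hkv hne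
    have : Module.finrank ℝ (peirceTwo h k₁) ≤ n := hmax ⟨(e₁, k₁, f₁), T₁, rfl⟩
    have := Submodule.finrank_lt_finrank_of_lt hlt
    omega
  by_contra hcon
  push Not at hcon
  have w1 : ∀ v : 𝔤, ⁅h, v⁆ = v → ⁅k, v⁆ = v → v = 0 := fun v hv hkv => hcon e k f v T hv hkv
  have hpos : ∀ v : 𝔤, ⁅h, v⁆ = v → ⁅k, v⁆ = (2 : ℝ) • v := by
    intro v hv
    have h1 := T.weights_pos hh hv
    have h2 := w0 (⁅k, ⁅k, v⁆⁆ - (3 : ℝ) • ⁅k, v⁆ + (2 : ℝ) • v)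
      (by simp only [lie_add, lie_sub, lie_smul, T.k_pos (T.k_pos hv), T.k_pos hv, hv])
      (by simp only [lie_add, lie_sub, lie_smul]; exact h1)
    have h3 := w1 (⁅k, v⁆ - (2 : ℝ) • v) (by simp only [lie_sub, lie_smul, T.k_pos hv, hv])
      (by simp only [lie_sub, lie_smul]; linear_combination (norm := module) h2)
    linear_combination (norm := module) h3
  have hneg : ∀ v : 𝔤, ⁅h, v⁆ = -v → ⁅k, v⁆ = (-2 : ℝ) • v := by
    intro v hv
    have hnd : (killingForm ℝ 𝔤).Nondegenerate := LieAlgebra.IsKilling.killingForm_nondegenerate ℝ 𝔤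
    have hkv : ⁅h, ⁅k, v⁆⁆ = -⁅k, v⁆ := by rw [leibniz_lie, T.hk, hv, zero_lie, zero_add, lie_neg]
    have hd : ⁅h, ⁅k, v⁆ + (2 : ℝ) • v⁆ = (-1 : ℝ) • (⁅k, v⁆ + (2 : ℝ) • v) := by
      rw [lie_add, lie_smul, hkv, hv]; module
    have h0 : ⁅k, v⁆ + (2 : ℝ) • v = 0 := by
      apply (LinearMap.BilinForm.toDual (killingForm ℝ 𝔤) hnd).injective
      ext y
      obtain ⟨a, b, c, ha, hb, hc, rfl⟩ := hh.decomp y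
      rw [map_zero, LinearMap.zero_apply, LinearMap.BilinForm.toDual_def, map_add, map_add,
        killingForm_eq_zero_of_degree (j := -1) hd (by simpa using ha) (by norm_num),
        killingForm_eq_zero_of_degree (j := 0) hd (by simpa using hb) (by norm_num),
        map_add, LinearMap.add_apply, killingForm_lie_left, hpos c hc]
      simp
    linear_combination (norm := module) h0
  have hk : k - (2 : ℝ) • h = 0 := by
    refine hh.eq_zero_of_lie_eq_zero ?_ (fun v hv => ?_) fun v hv => ?_
    · rw [lie_sub, T.hk, lie_smul, lie_self, smul_zero, sub_zero]
    · rw [sub_lie, smul_lie, hpos v hv, hv, sub_self]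
    · rw [sub_lie, smul_lie, hneg v hv, hv]; module
  rw [sub_eq_zero] at hk
  exact hns (hk ▸ T).isSymmetricElement

end GradedTriple

end Triples

/-! ### Integrating `sl₂`-representations to `SL₂(ℝ)` -/

section Integration

attribute [local instance] endNormedRing endNormedAlgebra

/-- Two families of generators of groups `G` and `H` define an isomorphism if the relations between
the generators of `G` are the same as those between the generators of `H`. -/
lemma exists_mulEquiv_of_generators {G H ι : Type*} [Group G] [Group H] {a : ι → G} {b : ι → H}
    (ha : Subgroup.closure (Set.range a) = ⊤) (hb : Subgroup.closure (Set.range b) = ⊤)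
    (h1 : ∀ g, (g, (1 : H)) ∈ Subgroup.closure (Set.range fun i => (a i, b i)) → g = 1)
    (h2 : ∀ γ, ((1 : G), γ) ∈ Subgroup.closure (Set.range fun i => (a i, b i)) → γ = 1) :
    ∃ Φ : G ≃* H, ∀ i, Φ (a i) = b i := by
  set Γ := Subgroup.closure (Set.range fun i => (a i, b i)) with hΓ
  have hf : Function.Bijective ((MonoidHom.fst G H).comp Γ.subtype) := by
    constructor
    · rw [injective_iff_map_eq_one]
      rintro ⟨⟨g, γ⟩, hp⟩ (h : g = 1)
      subst h
      obtain rfl := h2 _ hp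
      rfl
    · rw [← MonoidHom.range_eq_top, MonoidHom.range_comp, Subgroup.range_subtype, hΓ,
        MonoidHom.map_closure, ← Set.range_comp]
      exact ha
  have hs : Function.Bijective ((MonoidHom.snd G H).comp Γ.subtype) := by
    constructor
    · rw [injective_iff_map_eq_one]
      rintro ⟨⟨g, γ⟩, hp⟩ (h : γ = 1)
      subst h
      obtain rfl := h1 _ hp
      rfl
    · rw [← MonoidHom.range_eq_top, MonoidHom.range_comp, Subgroup.range_subtype, hΓ,
        MonoidHom.map_closure, ← Set.range_comp]
      exact hb
  refine ⟨(MulEquiv.ofBijective _ hf).symm.trans (MulEquiv.ofBijective _ hs), fun i => ?_⟩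
  have : (MulEquiv.ofBijective _ hf).symm (a i) =
      ⟨(a i, b i), Subgroup.subset_closure ⟨i, rfl⟩⟩ := by
    rw [MulEquiv.symm_apply_eq]; rfl
  rw [MulEquiv.trans_apply, this]
  rfl

lemma exp_matrix_of_sq_eq_zero {N : Matrix (Fin 2) (Fin 2) ℝ} (hN : N * N = 0) :
    NormedSpace.exp N = 1 + N := by
  let := Matrix.linftyOpNormedRing (n := Fin 2) (α := ℝ)
  let := Matrix.linftyOpNormedAlgebra (n := Fin 2) (R := ℝ) (α := ℝ)
  have h1 := NormedSpace.exp_series_hasSum_exp' (𝕂 := ℝ) N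
  have h3 : ∀ n ∉ Finset.range 2, ((n.factorial : ℝ)⁻¹) • N ^ n = 0 := by
    intro n hn
    obtain ⟨m, rfl⟩ : ∃ m, n = m + 2 := ⟨n - 2, by simp at hn; omega⟩
    rw [pow_add, pow_two, hN, mul_zero, smul_zero]
  have h4 : HasSum (fun n : ℕ => ((n.factorial : ℝ)⁻¹) • N ^ n)
      (∑ n ∈ Finset.range 2, ((n.factorial : ℝ)⁻¹) • N ^ n) := hasSum_sum_of_ne_finset_zero h3
  have h5 : ∑ n ∈ Finset.range 2, ((n.factorial : ℝ)⁻¹) • N ^ n = 1 + N := by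
    rw [Finset.sum_range_succ, Finset.sum_range_succ, Finset.sum_range_zero]; simp
  rw [h5] at h4
  exact h1.unique h4

lemma mem_sl2 {M : Matrix (Fin 2) (Fin 2) ℝ} : M ∈ sl2 ↔ M 0 0 + M 1 1 = 0 := by
  rw [← Matrix.trace_fin_two]; rfl

/-- `SL₂(ℝ)` is generated by exponentials. -/
lemma closure_range_expSL : Subgroup.closure (Set.range expSL) = ⊤ := by
  have hu : ∀ b : ℝ, ∀ g : SL(2, ℝ), (g : Matrix (Fin 2) (Fin 2) ℝ) = !![1, b; 0, 1] →
      g ∈ Subgroup.closure (Set.range expSL) := by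
    intro b g hg
    refine Subgroup.subset_closure ⟨⟨!![0, b; 0, 0], by rw [mem_sl2]; simp⟩, ?_⟩
    apply Subtype.ext
    change NormedSpace.exp !![0, b; 0, 0] = (g : Matrix (Fin 2) (Fin 2) ℝ)
    rw [exp_matrix_of_sq_eq_zero (by ext i j; fin_cases i <;> fin_cases j <;> simp), hg, Matrix.one_fin_two]; simp
  have hl : ∀ b : ℝ, ∀ g : SL(2, ℝ), (g : Matrix (Fin 2) (Fin 2) ℝ) = !![1, 0; b, 1] →
      g ∈ Subgroup.closure (Set.range expSL) := by
    intro b g hg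
    refine Subgroup.subset_closure ⟨⟨!![0, 0; b, 0], by rw [mem_sl2]; simp⟩, ?_⟩
    apply Subtype.ext
    change NormedSpace.exp !![0, 0; b, 0] = (g : Matrix (Fin 2) (Fin 2) ℝ)
    rw [exp_matrix_of_sq_eq_zero (by ext i j; fin_cases i <;> fin_cases j <;> simp), hg, Matrix.one_fin_two]; simp
  let u : ℝ → SL(2, ℝ) := fun b => ⟨!![1, b; 0, 1], by simp⟩
  let l : ℝ → SL(2, ℝ) := fun b => ⟨!![1, 0; b, 1], by simp⟩
  -- matrices with non-zero lower left entry
  have key : ∀ g : SL(2, ℝ), (g : Matrix (Fin 2) (Fin 2) ℝ) 1 0 ≠ 0 →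
      g ∈ Subgroup.closure (Set.range expSL) := by
    intro g hc
    have hdet := g.det_coe
    rw [Matrix.det_fin_two] at hdet
    set a := (g : Matrix (Fin 2) (Fin 2) ℝ) 0 0
    set b := (g : Matrix (Fin 2) (Fin 2) ℝ) 0 1
    set c := (g : Matrix (Fin 2) (Fin 2) ℝ) 1 0
    set d := (g : Matrix (Fin 2) (Fin 2) ℝ) 1 1
    have : g = u ((a - 1) / c) * l c * u ((d - 1) / c) := by
      apply Subtype.ext
      rw [Matrix.SpecialLinearGroup.coe_mul, Matrix.SpecialLinearGroup.coe_mul]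
      ext i j
      fin_cases i <;> fin_cases j <;> simp [u, l, Matrix.mul_apply, Fin.sum_univ_two]
      · change a = _; field_simp; ring
      · change b = _; field_simp; linear_combination -hdet
      · rfl
      · change d = _; field_simp; ring
    rw [this]
    exact mul_mem (mul_mem (hu _ _ rfl) (hl _ _ rfl)) (hu _ _ rfl)
  rw [eq_top_iff]
  intro g _
  by_cases hc : (g : Matrix (Fin 2) (Fin 2) ℝ) 1 0 = 0
  · have ha : (g : Matrix (Fin 2) (Fin 2) ℝ) 0 0 ≠ 0 := by
      intro ha
      have hdet := g.det_coe
      rw [Matrix.det_fin_two, ha, hc] at hdet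
      simp at hdet
    have h1 : g * l 1 * (l 1)⁻¹ = g := by group
    have h2 : l 1 * g ∈ Subgroup.closure (Set.range expSL) := by
      apply key
      rw [Matrix.SpecialLinearGroup.coe_mul]
      simp [l, Matrix.mul_apply, Fin.sum_univ_two, hc, ha]
    have := mul_mem (inv_mem (hl 1 (l 1) rfl)) h2
    rwa [inv_mul_cancel_left] at this
  · exact key g hc

lemma expSL_inv (X : sl2) : (expSL X)⁻¹ = expSL (-X) := by
  obtain ⟨X, hX⟩ := X
  rw [inv_eq_iff_mul_eq_one]
  apply Subtype.ext
  rw [Matrix.SpecialLinearGroup.coe_mul]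
  change NormedSpace.exp X * NormedSpace.exp (-X) = 1
  rw [← Matrix.exp_add_of_commute _ _ (Commute.refl X).neg_right, add_neg_cancel,
    NormedSpace.exp_zero]

lemma exp_toLin' (X : Matrix (Fin 2) (Fin 2) ℝ) :
    NormedSpace.exp (Matrix.toLin' X) = Matrix.toLin' (NormedSpace.exp X) := by
  let := Matrix.linftyOpNormedRing (n := Fin 2) (α := ℝ)
  let := Matrix.linftyOpNormedAlgebra (n := Fin 2) (R := ℝ) (α := ℝ)
  refine LinearMap.ext fun v => eq_of_forall_dual fun ξ => ?_
  have h1 := hasSum_exp_apply (Matrix.toLin' X) ξ v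
  have h2 := hasSum_exp_map ((ξ ∘ₗ LinearMap.applyₗ v) ∘ₗ
    (Matrix.toLin' : Matrix (Fin 2) (Fin 2) ℝ ≃ₗ[ℝ] _).toLinearMap) X
  simp only [LinearMap.comp_apply, LinearEquiv.coe_coe, Matrix.toLin'_pow] at h2
  exact h1.unique h2

variable {𝔤 : Type*} [LieRing 𝔤] [LieAlgebra ℝ 𝔤] [FiniteDimensional ℝ 𝔤] {ψ : sl2 → 𝔤}

lemma map_eq_of_mem_closure_of_trivial {ξ : Module.Dual ℝ 𝔤}
    (hξ : ∀ X v, ξ ⁅ψ X, v⁆ = 0) {p : SL(2, ℝ) × (𝔤 ≃ₗ[ℝ] 𝔤)}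
    (hp : p ∈ Subgroup.closure (Set.range fun X => (expSL X, expAd (ψ X)))) (v : 𝔤) :
    ξ (p.2 v) = ξ v := by
  induction hp using Subgroup.closure_induction generalizing v with
  | mem p h =>
    obtain ⟨X, rfl⟩ := h
    have := exp_intertwine ξ (A := LieAlgebra.ad ℝ 𝔤 (ψ X)) (B := 0) (by simp [hξ]) v
    simpa [expAd_apply] using this
  | one => rfl
  | mul p q _ _ h1 h2 => exact (h1 _).trans (h2 _)
  | inv p _ h => rw [← h]; congr 1; exact p.2.apply_symm_apply v

lemma map_eq_of_mem_closure_of_vector {T : 𝔤 →ₗ[ℝ] (Fin 2 → ℝ)}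
    (hT : ∀ X v, T ⁅ψ X, v⁆ = (X : Matrix (Fin 2) (Fin 2) ℝ).mulVec (T v))
    {p : SL(2, ℝ) × (𝔤 ≃ₗ[ℝ] 𝔤)}
    (hp : p ∈ Subgroup.closure (Set.range fun X => (expSL X, expAd (ψ X)))) (v : 𝔤) :
    T (p.2 v) = (p.1 : Matrix (Fin 2) (Fin 2) ℝ).mulVec (T v) := by
  induction hp using Subgroup.closure_induction generalizing v with
  | mem p h =>
    obtain ⟨X, rfl⟩ := h
    have := exp_intertwine T (A := LieAlgebra.ad ℝ 𝔤 (ψ X))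
      (B := Matrix.toLin' (X : Matrix (Fin 2) (Fin 2) ℝ)) (by simp [hT]) v
    rw [exp_toLin', Matrix.toLin'_apply, ← expAd_apply] at this
    exact this
  | one => simp
  | mul p q _ _ h1 h2 =>
    change T (p.2 (q.2 v)) = _
    rw [h1, h2, Prod.fst_mul, Matrix.SpecialLinearGroup.coe_mul, Matrix.mulVec_mulVec]
  | inv p _ h =>
    have := h (p.2.symm v)
    rw [LinearEquiv.apply_symm_apply] at this
    rw [this, Matrix.mulVec_mulVec, Prod.fst_inv, ← Matrix.SpecialLinearGroup.coe_mul,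
      inv_mul_cancel, Matrix.SpecialLinearGroup.coe_one, Matrix.one_mulVec]
    rfl

lemma map_eq_of_mem_closure_of_adjoint {T : 𝔤 →ₗ[ℝ] Matrix (Fin 2) (Fin 2) ℝ}
    (hT : ∀ X v, T ⁅ψ X, v⁆ = (X : Matrix (Fin 2) (Fin 2) ℝ) * T v - T v * X)
    {p : SL(2, ℝ) × (𝔤 ≃ₗ[ℝ] 𝔤)}
    (hp : p ∈ Subgroup.closure (Set.range fun X => (expSL X, expAd (ψ X)))) (v : 𝔤) :
    T (p.2 v) = (p.1 : Matrix (Fin 2) (Fin 2) ℝ) * T v * (p.1⁻¹ : SL(2, ℝ)) := by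
  induction hp using Subgroup.closure_induction generalizing v with
  | mem p h =>
    obtain ⟨X, rfl⟩ := h
    let := Matrix.linftyOpNormedRing (n := Fin 2) (α := ℝ)
    let := Matrix.linftyOpNormedAlgebra (n := Fin 2) (R := ℝ) (α := ℝ)
    have := exp_intertwine T (A := LieAlgebra.ad ℝ 𝔤 (ψ X))
      (B := LinearMap.mulLeft ℝ (X : Matrix (Fin 2) (Fin 2) ℝ) -
        LinearMap.mulRight ℝ (X : Matrix (Fin 2) (Fin 2) ℝ)) (by simp [hT]) v
    rw [exp_mulLeft_sub_mulRight, ← expAd_apply] at this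
    rw [this, expSL_inv]
    rfl
  | one => simp
  | mul p q _ _ h1 h2 =>
    change T (p.2 (q.2 v)) = _
    rw [h1, h2, Prod.fst_mul, mul_inv_rev, Matrix.SpecialLinearGroup.coe_mul,
      Matrix.SpecialLinearGroup.coe_mul]
    simp only [mul_assoc]
  | inv p _ h =>
    have := h (p.2.symm v)
    rw [LinearEquiv.apply_symm_apply] at this
    rw [this, Prod.fst_inv, inv_inv]
    have h1 : ((p.1⁻¹ : SL(2, ℝ)) : Matrix (Fin 2) (Fin 2) ℝ) * (p.1 : Matrix (Fin 2) (Fin 2) ℝ)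
        = 1 := by
      rw [← Matrix.SpecialLinearGroup.coe_mul, inv_mul_cancel, Matrix.SpecialLinearGroup.coe_one]
    rw [mul_assoc, mul_assoc, h1, mul_one, ← mul_assoc, h1, one_mul]
    rfl

end Integration

/-! ### The subalgebra `gl₂(ℝ)` of a graded triple -/

namespace GradedTriple

section Weights

variable {𝔤 : Type*} [LieRing 𝔤] [LieAlgebra ℝ 𝔤] {h e k f : 𝔤}

lemma lie_e_of_weight (T : GradedTriple h e k f) {μ : ℝ} {w : 𝔤} (hw : ⁅k, w⁆ = μ • w) :
    ⁅k, ⁅e, w⁆⁆ = (μ + 2) • ⁅e, w⁆ := by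
  rw [T.lie_ke, hw, lie_smul]; module

lemma lie_f_of_weight (T : GradedTriple h e k f) {μ : ℝ} {w : 𝔤} (hw : ⁅k, w⁆ = μ • w) :
    ⁅k, ⁅f, w⁆⁆ = (μ - 2) • ⁅f, w⁆ := by
  rw [T.lie_kf, hw, lie_smul]; module

lemma eq_zero_of_weight (hh : IsEulerElement h) (T : GradedTriple h e k f) {μ : ℝ} {w : 𝔤}
    (hw : ⁅k, w⁆ = μ • w) (hμ : μ ^ 5 - 5 * μ ^ 3 + 4 * μ ≠ 0) : w = 0 := by
  have := T.weights hh w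
  simp only [hw, lie_smul] at this
  have h0 : (μ ^ 5 - 5 * μ ^ 3 + 4 * μ) • w = 0 := by linear_combination (norm := module) this
  exact (smul_eq_zero.1 h0).resolve_left hμ

/-- The Lagrange interpolation formula splits a vector into weight vectors. -/
lemma exists_weight_decomp (hh : IsEulerElement h) (T : GradedTriple h e k f) (v : 𝔤) :
    ∃ a b c d g : 𝔤, ⁅k, a⁆ = (-2 : ℝ) • a ∧ ⁅k, b⁆ = (-1 : ℝ) • b ∧ ⁅k, c⁆ = (0 : ℝ) • c ∧
      ⁅k, d⁆ = (1 : ℝ) • d ∧ ⁅k, g⁆ = (2 : ℝ) • g ∧ v = a + b + c + d + g := by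
  have hw := T.weights hh v
  obtain ⟨v1, h1⟩ : ∃ v1, v1 = ⁅k, v⁆ := ⟨_, rfl⟩
  obtain ⟨v2, h2⟩ : ∃ v2, v2 = ⁅k, v1⁆ := ⟨_, rfl⟩
  obtain ⟨v3, h3⟩ : ∃ v3, v3 = ⁅k, v2⁆ := ⟨_, rfl⟩
  obtain ⟨v4, h4⟩ : ∃ v4, v4 = ⁅k, v3⁆ := ⟨_, rfl⟩
  obtain ⟨v5, h5⟩ : ∃ v5, v5 = ⁅k, v4⁆ := ⟨_, rfl⟩
  rw [← h1, ← h2, ← h3, ← h4, ← h5] at hw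
  refine ⟨(1 / 24 : ℝ) • (v4 - (2 : ℝ) • v3 - v2 + (2 : ℝ) • v1),
    (-1 / 6 : ℝ) • (v4 - v3 - (4 : ℝ) • v2 + (4 : ℝ) • v1),
    (1 / 4 : ℝ) • (v4 - (5 : ℝ) • v2 + (4 : ℝ) • v),
    (-1 / 6 : ℝ) • (v4 + v3 - (4 : ℝ) • v2 - (4 : ℝ) • v1),
    (1 / 24 : ℝ) • (v4 + (2 : ℝ) • v3 - v2 - (2 : ℝ) • v1), ?_, ?_, ?_, ?_, ?_, by module⟩ <;>
    simp only [lie_add, lie_sub, lie_smul, ← h1, ← h2, ← h3, ← h4, ← h5]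
  · linear_combination (norm := module) (1 / 24 : ℝ) • hw
  · linear_combination (norm := module) (-1 / 6 : ℝ) • hw
  · linear_combination (norm := module) (1 / 4 : ℝ) • hw
  · linear_combination (norm := module) (-1 / 6 : ℝ) • hw
  · linear_combination (norm := module) (1 / 24 : ℝ) • hw

/-- The operator `f²` maps the weight `2` component of the three-dimensional submodules to the
weight `-2` component, and annihilates everything else. -/
def spinOne (f : 𝔤) : Module.End ℝ 𝔤 := LieAlgebra.ad ℝ 𝔤 f * LieAlgebra.ad ℝ 𝔤 f

/-- The operator `f k (2 - k)` maps the weight `1` component to the weight `-1` component, and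
annihilates everything else. -/
def spinHalf (k f : 𝔤) : Module.End ℝ 𝔤 :=
  LieAlgebra.ad ℝ 𝔤 f * LieAlgebra.ad ℝ 𝔤 k * (2 - LieAlgebra.ad ℝ 𝔤 k)

/-- This operator is a multiple of the projection onto the trivial submodule. -/
def spinZero (e k f : 𝔤) : Module.End ℝ 𝔤 :=
  (2 - LieAlgebra.ad ℝ 𝔤 f * LieAlgebra.ad ℝ 𝔤 e) * (1 - LieAlgebra.ad ℝ 𝔤 k * LieAlgebra.ad ℝ 𝔤 k)
    * (4 - LieAlgebra.ad ℝ 𝔤 k * LieAlgebra.ad ℝ 𝔤 k)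

lemma spinOne_apply (v : 𝔤) : spinOne f v = ⁅f, ⁅f, v⁆⁆ := rfl

lemma spinHalf_apply {μ : ℝ} {w : 𝔤} (hw : ⁅k, w⁆ = μ • w) : spinHalf k f w = (μ * (2 - μ)) • ⁅f, w⁆ := by
  have h2 : (2 : Module.End ℝ 𝔤) w = (2 : ℝ) • w := by
    rw [← one_add_one_eq_two, LinearMap.add_apply, Module.End.one_apply, two_smul]
  simp only [spinHalf, Module.End.mul_apply, LinearMap.sub_apply, LieAlgebra.ad_apply, hw, h2, lie_sub,
    lie_smul]
  module

lemma spinZero_apply {μ : ℝ} {w : 𝔤} (hw : ⁅k, w⁆ = μ • w) :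
    spinZero e k f w = ((1 - μ ^ 2) * (4 - μ ^ 2)) • ((2 : ℝ) • w - ⁅f, ⁅e, w⁆⁆) := by
  have h2 : ∀ w, (2 : Module.End ℝ 𝔤) w = (2 : ℝ) • w := fun w => by
    rw [← one_add_one_eq_two, LinearMap.add_apply, Module.End.one_apply, two_smul]
  have h4 : ∀ w, (4 : Module.End ℝ 𝔤) w = (4 : ℝ) • w := fun w => by
    rw [← two_add_two_eq_four, LinearMap.add_apply, h2]; module
  simp only [spinZero, Module.End.mul_apply, LinearMap.sub_apply, LieAlgebra.ad_apply, hw, h2, h4,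
    lie_sub, lie_smul, Module.End.one_apply]
  module

/-- A linear map that vanishes on weight vectors vanishes. -/
lemma eq_zero_of_forall_weight (hh : IsEulerElement h) (T : GradedTriple h e k f) {W : Type*} [AddCommGroup W] [Module ℝ W]
    {A : 𝔤 →ₗ[ℝ] W} (hA : ∀ μ : ℝ, μ = -2 ∨ μ = -1 ∨ μ = 0 ∨ μ = 1 ∨ μ = 2 →
      ∀ w, ⁅k, w⁆ = μ • w → A w = 0) (v : 𝔤) :
    A v = 0 := by
  obtain ⟨a, b, c, d, g, ha, hb, hc, hd, hg, rfl⟩ := T.exists_weight_decomp hh v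
  rw [map_add, map_add, map_add, map_add, hA _ (by norm_num) a ha, hA _ (by norm_num) b hb,
    hA _ (by norm_num) c hc, hA _ (by norm_num) d hd, hA _ (by norm_num) g hg]
  simp

lemma spinOne_f (hh : IsEulerElement h) (T : GradedTriple h e k f) (v : 𝔤) :
    spinOne f ⁅f, v⁆ = 0 := by
  refine T.eq_zero_of_forall_weight hh (A := spinOne f ∘ₗ LieAlgebra.ad ℝ 𝔤 f) ?_ v
  intro μ hμ w hw
  refine T.eq_zero_of_weight hh (μ := μ - 2 - 2 - 2)
    (T.lie_f_of_weight (T.lie_f_of_weight (T.lie_f_of_weight hw))) ?_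
  rcases hμ with rfl | rfl | rfl | rfl | rfl <;> norm_num

lemma spinOne_k (hh : IsEulerElement h) (T : GradedTriple h e k f) (v : 𝔤) :
    spinOne f ⁅k, v⁆ = (2 : ℝ) • spinOne f v := by
  rw [← sub_eq_zero]
  refine T.eq_zero_of_forall_weight hh
    (A := spinOne f ∘ₗ LieAlgebra.ad ℝ 𝔤 k - (2 : ℝ) • spinOne f) ?_ v
  intro μ hμ w hw
  have h1 := T.lie_f_of_weight (T.lie_f_of_weight hw)
  simp only [LinearMap.sub_apply, LinearMap.comp_apply, LieAlgebra.ad_apply, hw, map_smul,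
    LinearMap.smul_apply, spinOne_apply]
  rcases hμ with rfl | rfl | rfl | rfl | rfl
  on_goal 5 => module
  all_goals rw [T.eq_zero_of_weight hh h1 (by norm_num)]; simp

lemma spinOne_eee (hh : IsEulerElement h) (T : GradedTriple h e k f) (v : 𝔤) :
    spinOne f ⁅e, ⁅e, ⁅e, v⁆⁆⁆ = 0 := by
  refine T.eq_zero_of_forall_weight hh (A := spinOne f ∘ₗ LieAlgebra.ad ℝ 𝔤 e ∘ₗ
    LieAlgebra.ad ℝ 𝔤 e ∘ₗ LieAlgebra.ad ℝ 𝔤 e) ?_ v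
  intro μ hμ w hw
  have h1 := T.lie_e_of_weight (T.lie_e_of_weight (T.lie_e_of_weight hw))
  simp only [LinearMap.comp_apply, LieAlgebra.ad_apply]
  rw [T.eq_zero_of_weight hh h1, map_zero]
  rcases hμ with rfl | rfl | rfl | rfl | rfl <;> norm_num

lemma spinHalf_f (hh : IsEulerElement h) (T : GradedTriple h e k f) (v : 𝔤) :
    spinHalf k f ⁅f, v⁆ = 0 := by
  refine T.eq_zero_of_forall_weight hh (A := spinHalf k f ∘ₗ LieAlgebra.ad ℝ 𝔤 f) ?_ v
  intro μ hμ w hw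
  have h1 := T.lie_f_of_weight (T.lie_f_of_weight hw)
  simp only [LinearMap.comp_apply, LieAlgebra.ad_apply, spinHalf_apply (T.lie_f_of_weight hw)]
  rcases hμ with rfl | rfl | rfl | rfl | rfl
  on_goal 5 => norm_num
  all_goals rw [T.eq_zero_of_weight hh h1 (by norm_num), smul_zero]

lemma spinHalf_k (hh : IsEulerElement h) (T : GradedTriple h e k f) (v : 𝔤) :
    spinHalf k f ⁅k, v⁆ = spinHalf k f v := by
  rw [← sub_eq_zero]
  refine T.eq_zero_of_forall_weight hh
    (A := spinHalf k f ∘ₗ LieAlgebra.ad ℝ 𝔤 k - spinHalf k f) ?_ v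
  intro μ hμ w hw
  have h1 := T.lie_f_of_weight hw
  simp only [LinearMap.sub_apply, LinearMap.comp_apply, LieAlgebra.ad_apply, hw, map_smul,
    spinHalf_apply hw]
  rcases hμ with rfl | rfl | rfl | rfl | rfl
  on_goal 1 => rw [T.eq_zero_of_weight hh h1 (by norm_num)]
  on_goal 2 => rw [T.eq_zero_of_weight hh h1 (by norm_num)]
  all_goals simp

lemma spinHalf_ee (hh : IsEulerElement h) (T : GradedTriple h e k f) (v : 𝔤) :
    spinHalf k f ⁅e, ⁅e, v⁆⁆ = 0 := by
  refine T.eq_zero_of_forall_weight hh (A := spinHalf k f ∘ₗ LieAlgebra.ad ℝ 𝔤 e ∘ₗ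
    LieAlgebra.ad ℝ 𝔤 e) ?_ v
  intro μ hμ w hw
  have h1 := T.lie_e_of_weight (T.lie_e_of_weight hw)
  simp only [LinearMap.comp_apply, LieAlgebra.ad_apply]
  rcases hμ with rfl | rfl | rfl | rfl | rfl
  on_goal 1 => rw [spinHalf_apply h1]; norm_num
  all_goals rw [T.eq_zero_of_weight hh h1 (by norm_num), map_zero]

lemma fe_of_weight_neg_two (hh : IsEulerElement h) (T : GradedTriple h e k f) {w : 𝔤}
    (hw : ⁅k, w⁆ = (-2 : ℝ) • w) : ⁅f, ⁅e, w⁆⁆ = (2 : ℝ) • w ∧ ⁅f, ⁅e, ⁅e, w⁆⁆⁆ = (2 : ℝ) • ⁅e, w⁆ := by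
  have h0 : ⁅f, w⁆ = 0 := T.eq_zero_of_weight hh (T.lie_f_of_weight hw) (by norm_num)
  have h1 : ⁅f, ⁅e, w⁆⁆ = (2 : ℝ) • w := by
    have := T.lie_ef w
    rw [h0, hw, lie_zero] at this
    linear_combination (norm := module) -this
  refine ⟨h1, ?_⟩
  have := T.lie_ef ⁅e, w⁆
  rw [h1, T.lie_e_of_weight hw, lie_smul] at this
  linear_combination (norm := module) -this

lemma ef_of_weight_two (hh : IsEulerElement h) (T : GradedTriple h e k f) {w : 𝔤}
    (hw : ⁅k, w⁆ = (2 : ℝ) • w) : ⁅e, ⁅f, w⁆⁆ = (2 : ℝ) • w := by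
  rw [T.lie_ef, T.eq_zero_of_weight hh (T.lie_e_of_weight hw) (by norm_num), hw, lie_zero, zero_add]

lemma spinZero_e (hh : IsEulerElement h) (T : GradedTriple h e k f) (v : 𝔤) :
    spinZero e k f ⁅e, v⁆ = 0 := by
  refine T.eq_zero_of_forall_weight hh (A := spinZero e k f ∘ₗ LieAlgebra.ad ℝ 𝔤 e) ?_ v
  intro μ hμ w hw
  have h1 := T.lie_e_of_weight hw
  simp only [LinearMap.comp_apply, LieAlgebra.ad_apply]
  rcases hμ with rfl | rfl | rfl | rfl | rfl
  · rw [spinZero_apply h1, (T.fe_of_weight_neg_two hh hw).2, sub_self, smul_zero]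
  · rw [spinZero_apply h1]; norm_num
  · rw [spinZero_apply h1]; norm_num
  · rw [T.eq_zero_of_weight hh h1 (by norm_num), map_zero]
  · rw [T.eq_zero_of_weight hh h1 (by norm_num), map_zero]

lemma spinZero_f (hh : IsEulerElement h) (T : GradedTriple h e k f) (v : 𝔤) :
    spinZero e k f ⁅f, v⁆ = 0 := by
  refine T.eq_zero_of_forall_weight hh (A := spinZero e k f ∘ₗ LieAlgebra.ad ℝ 𝔤 f) ?_ v
  intro μ hμ w hw
  have h1 := T.lie_f_of_weight hw
  simp only [LinearMap.comp_apply, LieAlgebra.ad_apply]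
  rcases hμ with rfl | rfl | rfl | rfl | rfl
  · rw [T.eq_zero_of_weight hh h1 (by norm_num), map_zero]
  · rw [T.eq_zero_of_weight hh h1 (by norm_num), map_zero]
  · rw [spinZero_apply h1]; norm_num
  · rw [spinZero_apply h1]; norm_num
  · rw [spinZero_apply h1, T.ef_of_weight_two hh hw, lie_smul]; module

lemma spinOne_eq_zero (hh : IsEulerElement h) (T : GradedTriple h e k f) {μ : ℝ} {w : 𝔤}
    (hw : ⁅k, w⁆ = μ • w) (hμ : (μ - 4) ^ 5 - 5 * (μ - 4) ^ 3 + 4 * (μ - 4) ≠ 0) :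
    spinOne f w = 0 :=
  T.eq_zero_of_weight hh (μ := μ - 4)
    (by rw [spinOne_apply, T.lie_f_of_weight (T.lie_f_of_weight hw)]; congr 1; ring) hμ

/-- The operators `spinOne`, `spinHalf`, `spinZero` and their translates by `e` separate points. -/
lemma eq_zero_of_spin (hh : IsEulerElement h) (T : GradedTriple h e k f) {v : 𝔤}
    (h10 : spinOne f v = 0) (h11 : spinOne f ⁅e, v⁆ = 0) (h12 : spinOne f ⁅e, ⁅e, v⁆⁆ = 0)
    (h20 : spinHalf k f v = 0) (h21 : spinHalf k f ⁅e, v⁆ = 0) (h30 : spinZero e k f v = 0) :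
    v = 0 := by
  -- `spinOne` is injective on weight `2`, and `spinHalf` is injective on weight `1`
  have inj2 : ∀ {w : 𝔤}, ⁅k, w⁆ = (2 : ℝ) • w → spinOne f w = 0 → w = 0 := by
    intro w hw h0
    rw [spinOne_apply] at h0
    have h1 := T.lie_ef ⁅f, w⁆
    rw [h0, T.ef_of_weight_two hh hw, T.lie_f_of_weight hw, lie_zero, lie_smul] at h1
    have h2 : ⁅f, w⁆ = 0 := by linear_combination (norm := module) (-1 / 2 : ℝ) • h1
    have h3 := T.ef_of_weight_two hh hw
    rw [h2, lie_zero] at h3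
    linear_combination (norm := module) (-1 / 2 : ℝ) • h3
  have inj1 : ∀ {w : 𝔤}, ⁅k, w⁆ = (1 : ℝ) • w → spinHalf k f w = 0 → w = 0 := by
    intro w hw h0
    rw [spinHalf_apply hw] at h0
    have h1 := T.lie_ef w
    have h2 : ⁅f, w⁆ = 0 := by linear_combination (norm := module) h0
    rw [h2, T.eq_zero_of_weight hh (T.lie_e_of_weight hw) (by norm_num), hw, lie_zero, lie_zero] at h1
    linear_combination (norm := module) -h1
  obtain ⟨a, b, c, d, g, ha, hb, hc, hd, hg, rfl⟩ := T.exists_weight_decomp hh v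
  have ea := T.lie_e_of_weight ha
  have eb := T.lie_e_of_weight hb
  have ec := T.lie_e_of_weight hc
  have ed : ⁅e, d⁆ = 0 := T.eq_zero_of_weight hh (T.lie_e_of_weight hd) (by norm_num)
  have eg : ⁅e, g⁆ = 0 := T.eq_zero_of_weight hh (T.lie_e_of_weight hg) (by norm_num)
  have eeb : ⁅e, ⁅e, b⁆⁆ = 0 := T.eq_zero_of_weight hh (T.lie_e_of_weight eb) (by norm_num)
  have eec : ⁅e, ⁅e, c⁆⁆ = 0 := T.eq_zero_of_weight hh (T.lie_e_of_weight ec) (by norm_num)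
  have fa : ⁅f, a⁆ = 0 := T.eq_zero_of_weight hh (T.lie_f_of_weight ha) (by norm_num)
  have fb : ⁅f, b⁆ = 0 := T.eq_zero_of_weight hh (T.lie_f_of_weight hb) (by norm_num)
  simp only [lie_add, map_add, ed, eg, eeb, eec, add_zero]
    at h10 h11 h12 h20 h21 h30
  rw [T.spinOne_eq_zero hh ha (by norm_num), T.spinOne_eq_zero hh hb (by norm_num),
    T.spinOne_eq_zero hh hc (by norm_num), T.spinOne_eq_zero hh hd (by norm_num)] at h10
  rw [T.spinOne_eq_zero hh ea (by norm_num), T.spinOne_eq_zero hh eb (by norm_num)] at h11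
  simp only [spinHalf_apply ha, spinHalf_apply hb, spinHalf_apply hc, spinHalf_apply hg, fa, fb,
    smul_zero, zero_add, zero_mul, zero_smul, sub_self, mul_zero, add_zero] at h20
  rw [spinHalf_apply ea, spinHalf_apply ec] at h21
  rw [spinZero_apply ha, spinZero_apply hb, spinZero_apply hc, spinZero_apply hd,
    spinZero_apply hg] at h30
  norm_num at h10 h11 h21 h30
  have g0 : g = 0 := inj2 hg h10
  have ec0 : ⁅e, c⁆ = 0 := inj2 (by rw [ec]; norm_num) h11
  have eea0 : ⁅e, ⁅e, a⁆⁆ = 0 := inj2 (by rw [T.lie_e_of_weight ea]; norm_num) h12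
  have d0 : d = 0 := inj1 hd h20
  have eb0 : ⁅e, b⁆ = 0 := inj1 (by rw [eb]; norm_num) h21
  have a0 : a = 0 := by
    obtain ⟨h1, h2⟩ := T.fe_of_weight_neg_two hh ha
    rw [eea0, lie_zero] at h2
    rw [(smul_eq_zero.1 h2.symm).resolve_left (by norm_num), lie_zero] at h1
    exact (smul_eq_zero.1 h1.symm).resolve_left (by norm_num)
  have b0 : b = 0 := by
    have h1 := T.lie_ef b
    rw [eb0, fb, hb, lie_zero, lie_zero] at h1
    linear_combination (norm := module) h1
  have c0 : c = 0 := by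
    rw [ec0, lie_zero] at h30
    simpa using h30
  rw [a0, b0, c0, d0, g0]; simp

end Weights

section Datum

variable {𝔤 : Type*} [LieRing 𝔤] [LieAlgebra ℝ 𝔤] {h e k f : 𝔤}

/-- The representation of `gl₂(ℝ)` in `𝔤` defined by a graded triple: the identity matrix is mapped
to the central element `2 h - k`, and `2σ₁` is mapped to `-k`. The matrix
`½ (1 1; -1 -1)` is mapped to `e`, and `½ (1 -1; 1 -1)` is mapped to `f`. -/
def glMap (h e k f : 𝔤) : Matrix (Fin 2) (Fin 2) ℝ →ₗ[ℝ] 𝔤 where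
  toFun M := (M 0 0 + M 1 1) • (h - (1 / 2 : ℝ) • k) +
    ((M 0 0 - M 1 1 + (M 0 1 - M 1 0)) / 2) • e + ((M 0 0 - M 1 1 - (M 0 1 - M 1 0)) / 2) • f -
      ((M 0 1 + M 1 0) / 2) • k
  map_add' M N := by simp only [Matrix.add_apply]; module
  map_smul' r M := by simp only [Matrix.smul_apply, smul_eq_mul, RingHom.id_apply]; module

lemma glMap_apply (M : Matrix (Fin 2) (Fin 2) ℝ) :
    glMap h e k f M = (M 0 0 + M 1 1) • (h - (1 / 2 : ℝ) • k) +
    ((M 0 0 - M 1 1 + (M 0 1 - M 1 0)) / 2) • e + ((M 0 0 - M 1 1 - (M 0 1 - M 1 0)) / 2) • f -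
      ((M 0 1 + M 1 0) / 2) • k := rfl

/-- `glMap` as a homomorphism of Lie algebras. -/
def glHom (T : GradedTriple h e k f) : Matrix (Fin 2) (Fin 2) ℝ →ₗ⁅ℝ⁆ 𝔤 :=
  { glMap h e k f with
    map_lie' := fun {M N} => by
      have he := T.he
      have hf := T.hf
      have ef := T.ef
      have ke := T.ke
      have kf := T.kf
      have hk := T.hk
      have eh : ⁅e, h⁆ = -e := by rw [← lie_skew, he]
      have fh : ⁅f, h⁆ = f := by rw [← lie_skew, hf, neg_neg]
      have fe : ⁅f, e⁆ = -k := by rw [← lie_skew, ef]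
      have ek : ⁅e, k⁆ = (-2 : ℝ) • e := by rw [← lie_skew, ke, neg_smul]
      have fk : ⁅f, k⁆ = (2 : ℝ) • f := by rw [← lie_skew, kf, neg_smul, neg_neg]
      have kh : ⁅k, h⁆ = 0 := by rw [← lie_skew, hk, neg_zero]
      change glMap h e k f ⁅M, N⁆ = ⁅glMap h e k f M, glMap h e k f N⁆
      simp only [glMap_apply, LieRing.of_associative_ring_bracket, Matrix.sub_apply,
        Matrix.mul_apply, Fin.sum_univ_two, add_lie, lie_add, sub_lie, lie_sub, smul_lie, lie_smul,
        lie_self, he, hf, ef, ke, kf, hk, eh, fh, fe, ek, fk, kh]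
      module }

lemma glHom_apply (T : GradedTriple h e k f) (M : Matrix (Fin 2) (Fin 2) ℝ) :
    T.glHom M = (M 0 0 + M 1 1) • (h - (1 / 2 : ℝ) • k) +
    ((M 0 0 - M 1 1 + (M 0 1 - M 1 0)) / 2) • e + ((M 0 0 - M 1 1 - (M 0 1 - M 1 0)) / 2) • f -
      ((M 0 1 + M 1 0) / 2) • k := rfl

lemma glHom_injective (T : GradedTriple h e k f) {v : 𝔤} (hv : ⁅h, v⁆ = v)
    (hkv : ⁅k, v⁆ = v) (hne : v ≠ 0) : Function.Injective T.glHom := by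
  have hk0 : k ≠ 0 := by rintro rfl; rw [zero_lie] at hkv; exact hne hkv.symm
  have he0 : e ≠ 0 := by rintro rfl; exact hk0 (by rw [← T.ef, zero_lie])
  have hf0 : f ≠ 0 := by rintro rfl; exact hk0 (by rw [← T.ef, lie_zero])
  rw [injective_iff_map_eq_zero]
  intro M hM
  rw [glHom_apply] at hM
  obtain ⟨τ, hτ⟩ : ∃ τ, τ = M 0 0 + M 1 1 := ⟨_, rfl⟩
  obtain ⟨α, hα⟩ : ∃ α, α = (M 0 0 - M 1 1 + (M 0 1 - M 1 0)) / 2 := ⟨_, rfl⟩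
  obtain ⟨β, hβ⟩ : ∃ β, β = (M 0 0 - M 1 1 - (M 0 1 - M 1 0)) / 2 := ⟨_, rfl⟩
  obtain ⟨γ, hγ⟩ : ∃ γ, γ = (M 0 1 + M 1 0) / 2 := ⟨_, rfl⟩
  rw [← hτ, ← hα, ← hβ, ← hγ] at hM
  have d1 : α • e - β • f = 0 := by
    have := congrArg (fun w => ⁅h, w⁆) hM
    simp only [lie_add, lie_sub, lie_smul, lie_self, T.hk, T.he, T.hf, lie_zero] at this
    linear_combination (norm := module) this
  have d2 : α • e + β • f = 0 := by
    have := congrArg (fun w => ⁅h, w⁆) d1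
    simp only [lie_sub, lie_smul, T.he, T.hf, lie_zero] at this
    linear_combination (norm := module) this
  have α0 : α = 0 := by
    refine (smul_eq_zero.1 (?_ : α • e = 0)).resolve_right he0
    linear_combination (norm := module) (1 / 2 : ℝ) • d1 + (1 / 2 : ℝ) • d2
  have β0 : β = 0 := by
    refine (smul_eq_zero.1 (?_ : β • f = 0)).resolve_right hf0
    linear_combination (norm := module) (-1 / 2 : ℝ) • d1 + (1 / 2 : ℝ) • d2
  rw [α0, β0] at hM
  have γ0 : γ = 0 := by
    have := congrArg (fun w => ⁅w, e⁆) hM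
    simp only [add_lie, sub_lie, smul_lie, T.ke, T.he, zero_lie] at this
    refine (smul_eq_zero.1 (?_ : γ • e = 0)).resolve_right he0
    linear_combination (norm := module) (-1 / 2 : ℝ) • this
  rw [γ0] at hM
  have τ0 : τ = 0 := by
    have := congrArg (fun w => ⁅w, v⁆) hM
    simp only [add_lie, sub_lie, smul_lie, hv, hkv, zero_lie] at this
    refine (smul_eq_zero.1 (?_ : τ • v = 0)).resolve_right hne
    linear_combination (norm := module) (2 : ℝ) • this
  ext i j
  fin_cases i <;> fin_cases j <;> simp <;> linarith

/-- The subalgebra of `𝔤` spanned by a graded triple and `h`. -/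
def gl (T : GradedTriple h e k f) : LieSubalgebra ℝ 𝔤 := T.glHom.range

/-- The embedding of `sl₂(ℝ)` defined by a graded triple. -/
def slHom (T : GradedTriple h e k f) : sl2 →ₗ⁅ℝ⁆ 𝔤 := T.glHom.comp sl2.incl

lemma slHom_apply (T : GradedTriple h e k f) (X : sl2) : T.slHom X =
    ((X : Matrix (Fin 2) (Fin 2) ℝ) 0 0 + (X.1 0 1 - X.1 1 0) / 2) • e +
      (X.1 0 0 - (X.1 0 1 - X.1 1 0) / 2) • f - ((X.1 0 1 + X.1 1 0) / 2) • k := by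
  have h0 := mem_sl2.1 X.2
  change T.glHom X.1 = _
  rw [glHom_apply, h0]
  have h1 : X.1 1 1 = - X.1 0 0 := by linarith
  rw [h1]
  module

lemma slHom_range (T : GradedTriple h e k f) : T.slHom.range = commutatorAlgebra T.gl := by
  apply le_antisymm
  · rintro _ ⟨X, rfl⟩
    have hmem : ∀ M, T.glHom M ∈ T.gl := fun M => ⟨M, rfl⟩
    have he : e ∈ T.gl := by
      convert hmem !![1 / 2, 1 / 2; -1 / 2, -1 / 2]
      rw [glHom_apply]; simp; norm_num
    have hf : f ∈ T.gl := by
      convert hmem !![1 / 2, -1 / 2; 1 / 2, -1 / 2]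
      rw [glHom_apply]; simp; norm_num
    have hk : k ∈ T.gl := by
      have := T.gl.lie_mem he hf
      rwa [T.ef] at this
    have hk' : k ∈ commutatorAlgebra T.gl :=
      LieSubalgebra.subset_lieSpan ⟨e, he, f, hf, T.ef.symm⟩
    have he' : e ∈ commutatorAlgebra T.gl := by
      have : (2 : ℝ) • e ∈ commutatorAlgebra T.gl :=
        LieSubalgebra.subset_lieSpan ⟨k, hk, e, he, T.ke.symm⟩
      simpa using (commutatorAlgebra T.gl).smul_mem (1 / 2 : ℝ) this
    have hf' : f ∈ commutatorAlgebra T.gl := by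
      have : (-2 : ℝ) • f ∈ commutatorAlgebra T.gl :=
        LieSubalgebra.subset_lieSpan ⟨k, hk, f, hf, T.kf.symm⟩
      have := (commutatorAlgebra T.gl).smul_mem (-1 / 2 : ℝ) this
      rwa [smul_smul, show (-1 / 2 * -2 : ℝ) = 1 by norm_num, one_smul] at this
    change T.slHom X ∈ _
    rw [slHom_apply]
    exact sub_mem (add_mem ((commutatorAlgebra T.gl).smul_mem _ he')
      ((commutatorAlgebra T.gl).smul_mem _ hf')) ((commutatorAlgebra T.gl).smul_mem _ hk')
  · refine LieSubalgebra.lieSpan_le.2 ?_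
    rintro _ ⟨_, ⟨M, rfl⟩, _, ⟨N, rfl⟩, rfl⟩
    have h0 : ⁅M, N⁆ ∈ sl2 := by
      rw [mem_sl2]
      simp only [LieRing.of_associative_ring_bracket, Matrix.sub_apply, Matrix.mul_apply,
        Fin.sum_univ_two]
      ring
    refine ⟨⟨⁅M, N⁆, h0⟩, ?_⟩
    change T.glHom ⁅M, N⁆ = _
    rw [LieHom.map_lie]
    rfl

/-- The equivariant map to `ℝ²` defined by the odd weights. -/
def vectorMap (e k f : 𝔤) (ξ : Module.Dual ℝ 𝔤) : 𝔤 →ₗ[ℝ] (Fin 2 → ℝ) where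
  toFun v := ξ (spinHalf k f v) • ![1, -1] + ξ (spinHalf k f ⁅e, v⁆) • ![1, 1]
  map_add' v w := by simp only [lie_add, map_add]; module
  map_smul' r v := by simp only [lie_smul, map_smul, smul_eq_mul, RingHom.id_apply]; module

/-- The equivariant map to the adjoint representation defined by the even weights. -/
def adjointMap (e f : 𝔤) (ξ : Module.Dual ℝ 𝔤) : 𝔤 →ₗ[ℝ] Matrix (Fin 2) (Fin 2) ℝ where
  toFun v := ξ (spinOne f v) • !![1 / 2, 1 / 2; -1 / 2, -1 / 2] +
    (-1 / 2 * ξ (spinOne f ⁅e, v⁆)) • !![0, -1; -1, 0] +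
    (-1 / 2 * ξ (spinOne f ⁅e, ⁅e, v⁆⁆)) • !![1 / 2, -1 / 2; 1 / 2, -1 / 2]
  map_add' v w := by simp only [lie_add, map_add]; module
  map_smul' r v := by simp only [lie_smul, map_smul, smul_eq_mul, RingHom.id_apply]; module

lemma vectorMap_lie (hh : IsEulerElement h) (T : GradedTriple h e k f) (ξ : Module.Dual ℝ 𝔤)
    (X : sl2) (v : 𝔤) : vectorMap e k f ξ ⁅T.slHom X, v⁆ =
      (X : Matrix (Fin 2) (Fin 2) ℝ).mulVec (vectorMap e k f ξ v) := by
  have h0 : X.1 1 1 = - X.1 0 0 := by linarith [mem_sl2.1 X.2]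
  change ξ (spinHalf k f _) • ![1, -1] + ξ (spinHalf k f ⁅e, _⁆) • ![1, 1] = X.1.mulVec
    (ξ (spinHalf k f v) • ![1, -1] + ξ (spinHalf k f ⁅e, v⁆) • ![1, 1])
  have r1 : spinHalf k f ⁅e, ⁅f, v⁆⁆ = spinHalf k f v := by
    rw [T.lie_ef, map_add, T.spinHalf_f hh, T.spinHalf_k hh, zero_add]
  have r2 : spinHalf k f ⁅e, ⁅k, v⁆⁆ = -spinHalf k f ⁅e, v⁆ := by
    have := T.spinHalf_k hh ⁅e, v⁆
    rw [T.lie_ke, map_add, map_smul] at this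
    linear_combination (norm := module) this
  simp only [slHom_apply, add_lie, sub_lie, smul_lie, lie_add, lie_sub, lie_smul, map_add, map_sub,
    map_smul, smul_eq_mul, T.spinHalf_f hh, T.spinHalf_k hh, T.spinHalf_ee hh, r1, r2, map_zero,
    map_neg]
  ext i
  fin_cases i <;> simp [Matrix.mulVec, dotProduct, Fin.sum_univ_two, h0] <;> ring

lemma adjointMap_lie (hh : IsEulerElement h) (T : GradedTriple h e k f) (ξ : Module.Dual ℝ 𝔤)
    (X : sl2) (v : 𝔤) : adjointMap e f ξ ⁅T.slHom X, v⁆ =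
      (X : Matrix (Fin 2) (Fin 2) ℝ) * adjointMap e f ξ v - adjointMap e f ξ v * X := by
  have h0 : X.1 1 1 = - X.1 0 0 := by linarith [mem_sl2.1 X.2]
  have hv : ∀ v, adjointMap e f ξ v = ξ (spinOne f v) • !![1 / 2, 1 / 2; -1 / 2, -1 / 2] +
    (-1 / 2 * ξ (spinOne f ⁅e, v⁆)) • !![0, -1; -1, 0] +
    (-1 / 2 * ξ (spinOne f ⁅e, ⁅e, v⁆⁆)) • !![1 / 2, -1 / 2; 1 / 2, -1 / 2] := fun _ => rfl
  have r1 : ∀ v, spinOne f ⁅e, ⁅f, v⁆⁆ = (2 : ℝ) • spinOne f v := fun v => by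
    rw [T.lie_ef, map_add, T.spinOne_f hh, T.spinOne_k hh, zero_add]
  have r2 : ∀ v, spinOne f ⁅e, ⁅k, v⁆⁆ = 0 := fun v => by
    have := T.spinOne_k hh ⁅e, v⁆
    rw [T.lie_ke, map_add, map_smul] at this
    linear_combination (norm := module) this
  have r3 : spinOne f ⁅e, ⁅e, ⁅k, v⁆⁆⁆ = (-2 : ℝ) • spinOne f ⁅e, ⁅e, v⁆⁆ := by
    have := r2 ⁅e, v⁆
    rw [T.lie_ke, lie_add, lie_smul, map_add, map_smul] at this
    linear_combination (norm := module) this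
  have r4 : spinOne f ⁅e, ⁅e, ⁅f, v⁆⁆⁆ = (2 : ℝ) • spinOne f ⁅e, v⁆ := by
    rw [T.lie_ef, lie_add, map_add, r1, r2, add_zero]
  rw [hv, hv]
  simp only [slHom_apply, add_lie, sub_lie, smul_lie, lie_add, lie_sub, lie_smul, map_add, map_sub,
    map_smul, smul_eq_mul, T.spinOne_f hh, T.spinOne_k hh, T.spinOne_eee hh, r1, r2, r3, r4,
    map_zero]
  ext i j
  fin_cases i <;> fin_cases j <;> simp [Matrix.mul_apply, Matrix.vecMul, dotProduct, Fin.sum_univ_two, h0] <;>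
    ring

lemma spinZero_lie (hh : IsEulerElement h) (T : GradedTriple h e k f) (X : sl2) (v : 𝔤) :
    spinZero e k f ⁅T.slHom X, v⁆ = 0 := by
  have : spinZero e k f ⁅k, v⁆ = 0 := by
    have := T.spinZero_e hh ⁅f, v⁆
    rwa [T.lie_ef, map_add, T.spinZero_f hh, zero_add] at this
  simp only [slHom_apply, add_lie, sub_lie, smul_lie, map_add, map_sub, map_smul, this,
    T.spinZero_e hh, T.spinZero_f hh]
  simp

variable [FiniteDimensional ℝ 𝔤]

/-- The group generated by `e^{ad 𝔥}` is isomorphic to `SL₂(ℝ)`. The relations of exponentials in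
`SL₂(ℝ)` hold in `GL(𝔤)` because equivariant maps to the trivial, the two-dimensional, and the
adjoint representation separate the points of `𝔤`. The relations in `GL(𝔤)` hold in `SL₂(ℝ)`
because there is a non-zero equivariant map to `ℝ²`. -/
lemma exists_group_iso (hh : IsEulerElement h) (T : GradedTriple h e k f) {v : 𝔤} (hv : ⁅h, v⁆ = v)
    (hkv : ⁅k, v⁆ = v) (hne : v ≠ 0) : ∃ Φ : SL(2, ℝ) ≃* InnSub T.slHom.range,
      ∀ X, (Φ (expSL X) : 𝔤 ≃ₗ[ℝ] 𝔤) = expAd (T.slHom X) := by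
  have hmem : ∀ X, expAd (T.slHom X) ∈ InnSub T.slHom.range :=
    fun X => Subgroup.subset_closure ⟨_, ⟨X, rfl⟩, rfl⟩
  have hlift : ∀ (g : SL(2, ℝ)) (γ : InnSub T.slHom.range),
      (g, γ) ∈ Subgroup.closure (Set.range fun X => (expSL X,
        (⟨expAd (T.slHom X), hmem X⟩ : InnSub T.slHom.range))) →
      (g, (γ : 𝔤 ≃ₗ[ℝ] 𝔤)) ∈ Subgroup.closure
        (Set.range fun X => (expSL X, expAd (T.slHom X))) := by
    intro g γ hg
    have := Subgroup.mem_map_of_mem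
      ((MonoidHom.id SL(2, ℝ)).prodMap (InnSub T.slHom.range).subtype) hg
    rw [MonoidHom.map_closure, ← Set.range_comp] at this
    exact this
  suffices hΦ : ∃ Φ : SL(2, ℝ) ≃* InnSub T.slHom.range,
      ∀ X, Φ (expSL X) = ⟨expAd (T.slHom X), hmem X⟩ by
    obtain ⟨Φ, hΦ⟩ := hΦ
    exact ⟨Φ, fun X => by rw [hΦ]⟩
  refine exists_mulEquiv_of_generators closure_range_expSL ?_ ?_ ?_
  · refine Eq.trans (congrArg Subgroup.closure ?_) (Subgroup.closure_closure_coe_preimage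
      (k := {φ : 𝔤 ≃ₗ[ℝ] 𝔤 | ∃ x ∈ T.slHom.range, φ = expAd x}))
    ext ⟨γ, hγ⟩
    constructor
    · rintro ⟨X, hX⟩
      exact ⟨_, ⟨X, rfl⟩, (congrArg Subtype.val hX).symm⟩
    · rintro ⟨_, ⟨X, rfl⟩, hX⟩
      exact ⟨X, Subtype.ext hX.symm⟩
  · intro g hg
    have hg := hlift _ _ hg
    have hev : ⁅e, v⁆ = 0 := hh.lie_pos_pos T.he hv
    have hfv : ⁅f, v⁆ ≠ 0 := by
      intro h0
      have := T.lie_ef v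
      rw [h0, hev, hkv, lie_zero, lie_zero, zero_add] at this
      exact hne this.symm
    obtain ⟨ξ, hξ⟩ : ∃ ξ : Module.Dual ℝ 𝔤, ξ ⁅f, v⁆ ≠ 0 := by
      by_contra hc
      push Not at hc
      exact hfv ((Module.forall_dual_apply_eq_zero_iff ℝ _).1 hc)
    have hkv' : ⁅k, v⁆ = (1 : ℝ) • v := by rw [hkv, one_smul]
    have key : ∀ w, vectorMap e k f ξ w =
        (g : Matrix (Fin 2) (Fin 2) ℝ).mulVec (vectorMap e k f ξ w) := fun w =>
      map_eq_of_mem_closure_of_vector (T.vectorMap_lie hh ξ) hg w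
    have hval : ∀ w, vectorMap e k f ξ w =
      ξ (spinHalf k f w) • ![1, -1] + ξ (spinHalf k f ⁅e, w⁆) • ![1, 1] := fun _ => rfl
    have a1 : spinHalf k f v = ⁅f, v⁆ := by rw [spinHalf_apply hkv']; norm_num
    have h1 := key v
    have h2 := key ⁅f, v⁆
    rw [hval, hev, map_zero, map_zero, zero_smul, add_zero, a1, Matrix.mulVec_smul] at h1
    rw [hval, T.spinHalf_f hh, T.lie_ef, hev, lie_zero, zero_add, hkv, a1, map_zero, zero_smul,
      zero_add, Matrix.mulVec_smul] at h2
    have h1 := smul_right_injective _ hξ h1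
    have h2 := smul_right_injective _ hξ h2
    have c1 := congrFun h1 0
    have c2 := congrFun h1 1
    have c3 := congrFun h2 0
    have c4 := congrFun h2 1
    simp [Matrix.mulVec, dotProduct, Fin.sum_univ_two] at c1 c2 c3 c4
    ext i j
    fin_cases i <;> fin_cases j <;> simp <;> linarith
  · intro γ hγ
    have hg := hlift _ _ hγ
    apply Subtype.ext
    ext w
    change (γ : 𝔤 ≃ₗ[ℝ] 𝔤) w = w
    rw [← sub_eq_zero]
    have k1 : ∀ ξ, adjointMap e f ξ (γ.1 w - w) = 0 := fun ξ => by
      rw [map_sub, sub_eq_zero]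
      simpa using map_eq_of_mem_closure_of_adjoint (T.adjointMap_lie hh ξ) hg w
    have k2 : ∀ ξ, vectorMap e k f ξ (γ.1 w - w) = 0 := fun ξ => by
      rw [map_sub, sub_eq_zero]
      simpa using map_eq_of_mem_closure_of_vector (T.vectorMap_lie hh ξ) hg w
    have k3 : ∀ ξ : Module.Dual ℝ 𝔤, ξ (spinZero e k f (γ.1 w - w)) = 0 := fun ξ => by
      rw [map_sub, map_sub, sub_eq_zero]
      exact map_eq_of_mem_closure_of_trivial (ξ := ξ ∘ₗ spinZero e k f)
        (fun X v => by rw [LinearMap.comp_apply, T.spinZero_lie hh, map_zero]) hg w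
    have q1 : ∀ ξ : Module.Dual ℝ 𝔤, ξ (spinOne f (γ.1 w - w)) = 0 ∧
        ξ (spinOne f ⁅e, γ.1 w - w⁆) = 0 ∧ ξ (spinOne f ⁅e, ⁅e, γ.1 w - w⁆⁆) = 0 := fun ξ => by
      have c1 := congrFun (congrFun (k1 ξ) 0) 0
      have c2 := congrFun (congrFun (k1 ξ) 0) 1
      have c3 := congrFun (congrFun (k1 ξ) 1) 0
      simp only [adjointMap, LinearMap.coe_mk, AddHom.coe_mk, Matrix.add_apply, Matrix.smul_apply,
        Matrix.of_apply, Matrix.cons_val', Matrix.cons_val_zero, Matrix.cons_val_one,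
        Matrix.zero_apply, smul_eq_mul, Matrix.cons_val_fin_one] at c1 c2 c3
      exact ⟨by linarith, by linarith, by linarith⟩
    have q2 : ∀ ξ : Module.Dual ℝ 𝔤, ξ (spinHalf k f (γ.1 w - w)) = 0 ∧
        ξ (spinHalf k f ⁅e, γ.1 w - w⁆) = 0 := fun ξ => by
      have c1 := congrFun (k2 ξ) 0
      have c2 := congrFun (k2 ξ) 1
      simp only [vectorMap, LinearMap.coe_mk, AddHom.coe_mk, Pi.add_apply, Pi.smul_apply,
        Matrix.cons_val_zero, Matrix.cons_val_one, Pi.zero_apply, smul_eq_mul,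
        Matrix.cons_val_fin_one] at c1 c2
      exact ⟨by linarith, by linarith⟩
    have z : ∀ {w : 𝔤}, (∀ ξ : Module.Dual ℝ 𝔤, ξ w = 0) → w = 0 :=
      fun hw => (Module.forall_dual_apply_eq_zero_iff ℝ _).1 hw
    exact T.eq_zero_of_spin hh (z fun ξ => (q1 ξ).1) (z fun ξ => (q1 ξ).2.1)
      (z fun ξ => (q1 ξ).2.2) (z fun ξ => (q2 ξ).1) (z fun ξ => (q2 ξ).2) (z k3)

/-- A graded triple with an odd weight defines a subalgebra `𝔟` with the required properties. -/
lemma nonempty_gl2Datum (hh : IsEulerElement h) (T : GradedTriple h e k f) {v : 𝔤}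
    (hv : ⁅h, v⁆ = v) (hkv : ⁅k, v⁆ = v) (hne : v ≠ 0) : Nonempty (Gl2Datum h) := by
  have hinj := T.glHom_injective hv hkv hne
  have hinj' : Function.Injective T.slHom := fun X Y hXY => Subtype.ext (hinj hXY)
  obtain ⟨Φ, hΦ⟩ := T.exists_group_iso hh hv hkv hne
  have hr := T.slHom_range
  refine ⟨{
    𝔟 := T.gl
    mem := ⟨!![1 / 2, -1 / 2; -1 / 2, 1 / 2], ?_⟩
    isoGl := ⟨(LieEquiv.ofInjective T.glHom hinj).symm⟩
    φ := (LieEquiv.ofInjective T.slHom hinj').trans (LieEquiv.ofEq _ _ (congrArg _ hr))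
    Φ := Φ.trans (MulEquiv.subgroupCongr (congrArg InnSub hr))
    Φ_exp := fun X => hΦ X
    central := ?_ }⟩
  · change T.glHom _ = h
    rw [glHom_apply]
    simp
    module
  · rintro _ ⟨M, rfl⟩
    change ⁅h + T.slHom sigma1, T.glHom M⁆ = 0
    have : T.slHom sigma1 = (-1 / 2 : ℝ) • k := by
      rw [slHom_apply]; simp [sigma1]; module
    have kh : ⁅k, h⁆ = 0 := by rw [← lie_skew, T.hk, neg_zero]
    rw [this, glHom_apply]
    simp only [add_lie, lie_add, lie_sub, smul_lie, lie_smul, lie_self, T.hk, kh, T.he, T.hf, T.ke,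
      T.kf]
    module

end Datum

end GradedTriple

/-! ### Holomorphic functions on the strip -/

section Strip

open Complex Topology

variable {E E' : Type*} [NormedAddCommGroup E] [NormedSpace ℂ E] [NormedAddCommGroup E']
  [NormedSpace ℂ E']

lemma interior_strip : interior strip = {z : ℂ | -(1 / 2) < z.im ∧ z.im < 0} := by
  have h : strip = Set.univ ×ℂ Set.Icc (-(1 / 2)) 0 := by
    ext z; simp [strip, mem_reProdIm]
  rw [h, interior_reProdIm]
  ext z; simp [mem_reProdIm]

lemma isPreconnected_interior_strip : IsPreconnected (interior strip) := by
  rw [interior_strip]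
  exact ((convex_halfSpace_im_gt _).inter (convex_halfSpace_im_lt _)).isPreconnected

lemma strip_subset_closure_interior : strip ⊆ closure (interior strip) := by
  have h : interior strip = Set.univ ×ℂ Set.Ioo (-(1 / 2)) 0 := by
    rw [interior_strip]; ext z; simp [mem_reProdIm]
  rw [h, closure_reProdIm, closure_Ioo (by norm_num)]
  intro z hz
  simpa [strip, mem_reProdIm] using hz

/-- `F` is continuous on the strip and holomorphic in its interior. -/
def StripHolo (F : ℂ → E) : Prop :=
  ContinuousOn F strip ∧ DifferentiableOn ℂ F (interior strip)

namespace StripHolo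

variable {F G : ℂ → E}

lemma const (v : E) : StripHolo fun _ => v := ⟨continuousOn_const, differentiableOn_const _⟩

lemma add (hF : StripHolo F) (hG : StripHolo G) : StripHolo fun z => F z + G z :=
  ⟨hF.1.add hG.1, hF.2.add hG.2⟩

lemma sub (hF : StripHolo F) (hG : StripHolo G) : StripHolo fun z => F z - G z :=
  ⟨hF.1.sub hG.1, hF.2.sub hG.2⟩

lemma clm (L : E →L[ℂ] E') (hF : StripHolo F) : StripHolo fun z => L (F z) :=
  ⟨L.continuous.comp_continuousOn hF.1, L.differentiable.comp_differentiableOn hF.2⟩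

lemma add_real {z : ℂ} (t : ℝ) (hz : z ∈ strip) : z + t ∈ strip := by
  simpa [strip] using hz

lemma add_real_interior {z : ℂ} (t : ℝ) (hz : z ∈ interior strip) : z + t ∈ interior strip := by
  rw [interior_strip] at hz ⊢
  simpa using hz

lemma translate (hF : StripHolo F) (t : ℝ) : StripHolo fun z => F (z + t) :=
  ⟨hF.1.comp (by fun_prop) fun _ hz => add_real t hz,
    hF.2.comp (by fun_prop) fun _ hz => add_real_interior t hz⟩

lemma conj_sub_mem {z : ℂ} (hz : z ∈ strip) : conj z - I / 2 ∈ strip := by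
  have h : (I / 2).im = 1 / 2 := by simp
  simp only [strip, Set.mem_ofPred_eq, sub_im, conj_im, h] at hz ⊢
  constructor <;> linarith

lemma conj_sub_mem_interior {z : ℂ} (hz : z ∈ interior strip) :
    conj z - I / 2 ∈ interior strip := by
  have h : (I / 2).im = 1 / 2 := by simp
  simp only [interior_strip, Set.mem_ofPred_eq, sub_im, conj_im, h] at hz ⊢
  constructor <;> linarith

/-- Composition with the antiholomorphic reflection `z ↦ z̄ - i/2` of the strip and an antilinear
map preserves holomorphy. -/
lemma conj_comp (hF : StripHolo F) (c : E →L⋆[ℂ] E') :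
    StripHolo fun z => c (F (conj z - I / 2)) := by
  refine ⟨c.continuous.comp_continuousOn (hF.1.comp (by fun_prop) fun _ hz => conj_sub_mem hz),
    fun z hz => ?_⟩
  have hz' := conj_sub_mem_interior hz
  have hd := (hF.2.differentiableAt (isOpen_interior.mem_nhds hz')).hasDerivAt
  refine DifferentiableAt.differentiableWithinAt (HasDerivAt.differentiableAt
    (f' := c (deriv F (conj z - I / 2))) ?_)
  rw [hasDerivAt_iff_isLittleO] at hd ⊢
  have ht : Filter.Tendsto (fun w : ℂ => conj w - I / 2) (𝓝 z) (𝓝 (conj z - I / 2)) :=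
    Continuous.tendsto (by fun_prop) z
  have h1 := (c.isBigO_comp (fun w => F (conj w - I / 2) - F (conj z - I / 2) -
    (conj w - I / 2 - (conj z - I / 2)) • deriv F (conj z - I / 2)) (𝓝 z)).trans_isLittleO
    (hd.comp_tendsto ht)
  refine (h1.congr_left fun w => ?_).trans_isBigO (Asymptotics.isBigO_of_le _ fun w => ?_)
  · simp
  · simp [← map_sub]

/-- A function that is continuous on the strip, holomorphic inside and zero on the real line
vanishes. The three lines theorem applies after a substitution that maps another strip to a bounded
region whose boundary contains an interval of the real line. -/
lemma eq_zero [CompleteSpace E] (hF : StripHolo F) (h0 : ∀ t : ℝ, F t = 0) {z : ℂ}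
    (hz : z ∈ strip) : F z = 0 := by
  -- `ψ` maps the strip `0 ≤ Re w ≤ 1` to a sector of the right half-plane below the real axis, and
  -- `ζ ↦ ζ / (1 + ζ)` maps that sector to a bounded part of `strip`, preserving the real line.
  let ψ : ℂ → ℂ := fun w => Complex.exp (-(I * w))
  let φ : ℂ → ℂ := fun w => 1 - (1 + ψ w)⁻¹
  have hre (w : ℂ) : (-(I * w)).re = w.im := by simp
  have him (w : ℂ) : (-(I * w)).im = -w.re := by simp
  have hψre (w : ℂ) : (ψ w).re = Real.exp w.im * Real.cos w.re := by
    simp only [ψ, Complex.exp_re, hre, him, Real.cos_neg]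
  have hψim (w : ℂ) : (ψ w).im = -(Real.exp w.im * Real.sin w.re) := by
    simp only [ψ, Complex.exp_im, hre, him, Real.sin_neg, mul_neg]
  have hcos {x : ℝ} (h1 : 0 ≤ x) (h2 : x ≤ 1) : 0 < Real.cos x :=
    Real.cos_pos_of_mem_Ioo ⟨by linarith [Real.pi_pos], by linarith [Real.pi_gt_three]⟩
  have hposre {w : ℂ} (h1 : 0 ≤ w.re) (h2 : w.re ≤ 1) : 0 < (ψ w).re := by
    rw [hψre]; exact mul_pos (Real.exp_pos _) (hcos h1 h2)
  have hns {w : ℂ} (h1 : 0 ≤ w.re) (h2 : w.re ≤ 1) : 1 + ψ w ≠ 0 := fun h => by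
    have := congrArg Complex.re h
    have h3 := hposre h1 h2
    simp at this; linarith
  have hnsq (w : ℂ) : normSq (1 + ψ w) = (1 + (ψ w).re) ^ 2 + (ψ w).im ^ 2 := by
    rw [normSq_apply]; simp; ring
  have hφim (w : ℂ) : (φ w).im = (ψ w).im / normSq (1 + ψ w) := by
    simp [φ, inv_im]
    ring
  have hφstrip {w : ℂ} (h1 : 0 ≤ w.re) (h2 : w.re ≤ 1) : φ w ∈ strip := by
    have h3 := hposre h1 h2
    have h4 : (ψ w).im ≤ 0 := by
      rw [hψim]
      have := Real.sin_nonneg_of_nonneg_of_le_pi h1 (by linarith [Real.pi_gt_three])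
      have := mul_nonneg (Real.exp_pos w.im).le this
      linarith
    have h5 : 0 < normSq (1 + ψ w) := normSq_pos.2 (hns h1 h2)
    refine ⟨?_, ?_⟩
    · rw [hφim, le_div_iff₀ h5, hnsq]
      nlinarith [sq_nonneg ((ψ w).im + 1)]
    · rw [hφim]; exact div_nonpos_of_nonpos_of_nonneg h4 h5.le
  have hφint {w : ℂ} (h1 : 0 < w.re) (h2 : w.re < 1) : φ w ∈ interior strip := by
    have h3 := hposre h1.le h2.le
    have h4 : (ψ w).im < 0 := by
      rw [hψim]
      have := Real.sin_pos_of_pos_of_lt_pi h1 (by linarith [Real.pi_gt_three])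
      have := mul_pos (Real.exp_pos w.im) this
      linarith
    have h5 : 0 < normSq (1 + ψ w) := normSq_pos.2 (hns h1.le h2.le)
    rw [interior_strip]
    refine ⟨?_, ?_⟩
    · rw [hφim, lt_div_iff₀ h5, hnsq]
      nlinarith [sq_nonneg ((ψ w).im + 1)]
    · rw [hφim]; exact div_neg_of_neg_of_pos h4 h5
  have hψd : Differentiable ℂ ψ := by fun_prop
  have hφd {w : ℂ} (h1 : 0 ≤ w.re) (h2 : w.re ≤ 1) : DifferentiableAt ℂ φ w :=
    ((differentiableAt_const _).add (hψd w)).inv (hns h1 h2) |>.const_sub _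
  have hφbd {w : ℂ} (h1 : 0 ≤ w.re) (h2 : w.re ≤ 1) : ‖φ w‖ ≤ 2 := by
    have h3 := hposre h1 h2
    have h4 : 1 ≤ ‖1 + ψ w‖ := by
      refine le_trans ?_ (Complex.re_le_norm _)
      simp; exact h3.le
    calc ‖φ w‖ ≤ ‖(1 : ℂ)‖ + ‖(1 + ψ w)⁻¹‖ := norm_sub_le _ _
      _ ≤ 1 + 1 := by
        rw [norm_one, norm_inv]
        exact add_le_add_right (inv_le_one_of_one_le₀ h4) _
      _ = 2 := by norm_num
  have hclosed : IsClosed strip :=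
    (isClosed_le continuous_const Complex.continuous_im).inter
      (isClosed_le Complex.continuous_im continuous_const)
  have hcpt : IsCompact (strip ∩ Metric.closedBall 0 2) :=
    (isCompact_closedBall 0 2).inter_left hclosed
  obtain ⟨C, hC⟩ := hcpt.exists_bound_of_continuousOn (hF.1.mono Set.inter_subset_left)
  have hclo : closure (HadamardThreeLines.verticalStrip 0 1) =
      HadamardThreeLines.verticalClosedStrip 0 1 := by
    have : HadamardThreeLines.verticalStrip 0 1 = Set.Ioo (0 : ℝ) 1 ×ℂ Set.univ := by
      ext w; simp [HadamardThreeLines.verticalStrip, mem_reProdIm]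
    rw [this, closure_reProdIm, closure_Ioo (by norm_num)]
    ext w; simp [HadamardThreeLines.verticalClosedStrip, mem_reProdIm]
  -- The bound `0` on the line `Re w = 0` makes the interpolated bound `0 ^ (1 - Re w) * C ^ Re w`
  -- vanish.
  have hvan (w : ℂ) (h1 : 0 < w.re) (h2 : w.re < 1) : F (φ w) = 0 := by
    have key := HadamardThreeLines.norm_le_interp_of_mem_verticalClosedStrip₀₁' (F ∘ φ) (z := w)
      (a := 0) (b := C) ⟨h1.le, h2.le⟩ ⟨?_, ?_⟩ ?_ ?_ ?_
    · rw [Real.zero_rpow (by linarith), zero_mul, norm_le_zero_iff] at key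
      exact key
    · exact hF.2.comp (fun v hv => (hφd hv.1.le hv.2.le).differentiableWithinAt)
        fun v hv => hφint hv.1 hv.2
    · rw [hclo]
      exact hF.1.comp (fun v hv => (hφd hv.1 hv.2).continuousAt.continuousWithinAt)
        fun v hv => hφstrip hv.1 hv.2
    · refine ⟨C, ?_⟩
      rintro _ ⟨v, hv, rfl⟩
      exact hC _ ⟨hφstrip hv.1 hv.2, by simpa using hφbd hv.1 hv.2⟩
    · intro v hv
      have hv0 : v.re = 0 := hv
      have h3 : (φ v).im = 0 := by rw [hφim, hψim, hv0]; simp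
      have h4 : φ v = ((φ v).re : ℂ) := by
        apply Complex.ext <;> simp [h3]
      rw [Function.comp_apply, h4, h0, norm_zero]
    · intro v hv
      have hv0 : v.re = 1 := hv
      exact hC _ ⟨hφstrip (by linarith) (by linarith),
        by simpa using hφbd (w := v) (by linarith) (by linarith)⟩
  -- `φ` is open at `1/2`, so that `F` vanishes near `φ (1/2)`
  let w0 : ℂ := 1 / 2
  have hw0 : w0.re = 1 / 2 := by simp [w0]
  have hstrict : HasStrictDerivAt φ (-(-((1 + ψ w0) ^ 2)⁻¹ * (ψ w0 * -(I * 1)))) w0 := by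
    have h1 : HasStrictDerivAt ψ (ψ w0 * -(I * 1)) w0 :=
      (((hasStrictDerivAt_id w0).const_mul I).fun_neg).cexp
    exact ((hasStrictDerivAt_inv (hns (by rw [hw0]; norm_num) (by rw [hw0]; norm_num))).comp w0
      (h1.const_add 1)).const_sub 1
  have hmap := hstrict.map_nhds_eq (by
    have : (1 + ψ w0) ≠ 0 := hns (by rw [hw0]; norm_num) (by rw [hw0]; norm_num)
    have h2 : ψ w0 ≠ 0 := Complex.exp_ne_zero _
    simp [this, h2])
  have hev : ∀ᶠ u in 𝓝 (φ w0), F u = 0 := by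
    rw [← hmap, Filter.eventually_map]
    have ho : IsOpen {w : ℂ | 0 < w.re ∧ w.re < 1} :=
      (isOpen_lt continuous_const Complex.continuous_re).inter
        (isOpen_lt Complex.continuous_re continuous_const)
    filter_upwards [ho.mem_nhds (show w0 ∈ {w : ℂ | 0 < w.re ∧ w.re < 1} by
      simp only [Set.mem_ofPred_eq, hw0]; norm_num)] with w hw
    exact hvan w hw.1 hw.2
  have hin : Set.EqOn F 0 (interior strip) :=
    (hF.2.analyticOnNhd isOpen_interior).eqOn_zero_of_preconnected_of_eventuallyEq_zero
      isPreconnected_interior_strip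
      (hφint (w := w0) (by rw [hw0]; norm_num) (by rw [hw0]; norm_num)) hev
  exact hin.of_subset_closure hF.1 continuousOn_const interior_subset
    strip_subset_closure_interior hz

lemma eq_of_eq_real [CompleteSpace E] (hF : StripHolo F) (hG : StripHolo G)
    (h : ∀ t : ℝ, F t = G t) {z : ℂ} (hz : z ∈ strip) : F z = G z :=
  sub_eq_zero.1 ((hF.sub hG).eq_zero (fun t => by simp [h]) hz)

/-- A function on the strip whose norm is invariant under real translations is bounded by the
values of the norm at `0` and `-i/2`. -/
lemma norm_le (hF : StripHolo F) (hinv : ∀ z ∈ strip, ∀ t : ℝ, ‖F (z + t)‖ = ‖F z‖) {C : ℝ}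
    (h0 : ‖F 0‖ ≤ C) (h1 : ‖F (-(I / 2))‖ ≤ C) {z : ℂ} (hz : z ∈ strip) : ‖F z‖ ≤ C := by
  have hsplit (w : ℂ) (hw : w ∈ strip) : ‖F w‖ = ‖F (w.im * I)‖ := by
    rw [← hinv (w.im * I) (by simpa [strip] using hw) w.re, add_comm, re_add_im]
  have hpre : im ⁻¹' Set.Ioo (-(1 / 2)) 0 = interior strip := by
    rw [interior_strip]; rfl
  have hcl : closure (interior strip) ⊆ strip :=
    closure_minimal interior_subset ((isClosed_le continuous_const Complex.continuous_im).inter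
      (isClosed_le Complex.continuous_im continuous_const))
  have hmap : Set.MapsTo (fun y : ℝ => (y : ℂ) * I) (Set.Icc (-(1 / 2)) 0) strip := by
    intro y hy; simpa [strip] using hy
  obtain ⟨B, hB⟩ := isCompact_Icc.exists_bound_of_continuousOn
    (hF.1.comp (Continuous.continuousOn (by fun_prop)) hmap)
  have hbd (w : ℂ) (hw : w ∈ strip) : ‖F w‖ ≤ B := by
    rw [hsplit w hw]; exact hB w.im hw
  refine PhragmenLindelof.horizontal_strip (a := -(1 / 2)) (b := 0) (f := F) ⟨?_, ?_⟩ ?_ ?_ ?_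
    hz.1 hz.2
  · rw [hpre]; exact hF.2
  · rw [hpre]; exact hF.1.mono hcl
  · refine ⟨0, by positivity, 0, ?_⟩
    refine Asymptotics.IsBigO.of_bound B ?_
    filter_upwards [Filter.mem_inf_of_right (Filter.mem_principal_self _)] with w hw
    rw [hpre] at hw
    simpa using hbd w (interior_subset hw)
  · intro w hw
    rw [hsplit w (by simp [strip, hw]), hw]
    convert! h1 using 3; push_cast; ring
  · intro w hw
    rw [hsplit w (by simp [strip, hw]), hw]
    simpa using h0

/-- A scalar function on the strip that is invariant under real translations is constant. -/
lemma eq_of_translate {f : ℂ → ℂ} (hf : StripHolo f)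
    (hinv : ∀ z ∈ strip, ∀ t : ℝ, f (z + t) = f z) {z w : ℂ} (hz : z ∈ strip) (hw : w ∈ strip) :
    f z = f w := by
  have hq : -(I / 4) ∈ interior strip := by
    rw [interior_strip]; simp; norm_num
  have hd : Set.EqOn (deriv f) 0 (interior strip) := by
    intro u hu
    have hda := (hf.2.differentiableAt (isOpen_interior.mem_nhds hu)).hasDerivAt
    have h1 : HasDerivAt (fun t : ℝ => f (u + t)) (deriv f u) 0 := by
      have h2 : HasDerivAt (fun v : ℂ => f (u + v)) (deriv f u) ((0 : ℝ) : ℂ) := by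
        apply HasDerivAt.comp_const_add
        simpa using hda
      exact h2.comp_ofReal
    have h2 : (fun t : ℝ => f (u + t)) = fun _ => f u :=
      funext fun t => hinv u (interior_subset hu) t
    rw [h2] at h1
    exact h1.unique (hasDerivAt_const _ _)
  have hc : Set.EqOn f (fun _ => f (-(I / 4))) (interior strip) := fun u hu =>
    isOpen_interior.is_const_of_deriv_eq_zero isPreconnected_interior_strip hf.2 hd hu hq
  have := hc.of_subset_closure hf.1 continuousOn_const interior_subset
    strip_subset_closure_interior
  rw [this hz, this hw]

/-- A bounded scalar function on the strip that is real on both boundary lines is constant: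
`e^{if}` and `e^{-if}` are bounded by `1` by the Phragmén-Lindelöf principle, so that `f` is real
everywhere. -/
lemma eq_of_real_boundary {f : ℂ → ℂ} (hf : StripHolo f) {B : ℝ} (hB : ∀ z ∈ strip, ‖f z‖ ≤ B)
    (h0 : ∀ z : ℂ, z.im = 0 → (f z).im = 0) (h1 : ∀ z : ℂ, z.im = -(1 / 2) → (f z).im = 0)
    {z w : ℂ} (hz : z ∈ strip) (hw : w ∈ strip) : f z = f w := by
  have hpre : im ⁻¹' Set.Ioo (-(1 / 2)) 0 = interior strip := by
    rw [interior_strip]; rfl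
  have hcl : closure (interior strip) ⊆ strip :=
    closure_minimal interior_subset ((isClosed_le continuous_const Complex.continuous_im).inter
      (isClosed_le Complex.continuous_im continuous_const))
  have key (c : ℝ) (u : ℂ) (hu : u ∈ strip) : ‖Complex.exp (c * I * f u)‖ ≤ 1 := by
    refine PhragmenLindelof.horizontal_strip (a := -(1 / 2)) (b := 0)
      (f := fun u => Complex.exp (c * I * f u)) ⟨?_, ?_⟩ ?_ ?_ ?_ hu.1 hu.2
    · rw [hpre]; exact (hf.2.const_mul _).cexp
    · rw [hpre]; exact ((hf.1.mono hcl).const_smul (c * I)).cexp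
    · refine ⟨0, by positivity, 0, ?_⟩
      refine Asymptotics.IsBigO.of_bound (Real.exp (|c| * B)) ?_
      filter_upwards [Filter.mem_inf_of_right (Filter.mem_principal_self _)] with w hw
      rw [hpre] at hw
      rw [Complex.norm_exp]
      have h2 : ‖c * I * f w‖ ≤ |c| * B := by
        simpa using mul_le_mul_of_nonneg_left (hB w (interior_subset hw)) (abs_nonneg c)
      simpa using (Complex.re_le_norm _).trans h2
    · intro w hw
      rw [Complex.norm_exp]
      simp [h1 w hw]
    · intro w hw
      rw [Complex.norm_exp]
      simp [h0 w hw]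
  -- `c = 1` and `c = -1` bound the imaginary part from both sides
  have hreal (u : ℂ) (hu : u ∈ strip) : (f u).im = 0 := by
    have e1 := key 1 u hu
    have e2 := key (-1) u hu
    rw [Complex.norm_exp, Real.exp_le_one_iff] at e1 e2
    simp at e1 e2
    linarith
  have hq : -(I / 4) ∈ interior strip := by
    rw [interior_strip]; simp; norm_num
  have hd : Set.EqOn (deriv f) 0 (interior strip) := by
    intro u hu
    have hda := (hf.2.differentiableAt (isOpen_interior.mem_nhds hu)).hasDerivAt
    -- the directional derivatives of a real-valued function are real
    have haux (d : ℂ) : (deriv f u * d).im = 0 := by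
      have h2 : HasDerivAt (fun t : ℝ => (f (u + t * d)).im) (deriv f u * d).im 0 := by
        have h3 : HasDerivAt (fun v : ℂ => f (u + v * d)) (deriv f u * d) ((0 : ℝ) : ℂ) := by
          have h4 : HasDerivAt (fun v : ℂ => u + v * d) d ((0 : ℝ) : ℂ) := by
            simpa using ((hasDerivAt_id ((0 : ℝ) : ℂ)).mul_const d).const_add u
          exact HasDerivAt.comp ((0 : ℝ) : ℂ) (by simpa using hda) h4
        exact imCLM.hasFDerivAt.comp_hasDerivAt (0 : ℝ) h3.comp_ofReal
      have h3 : (fun t : ℝ => (f (u + t * d)).im) =ᶠ[𝓝 0] fun _ => 0 := by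
        have hc : ContinuousAt (fun t : ℝ => u + t * d) 0 := by fun_prop
        have := hc.preimage_mem_nhds (t := interior strip) (by
          simpa using isOpen_interior.mem_nhds hu)
        filter_upwards [this] with t ht
        exact hreal _ (interior_subset ht)
      exact (h2.congr_of_eventuallyEq h3.symm).unique (hasDerivAt_const _ _)
    have e1 := haux 1
    have e2 := haux I
    apply Complex.ext <;> simp at e1 e2 ⊢ <;> assumption
  have hc : Set.EqOn f (fun _ => f (-(I / 4))) (interior strip) := fun u hu =>
    isOpen_interior.is_const_of_deriv_eq_zero isPreconnected_interior_strip hf.2 hd hu hq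
  have := hc.of_subset_closure hf.1 continuousOn_const interior_subset
    strip_subset_closure_interior
  rw [this hz, this hw]

end StripHolo

end Strip

/-! ### The analytic generator of a unitary one-parameter group -/

section Generator

open Complex Topology

variable {ℋ : Type*} [NormedAddCommGroup ℋ] [InnerProductSpace ℂ ℋ]

/-- A strongly continuous one-parameter group of unitary operators. -/
structure IsUnitaryGroup (D : ℝ → ℋ ≃ₗᵢ[ℂ] ℋ) : Prop where
  add : ∀ s t : ℝ, ∀ v, D (s + t) v = D s (D t v)
  continuous : ∀ v, Continuous fun t => D t v

/-- `F` continues the orbit map `t ↦ D t v` holomorphically to the strip. -/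
def Continues (D : ℝ → ℋ ≃ₗᵢ[ℂ] ℋ) (v : ℋ) (F : ℂ → ℋ) : Prop :=
  StripHolo F ∧ ∀ t : ℝ, F t = D t v

/-- The pairing of two functions on the strip that is sesquilinear and holomorphic. -/
lemma StripHolo.pairing {F G : ℂ → ℋ} (hF : StripHolo F) (hG : StripHolo G) :
    StripHolo fun z => ⟪F (conj z - I / 2), G z⟫_ℂ := by
  have h := hF.conj_comp (innerSL ℂ)
  exact ⟨h.1.clm_apply hG.1, h.2.clm_apply hG.2⟩

lemma zero_mem_strip : (0 : ℂ) ∈ strip := by simp [strip]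

lemma half_mem_strip : -(I / 2) ∈ strip := by simp [strip]

lemma quarter_mem_strip : -(I / 4) ∈ strip := by simp [strip]; norm_num

lemma conj_half : conj (-(I / 2)) - I / 2 = 0 := by
  apply Complex.ext <;> simp [-map_neg, -map_div₀]

lemma conj_quarter : conj (-(I / 4)) - I / 2 = -(I / 4) := by
  apply Complex.ext <;> simp [-map_neg, -map_div₀]; norm_num

lemma conj_zero_sub : conj (0 : ℂ) - I / 2 = -(I / 2) := by simp

namespace Continues

variable {D : ℝ → ℋ ≃ₗᵢ[ℂ] ℋ} {v w : ℋ} {F G : ℂ → ℋ}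

lemma add (hF : Continues D v F) (hG : Continues D w G) :
    Continues D (v + w) fun z => F z + G z :=
  ⟨hF.1.add hG.1, fun t => by simp only [hF.2, hG.2, map_add]⟩

lemma smul (c : ℂ) (hF : Continues D v F) : Continues D (c • v) fun z => c • F z :=
  ⟨⟨hF.1.1.const_smul c, hF.1.2.const_smul c⟩, fun t => by simp only [hF.2, map_smul]⟩

lemma zero : Continues D 0 fun _ => 0 := ⟨StripHolo.const 0, fun t => by simp⟩

end Continues

namespace IsUnitaryGroup

variable {D : ℝ → ℋ ≃ₗᵢ[ℂ] ℋ} {v w : ℋ} {F G : ℂ → ℋ}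

lemma zero_apply (hD : IsUnitaryGroup D) (v : ℋ) : D 0 v = v :=
  (D 0).injective (by rw [← hD.add, add_zero])

lemma neg_apply (hD : IsUnitaryGroup D) (t : ℝ) (v : ℋ) : D (-t) (D t v) = v := by
  rw [← hD.add, neg_add_cancel, hD.zero_apply]

lemma inner_apply_left (hD : IsUnitaryGroup D) (t : ℝ) (v w : ℋ) :
    ⟪D t v, w⟫_ℂ = ⟪v, D (-t) w⟫_ℂ := by
  rw [← (D (-t)).inner_map_map, hD.neg_apply]

lemma continues_zero (hD : IsUnitaryGroup D) (hF : Continues D v F) : F 0 = v := by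
  simpa [hD.zero_apply] using hF.2 0

/-- The graph of the analytic continuation of `D` to `-i/2`. -/
def graph (D : ℝ → ℋ ≃ₗᵢ[ℂ] ℋ) : Submodule ℂ (ℋ × ℋ) where
  carrier := {p | ∃ F, Continues D p.1 F ∧ F (-(I / 2)) = p.2}
  add_mem' := by
    rintro p q ⟨F, hF, hF'⟩ ⟨G, hG, hG'⟩
    exact ⟨_, hF.add hG, by simp [hF', hG']⟩
  zero_mem' := ⟨_, Continues.zero, rfl⟩
  smul_mem' := by
    rintro c p ⟨F, hF, hF'⟩
    exact ⟨_, hF.smul c, by simp [hF']⟩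

lemma mem_graph {p : ℋ × ℋ} :
    p ∈ graph D ↔ ∃ F, Continues D p.1 F ∧ F (-(I / 2)) = p.2 := Iff.rfl

variable [CompleteSpace ℋ]

lemma continues_add (hD : IsUnitaryGroup D) (hF : Continues D v F) (t : ℝ) {z : ℂ}
    (hz : z ∈ strip) : F (z + t) = D t (F z) := by
  refine (hF.1.translate t).eq_of_eq_real
    (hF.1.clm ((D t).toContinuousLinearEquiv : ℋ →L[ℂ] ℋ)) (fun s => ?_) hz
  change F (s + t) = D t (F s)
  rw [hF.2, ← ofReal_add, hF.2, add_comm, hD.add]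

/-- For two continued orbit maps the holomorphic pairing is constant on the strip. -/
lemma pairing_eq (hD : IsUnitaryGroup D) (hF : Continues D v F) (hG : Continues D w G) {z z' : ℂ}
    (hz : z ∈ strip) (hz' : z' ∈ strip) :
    ⟪F (conj z - I / 2), G z⟫_ℂ = ⟪F (conj z' - I / 2), G z'⟫_ℂ := by
  refine (hF.1.pairing hG.1).eq_of_translate (fun z hz t => ?_) hz hz'
  have : conj (z + t) - I / 2 = conj z - I / 2 + t := by simp; ring
  simp only [this]
  rw [hD.continues_add hF t (StripHolo.conj_sub_mem hz), hD.continues_add hG t hz,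
    (D t).inner_map_map]

lemma norm_continues_le (hD : IsUnitaryGroup D) (hF : Continues D v F) {C : ℝ} (h0 : ‖v‖ ≤ C)
    (h1 : ‖F (-(I / 2))‖ ≤ C) {z : ℂ} (hz : z ∈ strip) : ‖F z‖ ≤ C :=
  hF.1.norm_le (fun z hz t => by rw [hD.continues_add hF t hz, (D t).norm_map])
    (by rwa [hD.continues_zero hF]) h1 hz

lemma graph_fst_zero {p : ℋ × ℋ} (hp : p ∈ graph D) (h : p.1 = 0) : p.2 = 0 := by
  obtain ⟨F, hF, hF'⟩ := hp
  rw [h] at hF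
  rw [← hF', hF.1.eq_of_eq_real (StripHolo.const 0) (fun t => by rw [hF.2, map_zero])
    half_mem_strip]

/-- The analytic generator `D_{-i/2}` of `D`. -/
def generator (D : ℝ → ℋ ≃ₗᵢ[ℂ] ℋ) : ℋ →ₗ.[ℂ] ℋ := (graph D).toLinearPMap

lemma graph_generator : (generator D).graph = graph D :=
  Submodule.toLinearPMap_graph_eq _ fun _ hp h => graph_fst_zero hp h

lemma generator_iff : (∃ ζ : (generator D).domain, (ζ : ℋ) = v ∧ generator D ζ = w) ↔
    ∃ F, Continues D v F ∧ F (-(I / 2)) = w := by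
  rw [← LinearPMap.mem_graph_iff (generator D) (x := (v, w)), graph_generator, mem_graph]

lemma isImaginaryPowers (hD : IsUnitaryGroup D) : IsImaginaryPowers (generator D) D where
  add := hD.add
  continuous := hD.continuous
  continuation v w := by
    rw [generator_iff]
    simp only [Continues, StripHolo, and_assoc]

lemma graph_symm {p q : ℋ × ℋ} (hD : IsUnitaryGroup D) (hp : p ∈ graph D) (hq : q ∈ graph D) :
    ⟪p.2, q.1⟫_ℂ = ⟪p.1, q.2⟫_ℂ := by
  obtain ⟨F, hF, hF'⟩ := hp
  obtain ⟨G, hG, hG'⟩ := hq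
  have := hD.pairing_eq hF hG zero_mem_strip half_mem_strip
  rwa [conj_half, conj_zero_sub, hD.continues_zero hF, hD.continues_zero hG, hF', hG'] at this

lemma graph_nonneg {p : ℋ × ℋ} (hD : IsUnitaryGroup D) (hp : p ∈ graph D) :
    0 ≤ (⟪p.1, p.2⟫_ℂ).re := by
  obtain ⟨F, hF, hF'⟩ := hp
  have := hD.pairing_eq hF hF half_mem_strip quarter_mem_strip
  rw [conj_half, conj_quarter, hD.continues_zero hF, hF'] at this
  rw [this]
  exact inner_self_nonneg (𝕜 := ℂ)

/-- The analytic generator is closed: by the three lines theorem, convergence of the orbit maps at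
`0` and `-i/2` implies uniform convergence of their continuations. -/
lemma isClosed_graph (hD : IsUnitaryGroup D) : IsClosed (graph D : Set (ℋ × ℋ)) := by
  refine IsSeqClosed.isClosed fun p q hp hq => ?_
  choose F hF hF' using fun n => mem_graph.1 (hp n)
  have hdiff (m n : ℕ) : Continues D ((p m).1 - (p n).1) fun z => F m z - F n z :=
    ⟨(hF m).1.sub (hF n).1, fun t => by simp only [(hF m).2, (hF n).2, map_sub]⟩
  have hcau : UniformCauchySeqOn F Filter.atTop strip := by
    rw [Metric.uniformCauchySeqOn_iff]
    intro ε hε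
    obtain ⟨N, hN⟩ := Metric.cauchySeq_iff.1 hq.cauchySeq (ε / 2) (by positivity)
    refine ⟨N, fun m hm n hn z hz => ?_⟩
    have h1 : dist (p m) (p n) ≤ ε / 2 := (hN m hm n hn).le
    rw [dist_eq_norm] at h1 ⊢
    refine (hD.norm_continues_le (hdiff m n) ?_ ?_ hz).trans_lt (half_lt_self hε)
    · exact (norm_fst_le (p m - p n)).trans h1
    · rw [hF', hF']
      exact (norm_snd_le (p m - p n)).trans h1
  have hlim (z : ℂ) (hz : z ∈ strip) : ∃ y, Filter.Tendsto (fun n => F n z) Filter.atTop (𝓝 y) :=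
    cauchySeq_tendsto_of_complete (hcau.cauchySeq hz)
  choose! G hG using hlim
  have hunif : TendstoUniformlyOn F G Filter.atTop strip :=
    hcau.tendstoUniformlyOn_of_tendsto hG
  refine ⟨G, ⟨⟨hunif.continuousOn (Filter.Frequently.of_forall fun n => (hF n).1.1), ?_⟩,
    fun t => ?_⟩, ?_⟩
  · exact (hunif.mono interior_subset).tendstoLocallyUniformlyOn.differentiableOn
      (Filter.Eventually.of_forall fun n => (hF n).1.2) isOpen_interior
  · have h1 := hG (t : ℂ) (by simp [strip])
    simp only [(hF _).2] at h1
    exact tendsto_nhds_unique h1 (((D t).continuous.tendsto _).comp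
      ((continuous_fst.tendsto _).comp hq))
  · have h1 := hG _ half_mem_strip
    simp only [hF'] at h1
    exact tendsto_nhds_unique h1 ((continuous_snd.tendsto _).comp hq)

end IsUnitaryGroup

end Generator

/-! ### Gaussian regularization -/

section Gaussian

open Complex Topology MeasureTheory

variable {ℋ : Type*} [NormedAddCommGroup ℋ] [InnerProductSpace ℂ ℋ]

/-- A Gaussian bound that is locally uniform in `z`, and hence dominates the integrals below. -/
lemma norm_cexp_neg_sq_le (c s : ℝ) (z : ℂ) :
    ‖cexp (-((s : ℂ) - c * z) ^ 2)‖ ≤ Real.exp (c ^ 2 * ‖z‖ ^ 2) * Real.exp (-(1 / 2) * s ^ 2) := by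
  rw [Complex.norm_exp, ← Real.exp_add, Real.exp_le_exp, ← normSq_eq_norm_sq, normSq_apply]
  simp [pow_two]
  nlinarith [sq_nonneg (s - 2 * c * z.re)]

/-- The Gaussian average of an orbit, moved to the complex time `z`. -/
def gaussOrbit (D : ℝ → ℋ ≃ₗᵢ[ℂ] ℋ) (c : ℝ) (v : ℋ) (z : ℂ) : ℋ :=
  ∫ s : ℝ, cexp (-((s : ℂ) - c * z) ^ 2) • D (s / c) v

namespace IsUnitaryGroup

variable {D : ℝ → ℋ ≃ₗᵢ[ℂ] ℋ}

lemma continuous_gauss (hD : IsUnitaryGroup D) (c : ℝ) (v : ℋ) (z : ℂ) :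
    Continuous fun s : ℝ => cexp (-((s : ℂ) - c * z) ^ 2) • D (s / c) v :=
  (by fun_prop : Continuous fun s : ℝ => cexp (-((s : ℂ) - c * z) ^ 2)).smul
    ((hD.continuous v).comp (by fun_prop))

lemma integrable_gauss (hD : IsUnitaryGroup D) (c : ℝ) (v : ℋ) (z : ℂ) :
    Integrable fun s : ℝ => cexp (-((s : ℂ) - c * z) ^ 2) • D (s / c) v := by
  refine Integrable.mono' (((integrable_exp_neg_mul_sq (b := 1 / 2) (by norm_num)).const_mul
    (Real.exp (c ^ 2 * ‖z‖ ^ 2))).mul_const ‖v‖) (hD.continuous_gauss c v z).aestronglyMeasurable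
    (Filter.Eventually.of_forall fun s => ?_)
  rw [norm_smul, LinearIsometryEquiv.norm_map]
  exact mul_le_mul_of_nonneg_right (norm_cexp_neg_sq_le c s z) (norm_nonneg _)

lemma differentiable_gaussOrbit [CompleteSpace ℋ] (hD : IsUnitaryGroup D) (c : ℝ) (v : ℋ) :
    Differentiable ℂ (gaussOrbit D c v) := by
  intro z₀
  let R := ‖z₀‖ + 1
  let B : ℝ → ℝ := fun s => Real.exp (c ^ 2 * R ^ 2) * (2 * |c| * ‖v‖) *
    (|s * Real.exp (-(1 / 2) * s ^ 2)| + |c| * R * Real.exp (-(1 / 2) * s ^ 2))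
  have hder (s : ℝ) (z : ℂ) : HasDerivAt (fun z => cexp (-((s : ℂ) - c * z) ^ 2) • D (s / c) v)
      ((cexp (-((s : ℂ) - c * z) ^ 2) * (2 * c * (s - c * z))) • D (s / c) v) z := by
    have h1 : HasDerivAt (fun z : ℂ => -((s : ℂ) - c * z) ^ 2) (2 * c * (s - c * z)) z := by
      have h2 := (((hasDerivAt_id z).const_mul (c : ℂ)).const_sub (s : ℂ)).fun_pow 2 |>.fun_neg
      convert! h2 using 1
      simp; ring
    exact h1.cexp.smul_const _
  refine (hasDerivAt_integral_of_dominated_loc_of_deriv_le (bound := B)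
    (F' := fun z s => (cexp (-((s : ℂ) - c * z) ^ 2) * (2 * c * (s - c * z))) • D (s / c) v)
    (Metric.ball_mem_nhds z₀ one_pos)
    (Filter.Eventually.of_forall fun z => (hD.continuous_gauss c v z).aestronglyMeasurable)
    (hD.integrable_gauss c v z₀) ?_ (Filter.Eventually.of_forall fun s z hz => ?_) ?_
    (Filter.Eventually.of_forall fun s z hz => hder s z)).2.differentiableAt
  · exact ((by fun_prop : Continuous fun s : ℝ => cexp (-((s : ℂ) - c * z₀) ^ 2) *
      (2 * c * (s - c * z₀))).smul
        ((hD.continuous v).comp (by fun_prop))).aestronglyMeasurable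
  · have hzR : ‖z‖ ≤ R := by
      have h1 : ‖z - z₀‖ < 1 := by simpa [dist_eq_norm] using hz
      have h2 := norm_le_norm_add_norm_sub' z z₀
      simp only [R]; linarith
    have hR : 0 ≤ R := (norm_nonneg z).trans hzR
    have h1 : ‖cexp (-((s : ℂ) - c * z) ^ 2)‖ ≤
        Real.exp (c ^ 2 * R ^ 2) * Real.exp (-(1 / 2) * s ^ 2) :=
      (norm_cexp_neg_sq_le c s z).trans (by gcongr)
    have h2 : ‖(2 * c * (s - c * z) : ℂ)‖ ≤ 2 * |c| * (|s| + |c| * R) := by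
      rw [norm_mul, norm_mul, norm_real, Real.norm_eq_abs]
      have h3 : ‖(s - c * z : ℂ)‖ ≤ |s| + |c| * R := by
        refine (norm_sub_le _ _).trans ?_
        rw [norm_mul, norm_real, norm_real, Real.norm_eq_abs, Real.norm_eq_abs]
        gcongr
      simpa using mul_le_mul_of_nonneg_left h3 (by positivity : 0 ≤ 2 * |c|)
    rw [norm_smul, LinearIsometryEquiv.norm_map, norm_mul]
    calc _ ≤ (Real.exp (c ^ 2 * R ^ 2) * Real.exp (-(1 / 2) * s ^ 2)) *
          (2 * |c| * (|s| + |c| * R)) * ‖v‖ := by gcongr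
      _ = B s := by
        simp only [B, abs_mul, abs_of_pos (Real.exp_pos _)]
        ring
  · exact (((integrable_mul_exp_neg_mul_sq (b := 1 / 2) (by norm_num)).abs).add
      ((integrable_exp_neg_mul_sq (b := 1 / 2) (by norm_num)).const_mul _)).const_mul _

/-- Real times act on Gaussian averages by translation. -/
lemma gaussOrbit_ofReal [CompleteSpace ℋ] (hD : IsUnitaryGroup D) {c : ℝ} (hc : c ≠ 0) (v : ℋ)
    (t : ℝ) : gaussOrbit D c v t = D t (gaussOrbit D c v 0) := by
  unfold gaussOrbit
  rw [← integral_add_right_eq_self _ (c * t)]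
  have h1 := ((D t).toContinuousLinearEquiv : ℋ →L[ℂ] ℋ).integral_comp_comm
    (hD.integrable_gauss c v 0)
  refine Eq.trans ?_ h1
  refine integral_congr_ae (Filter.Eventually.of_forall fun s => ?_)
  change _ = D t _
  have h2 : (s + c * t) / c = t + s / c := by field_simp; ring
  simp only [map_smul, h2, hD.add]
  congr 2
  push_cast; ring

lemma continues_gaussOrbit [CompleteSpace ℋ] (hD : IsUnitaryGroup D) {c : ℝ} (hc : c ≠ 0) (v : ℋ) :
    Continues D (gaussOrbit D c v 0) (gaussOrbit D c v) :=
  ⟨⟨(hD.differentiable_gaussOrbit c v).continuous.continuousOn,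
    (hD.differentiable_gaussOrbit c v).differentiableOn⟩, hD.gaussOrbit_ofReal hc v⟩

/-- The Gaussian average as a bounded operator. -/
def gaussOp (hD : IsUnitaryGroup D) (c : ℝ) : ℋ →L[ℂ] ℋ :=
  LinearMap.mkContinuous
    { toFun := fun v => gaussOrbit D c v 0
      map_add' := fun v w => by
        simp only [gaussOrbit]
        rw [← integral_add (hD.integrable_gauss c v 0) (hD.integrable_gauss c w 0)]
        simp
      map_smul' := fun a v => by
        simp only [gaussOrbit, RingHom.id_apply]
        rw [← integral_smul]
        simp only [map_smul]
        simp_rw [smul_comm a] }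
    (∫ s : ℝ, Real.exp (-(1 / 2) * s ^ 2)) fun v => by
      change ‖∫ s : ℝ, _‖ ≤ _
      rw [← integral_mul_const]
      refine norm_integral_le_of_norm_le
        ((integrable_exp_neg_mul_sq (b := 1 / 2) (by norm_num)).mul_const ‖v‖)
        (Filter.Eventually.of_forall fun s => ?_)
      rw [norm_smul, LinearIsometryEquiv.norm_map]
      have := norm_cexp_neg_sq_le c s 0
      simp only [norm_zero] at this
      refine mul_le_mul_of_nonneg_right (this.trans ?_) (norm_nonneg _)
      simp

lemma gaussOp_apply (hD : IsUnitaryGroup D) (c : ℝ) (v : ℋ) :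
    hD.gaussOp c v = gaussOrbit D c v 0 := rfl

lemma gaussOp_comm [CompleteSpace ℋ] (hD : IsUnitaryGroup D) (c t : ℝ) (v : ℋ) :
    hD.gaussOp c (D t v) = D t (hD.gaussOp c v) := by
  simp only [gaussOp_apply, gaussOrbit]
  have h1 := ((D t).toContinuousLinearEquiv : ℋ →L[ℂ] ℋ).integral_comp_comm
    (hD.integrable_gauss c v 0)
  refine Eq.trans ?_ h1
  refine integral_congr_ae (Filter.Eventually.of_forall fun s => ?_)
  change _ = D t _
  simp only [map_smul, ← hD.add, add_comm]

lemma gaussOp_symm [CompleteSpace ℋ] (hD : IsUnitaryGroup D) (c : ℝ) (v w : ℋ) :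
    ⟪hD.gaussOp c v, w⟫_ℂ = ⟪v, hD.gaussOp c w⟫_ℂ := by
  have hc (s : ℝ) : conj (cexp (-((s : ℂ) - c * 0) ^ 2)) = cexp (-((s : ℂ) - c * 0) ^ 2) := by
    rw [← Complex.exp_conj]; simp
  have h1 : ⟪w, hD.gaussOp c v⟫_ℂ = ∫ s : ℝ, ⟪w, cexp (-((s : ℂ) - c * 0) ^ 2) • D (s / c) v⟫_ℂ :=
    ((innerSL ℂ w).integral_comp_comm (hD.integrable_gauss c v 0)).symm
  have h2 : ⟪v, hD.gaussOp c w⟫_ℂ = ∫ s : ℝ, ⟪v, cexp (-((s : ℂ) - c * 0) ^ 2) • D (s / c) w⟫_ℂ :=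
    ((innerSL ℂ v).integral_comp_comm (hD.integrable_gauss c w 0)).symm
  rw [← inner_conj_symm, h1, ← integral_conj, h2, ← integral_neg_eq_self]
  refine integral_congr_ae (Filter.Eventually.of_forall fun s => ?_)
  simp only [inner_smul_right]
  rw [map_mul, inner_conj_symm, hD.inner_apply_left, hc]
  congr 2
  · simp
  · rw [neg_div, neg_neg]

/-- The Gaussian averages tend to a multiple of the identity. -/
lemma tendsto_gaussOp [CompleteSpace ℋ] (hD : IsUnitaryGroup D) (v : ℋ) :
    Filter.Tendsto (fun n : ℕ => ((√Real.pi)⁻¹ : ℂ) • hD.gaussOp (n + 1) v) Filter.atTop (𝓝 v) := by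
  have hlim : Filter.Tendsto (fun n : ℕ => hD.gaussOp (n + 1) v) Filter.atTop
      (𝓝 (∫ s : ℝ, cexp (-(s : ℂ) ^ 2) • v)) := by
    refine tendsto_integral_of_dominated_convergence
      (fun s => Real.exp (-(1 / 2) * s ^ 2) * ‖v‖)
      (fun n => (hD.continuous_gauss _ v 0).aestronglyMeasurable)
      ((integrable_exp_neg_mul_sq (b := 1 / 2) (by norm_num)).mul_const ‖v‖)
      (fun n => Filter.Eventually.of_forall fun s => ?_) (Filter.Eventually.of_forall fun s => ?_)
    · rw [norm_smul, LinearIsometryEquiv.norm_map]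
      have := norm_cexp_neg_sq_le (n + 1) s 0
      simp only [norm_zero] at this
      refine mul_le_mul_of_nonneg_right (this.trans ?_) (norm_nonneg _)
      simp
    · have h1 : Filter.Tendsto (fun n : ℕ => s / ((n : ℝ) + 1)) Filter.atTop (𝓝 0) := by
        simpa [div_eq_mul_inv] using
          (tendsto_one_div_add_atTop_nhds_zero_nat (𝕜 := ℝ)).const_mul s
      have h2 := ((hD.continuous v).tendsto 0).comp h1
      rw [hD.zero_apply] at h2
      simpa using h2.const_smul (cexp (-(s : ℂ) ^ 2))
  have hint : ∫ s : ℝ, cexp (-(s : ℂ) ^ 2) • v = (√Real.pi : ℂ) • v := by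
    rw [integral_smul_const]
    congr 1
    have h1 := integral_gaussian 1
    rw [div_one] at h1
    rw [← h1, ← integral_complex_ofReal]
    refine integral_congr_ae (Filter.Eventually.of_forall fun s => ?_)
    simp
  rw [hint] at hlim
  have h0 : (√Real.pi : ℂ) ≠ 0 := by
    exact_mod_cast (Real.sqrt_pos.2 Real.pi_pos).ne'
  have h2 := hlim.const_smul ((√Real.pi)⁻¹ : ℂ)
  rwa [smul_smul, inv_mul_cancel₀ h0, one_smul] at h2

variable [CompleteSpace ℋ]

lemma dense_domain (hD : IsUnitaryGroup D) : Dense ((generator D).domain : Set ℋ) := by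
  intro v
  refine mem_closure_of_tendsto (hD.tendsto_gaussOp v) (Filter.Eventually.of_forall fun n => ?_)
  refine Submodule.smul_mem _ _ ?_
  obtain ⟨ζ, hζ, -⟩ := generator_iff.2 ⟨_, hD.continues_gaussOrbit
    (c := (n : ℝ) + 1) (by positivity) v, rfl⟩
  rw [hD.gaussOp_apply, ← hζ]
  exact ζ.2

/-- Gaussian averages commute with the analytic generator. -/
lemma gaussOp_graph (hD : IsUnitaryGroup D) (c : ℝ) {p : ℋ × ℋ} (hp : p ∈ graph D) :
    (hD.gaussOp c p.1, hD.gaussOp c p.2) ∈ graph D := by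
  obtain ⟨F, hF, hF'⟩ := hp
  exact ⟨fun z => hD.gaussOp c (F z), ⟨hF.1.clm _, fun t => by simp only [hF.2, hD.gaussOp_comm]⟩,
    by simp only [hF']⟩

lemma generator_mem_graph (ζ : (generator D).domain) : ((ζ : ℋ), generator D ζ) ∈ graph D :=
  graph_generator (D := D) ▸ (generator D).mem_graph ζ

/-- The analytic generator is self-adjoint. Vectors in the domain of the adjoint are regularized
by Gaussian averages, which lie in the domain of the generator. -/
lemma isSelfAdjoint_generator (hD : IsUnitaryGroup D) : IsSelfAdjoint (generator D) := by
  rw [LinearPMap.isSelfAdjoint_def]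
  have hd := hD.dense_domain
  have hform : (generator D).IsFormalAdjoint (generator D) := fun ζ η =>
    hD.graph_symm (generator_mem_graph ζ) (generator_mem_graph η)
  refine le_antisymm (LinearPMap.le_of_le_graph ?_) (hform.le_adjoint hd)
  rintro ⟨w, w'⟩ hw
  rw [LinearPMap.mem_graph_iff] at hw
  obtain ⟨ω, hω, hω'⟩ := hw
  simp only at hω hω'
  rw [graph_generator]
  have hadj (p : ℋ × ℋ) (hp : p ∈ graph D) : ⟪w', p.1⟫_ℂ = ⟪w, p.2⟫_ℂ := by
    obtain ⟨ζ, hζ, hζ'⟩ := generator_iff.2 (mem_graph.1 hp)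
    rw [← hζ, ← hζ', ← hω, ← hω']
    exact LinearPMap.adjoint_isFormalAdjoint hd ω ζ
  -- Regularization moves `(w, w')` from the graph of the adjoint to the graph of the generator.
  have hreg (n : ℕ) : (hD.gaussOp (n + 1) w, hD.gaussOp (n + 1) w') ∈ graph D := by
    have hc : (n : ℝ) + 1 ≠ 0 := by positivity
    have h1 : (hD.gaussOp (n + 1) w, gaussOrbit D (n + 1) w (-(I / 2))) ∈ graph D :=
      ⟨_, hD.continues_gaussOrbit hc w, rfl⟩
    have h2 : gaussOrbit D (n + 1) w (-(I / 2)) = hD.gaussOp (n + 1) w' := by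
      refine hd.eq_of_inner_left (𝕜 := ℂ) fun v hv => ?_
      have hv' := generator_mem_graph (D := D) ⟨v, hv⟩
      have e1 := hD.graph_symm h1 hv'
      have e2 := hadj _ (hD.gaussOp_graph (n + 1) hv')
      simp only at e1 e2
      rw [e1, hD.gaussOp_symm, ← e2, ← hD.gaussOp_symm]
    rwa [h2] at h1
  refine hD.isClosed_graph.mem_of_tendsto
    ((hD.tendsto_gaussOp w).prodMk_nhds (hD.tendsto_gaussOp w'))
    (Filter.Eventually.of_forall fun n => ?_)
  exact (graph D).smul_mem ((√Real.pi)⁻¹ : ℂ) (hreg n)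

lemma nonneg_generator (hD : IsUnitaryGroup D) (ζ : (generator D).domain) :
    0 ≤ (inner ℂ (ζ : ℋ) (generator D ζ)).re :=
  hD.graph_nonneg (generator_mem_graph ζ)

end IsUnitaryGroup

end Gaussian

/-! ### Standard subspaces and their modular data -/

section Modular

open Complex Topology

variable {ℋ : Type*} [NormedAddCommGroup ℋ] [InnerProductSpace ℂ ℋ]

lemma mem_mulI {S : ClosedSubmodule ℝ ℋ} {v : ℋ} : v ∈ S.mulI ↔ I • v ∈ S := by
  rw [ClosedSubmodule.mem_mapEquiv_iff, scalarSMulCLE_symm_apply, Units.smul_def]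
  simp only [Units.val_inv_eq_inv_val, val_UnitI, inv_I, neg_smul]
  exact S.toSubmodule.neg_mem_iff

lemma conj_one_half : conj (1 / 2 : ℂ) = 1 / 2 := by
  rw [map_div₀, map_one, map_ofNat]

/-- Two continuous linear maps that agree on a standard subspace are equal. -/
lemma eq_of_eqOn_standard {E : Type*} [NormedAddCommGroup E] [NormedSpace ℂ E]
    (K : StandardSubspace ℋ) (L L' : ℋ →L[ℂ] E) (h : ∀ v ∈ K.toClosedSubmodule, L v = L' v) :
    L = L' := by
  let T : ClosedSubmodule ℝ ℋ :=
    { (LinearMap.eqLocus L.toLinearMap L'.toLinearMap).restrictScalars ℝ with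
      isClosed' := isClosed_eq L.continuous L'.continuous }
  have h1 : K.toClosedSubmodule ⊔ K.toClosedSubmodule.mulI ≤ T := by
    refine sup_le (fun v hv => h v hv) fun v hv => ?_
    have h2 := h _ (mem_mulI.1 hv)
    rw [map_smul, map_smul] at h2
    exact smul_right_injective _ I_ne_zero h2
  rw [K.IsCyclic] at h1
  exact ContinuousLinearMap.ext fun v => h1 (ClosedSubmodule.mem_top (x := v))

lemma eq_zero_of_mem_of_I_smul_mem (K : StandardSubspace ℋ) {v : ℋ} (hv : v ∈ K.toClosedSubmodule)
    (hv' : I • v ∈ K.toClosedSubmodule) : v = 0 := by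
  have h : v ∈ K.toClosedSubmodule ⊓ K.toClosedSubmodule.mulI := ⟨hv, mem_mulI.2 hv'⟩
  rwa [K.IsSeparating, ClosedSubmodule.mem_bot] at h

/-- The image of a standard subspace under a unitary operator. -/
def mapStandard (V : ℋ ≃ₗᵢ[ℝ] ℋ) (hV : ∀ (c : ℂ) (v : ℋ), V (c • v) = c • V v)
    (K : StandardSubspace ℋ) : StandardSubspace ℋ where
  toClosedSubmodule := K.toClosedSubmodule.mapEquiv V.toContinuousLinearEquiv
  IsSeparating := by
    refine le_antisymm (fun v hv => ?_) bot_le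
    obtain ⟨h1, h2⟩ := hv
    have h2' := mem_mulI.1 h2
    rw [ClosedSubmodule.mem_mapEquiv_iff] at h2'
    have h1' := (ClosedSubmodule.mem_mapEquiv_iff _ _ _).1 h1
    change V.symm v ∈ _ at h1'
    change V.symm (I • v) ∈ _ at h2'
    have h3 : V.symm (I • v) = I • V.symm v := by
      apply V.injective; rw [hV]; simp
    rw [h3] at h2'
    have := eq_zero_of_mem_of_I_smul_mem K h1' h2'
    simpa using this
  IsCyclic := by
    set T := K.toClosedSubmodule.mapEquiv V.toContinuousLinearEquiv with hT
    have hK (v : ℋ) (hv : v ∈ K.toClosedSubmodule) : V v ∈ T :=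
      (ClosedSubmodule.mem_mapEquiv_iff' V.toContinuousLinearEquiv _ _).2 hv
    have h1 : K.toClosedSubmodule ⊔ K.toClosedSubmodule.mulI ≤
        (T ⊔ T.mulI).comap (V.toContinuousLinearEquiv : ℋ →L[ℝ] ℋ) := by
      refine sup_le (fun v hv => ?_) fun v hv => ?_
      · exact (le_sup_left : T ≤ _) (hK v hv)
      · refine (le_sup_right : T.mulI ≤ _) (mem_mulI.2 ?_)
        change I • V v ∈ T
        rw [← hV]
        exact hK _ (mem_mulI.1 hv)
    rw [K.IsCyclic] at h1
    refine top_le_iff.1 fun v _ => ?_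
    have := h1 (ClosedSubmodule.mem_top (x := V.symm v))
    rw [ClosedSubmodule.mem_comap] at this
    change V (V.symm v) ∈ _ at this
    simpa using this

lemma isImage_mapStandard (V : ℋ ≃ₗᵢ[ℝ] ℋ) (hV : ∀ (c : ℂ) (v : ℋ), V (c • v) = c • V v)
    (K : StandardSubspace ℋ) : IsImage V K (mapStandard V hV K) := by
  change ((K.toClosedSubmodule.mapEquiv V.toContinuousLinearEquiv : ClosedSubmodule ℝ ℋ) : Set ℋ)
    = _
  ext v
  constructor
  · intro hv
    exact ⟨V.symm v, (ClosedSubmodule.mem_mapEquiv_iff _ _ _).1 hv, by simp⟩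
  · rintro ⟨w, hw, rfl⟩
    exact (ClosedSubmodule.mem_mapEquiv_iff' V.toContinuousLinearEquiv _ _).2 hw

/-- A conjugation is antiunitary. -/
lemma inner_conj_map {J : ℋ ≃ₗᵢ[ℝ] ℋ} (hJ : ∀ (c : ℂ) (v : ℋ), J (c • v) = conj c • J v)
    (v w : ℋ) : ⟪J v, J w⟫_ℂ = ⟪w, v⟫_ℂ := by
  have hre (v w : ℋ) : (⟪J v, J w⟫_ℂ).re = (⟪v, w⟫_ℂ).re := by
    have h1 := norm_add_sq (𝕜 := ℂ) v w
    have h2 := norm_add_sq (𝕜 := ℂ) (J v) (J w)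
    rw [← map_add, J.norm_map, J.norm_map, J.norm_map, h1] at h2
    simp only [RCLike.re_to_complex] at h2
    linarith
  have him := hre v (I • w)
  rw [hJ, inner_smul_right, inner_smul_right] at him
  rw [← inner_conj_symm w v]
  apply Complex.ext
  · rw [conj_re]; exact hre v w
  · rw [conj_im]; simpa using him

/-- An antilinear isometry as a continuous semilinear map. -/
def conjCLM (J : ℋ ≃ₗᵢ[ℝ] ℋ) (hJ : ∀ (c : ℂ) (v : ℋ), J (c • v) = conj c • J v) : ℋ →L⋆[ℂ] ℋ where
  toFun := J
  map_add' := J.map_add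
  map_smul' := hJ
  cont := J.continuous

open IsUnitaryGroup

/-- The conjugation `J` is antilinear, involutive, and commutes with the group `D`. -/
structure IsModularPair (J : ℋ ≃ₗᵢ[ℝ] ℋ) (D : ℝ → ℋ ≃ₗᵢ[ℂ] ℋ) : Prop where
  group : IsUnitaryGroup D
  antilinear : ∀ (c : ℂ) (v : ℋ), J (c • v) = conj c • J v
  involutive : ∀ v, J (J v) = v
  comm : ∀ (t : ℝ) (v : ℋ), J (D t v) = D t (J v)

namespace IsModularPair

variable [CompleteSpace ℋ] {J : ℋ ≃ₗᵢ[ℝ] ℋ} {D : ℝ → ℋ ≃ₗᵢ[ℂ] ℋ}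

/-- The analytic generator `A` satisfies `J A J = A⁻¹`. -/
lemma graph_swap (h : IsModularPair J D) {v w : ℋ} (hvw : (v, w) ∈ graph D) :
    (J w, J v) ∈ graph D := by
  obtain ⟨F, hF, hF'⟩ := hvw
  refine ⟨fun z => J (F (conj z - I / 2)), ⟨hF.1.conj_comp (conjCLM J h.antilinear), fun t => ?_⟩,
    ?_⟩
  · have h1 : conj (t : ℂ) - I / 2 = -(I / 2) + t := by rw [conj_ofReal]; ring
    simp only [h1]
    rw [h.group.continues_add hF t half_mem_strip, hF', h.comm]
  · simp only [conj_half]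
    rw [h.group.continues_zero hF]

/-- The fixed points of `J A`, where `A` is the analytic generator of `D`. -/
def fixedSubspace (h : IsModularPair J D) : StandardSubspace ℋ where
  toClosedSubmodule :=
    { carrier := {v | (v, J v) ∈ graph D}
      add_mem' := fun {v w} hv hw => by
        simp only [Set.mem_ofPred_eq, map_add] at hv hw ⊢
        exact add_mem hv hw
      zero_mem' := by
        simp only [Set.mem_ofPred_eq, map_zero]
        exact zero_mem _
      smul_mem' := fun r v hv => by
        simp only [Set.mem_ofPred_eq, map_smul] at hv ⊢
        exact (graph D).smul_mem (r : ℂ) hv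
      isClosed' := h.group.isClosed_graph.preimage (continuous_id.prodMk J.continuous) }
  IsSeparating := by
    refine le_antisymm (fun v hv => ?_) bot_le
    have h1 : (v, J v) ∈ graph D := hv.1
    have h2 : (I • v, J (I • v)) ∈ graph D := mem_mulI.1 hv.2
    have h3 := sub_mem ((graph D).smul_mem I h1) h2
    have h4 := graph_fst_zero h3 (by simp)
    -- antilinearity gives `J(iv) = -iJv`, so that `2iJv` lies over `0`
    rw [h.antilinear] at h4
    have h5 : (2 * I) • J v = 0 := by
      rw [← h4]
      simp [two_mul, add_smul]
    have h6 : J v = 0 := (smul_eq_zero.1 h5).resolve_left (by simp)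
    exact (map_eq_zero_iff J J.injective).1 h6
  IsCyclic := by
    refine top_le_iff.1 fun v _ => ?_
    refine closure_minimal (s := ((generator D).domain : Set ℋ)) (fun u hu => ?_)
      (ClosedSubmodule.isClosed _) (h.group.dense_domain v)
    have h1 := generator_mem_graph (D := D) ⟨u, hu⟩
    set w := generator D ⟨u, hu⟩
    simp only at h1
    have h2 := h.graph_swap h1
    -- `u = ξ + iη` with the fixed points `ξ = (u + JAu)/2` and `η = (u - JAu)/(2i)` of `J A`
    have hξ : ((1 / 2 : ℂ) • (u + J w), J ((1 / 2 : ℂ) • (u + J w))) ∈ graph D := by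
      convert (graph D).smul_mem (1 / 2 : ℂ) (add_mem h1 h2) using 1
      rw [h.antilinear, map_add, h.involutive, conj_one_half]
      simp [add_comm]
    have hη : (I • ((1 / 2 : ℂ) • (u - J w)), J (I • ((1 / 2 : ℂ) • (u - J w)))) ∈ graph D := by
      convert (graph D).smul_mem I ((graph D).smul_mem (1 / 2 : ℂ) (sub_mem h1 h2)) using 1
      rw [h.antilinear, h.antilinear, map_sub, h.involutive]
      simp only [Prod.mk_sub_mk, Prod.smul_mk, Prod.mk.injEq, true_and]
      rw [conj_I, conj_one_half]
      module
    have hu' : u = (1 / 2 : ℂ) • (u + J w) + (1 / 2 : ℂ) • (u - J w) := by module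
    rw [hu']
    refine add_mem (SetLike.le_def.1 le_sup_left hξ) (SetLike.le_def.1 le_sup_right ?_)
    exact mem_mulI.2 hη

lemma mem_fixedSubspace (h : IsModularPair J D) {v : ℋ} :
    v ∈ h.fixedSubspace.toClosedSubmodule ↔ (v, J v) ∈ graph D := Iff.rfl

/-- `J` and `D` are the modular data of the fixed points of `J A`. -/
lemma isModularData (h : IsModularPair J D) : IsModularData h.fixedSubspace J D := by
  refine ⟨generator D, ⟨h.antilinear, h.involutive, h.group.isSelfAdjoint_generator,
    h.group.nonneg_generator, fun p q => ?_⟩, h.group.isImaginaryPowers⟩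
  have hgen : (∃ ζ : (generator D).domain, (ζ : ℋ) = p ∧ J (generator D ζ) = q) ↔
      (p, J q) ∈ graph D := by
    rw [mem_graph, ← generator_iff]
    refine exists_congr fun ζ => and_congr_right fun _ => ⟨fun hq => ?_, fun hq => ?_⟩
    · rw [← hq, h.involutive]
    · rw [hq, h.involutive]
  rw [hgen]
  constructor
  · rintro ⟨ξ, hξ, η, hη, hp, hq⟩
    simp only at hp hq
    convert add_mem (h.mem_fixedSubspace.1 hξ) ((graph D).smul_mem I (h.mem_fixedSubspace.1 hη))
      using 1
    rw [hp, hq, map_sub, h.antilinear]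
    simp
  · intro h1
    have h2 := h.graph_swap h1
    rw [h.involutive] at h2
    refine ⟨(1 / 2 : ℂ) • (p + q), ?_, -(I • ((1 / 2 : ℂ) • (p - q))), ?_, ?_, ?_⟩
    · rw [h.mem_fixedSubspace]
      convert (graph D).smul_mem (1 / 2 : ℂ) (add_mem h1 h2) using 1
      rw [h.antilinear, map_add, conj_one_half]
      simp [add_comm]
    · rw [h.mem_fixedSubspace]
      convert neg_mem ((graph D).smul_mem I ((graph D).smul_mem (1 / 2 : ℂ) (sub_mem h1 h2))) using 1
      rw [map_neg, h.antilinear, h.antilinear, map_sub]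
      simp only [Prod.mk_sub_mk, Prod.smul_mk, Prod.neg_mk, Prod.mk.injEq, true_and]
      rw [conj_I, conj_one_half]
      module
    · simp only [smul_neg, smul_smul I I, I_mul_I]
      module
    · simp only [smul_neg, smul_smul I I, I_mul_I]
      module

end IsModularPair

/-- A standard subspace is determined by its modular data: it is the set of fixed points of its
Tomita operator `J A`, and `A` is the analytic generator of `D`. -/
lemma IsModularData.mem_iff {K : StandardSubspace ℋ} {J : ℋ ≃ₗᵢ[ℝ] ℋ} {D : ℝ → ℋ ≃ₗᵢ[ℂ] ℋ}
    [CompleteSpace ℋ] (h : IsModularData K J D) {v : ℋ} :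
    v ∈ K.toClosedSubmodule ↔ (v, J v) ∈ graph D := by
  obtain ⟨A, hJ, hA⟩ := h
  have h1 : (∃ ζ : A.domain, (ζ : ℋ) = v ∧ J (A ζ) = v) ↔ (v, J v) ∈ graph D := by
    rw [mem_graph]
    simp only [Continues, StripHolo, and_assoc]
    rw [← hA.continuation]
    refine exists_congr fun ζ => and_congr_right fun _ => ⟨fun hq => ?_, fun hq => ?_⟩
    · rw [← hJ.involutive (A ζ), hq]
    · rw [hq, hJ.involutive]
  rw [← h1, ← hJ.polar]
  constructor
  · intro hv
    exact ⟨v, hv, 0, zero_mem _, by simp, by simp⟩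
  · rintro ⟨ξ, hξ, η, hη, hp, hq⟩
    simp only at hp hq
    have h2 : (2 * I) • η = 0 := by
      have := hp.symm.trans hq
      linear_combination (norm := module) this
    have h3 : η = 0 := (smul_eq_zero.1 h2).resolve_left (by simp)
    rw [hp, h3, smul_zero, add_zero]
    exact hξ

variable [CompleteSpace ℋ] {J : ℋ ≃ₗᵢ[ℝ] ℋ} {D : ℝ → ℋ ≃ₗᵢ[ℂ] ℋ} {K : StandardSubspace ℋ}

lemma IsModularData.eq {K' : StandardSubspace ℋ} (h : IsModularData K J D)
    (h' : IsModularData K' J D) : K = K' := by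
  rw [← StandardSubspace.toClosedSubmodule_inj]
  exact SetLike.ext fun v => h.mem_iff.trans h'.mem_iff.symm

/-- The modular group preserves the standard subspace. -/
lemma IsModularPair.apply_mem (hp : IsModularPair J D) (h : IsModularData K J D) (t : ℝ) {v : ℋ}
    (hv : v ∈ K.toClosedSubmodule) : D t v ∈ K.toClosedSubmodule := by
  rw [h.mem_iff] at hv ⊢
  obtain ⟨F, hF, hF'⟩ := hv
  refine ⟨fun z => F (z + t), ⟨hF.1.translate t, fun s => ?_⟩, ?_⟩
  · simp only
    rw [← ofReal_add, hF.2, hp.group.add]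
  · simp only
    rw [hp.group.continues_add hF t half_mem_strip, hF', hp.comm]

/-- Unitaries that commute with `J` and `D` preserve the standard subspace. -/
lemma IsModularData.map_mem (h : IsModularData K J D) {V : ℋ ≃ₗᵢ[ℝ] ℋ}
    (hV : ∀ (c : ℂ) (v : ℋ), V (c • v) = c • V v) (hJ : ∀ v, V (J v) = J (V v))
    (hD : ∀ t v, V (D t v) = D t (V v)) {v : ℋ} (hv : v ∈ K.toClosedSubmodule) :
    V v ∈ K.toClosedSubmodule := by
  rw [h.mem_iff] at hv ⊢
  obtain ⟨F, hF, hF'⟩ := hv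
  let L : ℋ →L[ℂ] ℋ :=
    { toFun := V, map_add' := V.map_add, map_smul' := hV, cont := V.continuous }
  refine ⟨fun z => V (F z), ⟨hF.1.clm L, fun s => ?_⟩, ?_⟩
  · simp only [hF.2, hD]
  · simp only [hF', hJ]

lemma IsModularPair.im_inner_eq_zero (hp : IsModularPair J D) (h : IsModularData K J D) {ξ η : ℋ}
    (hξ : ξ ∈ K.toClosedSubmodule) (hη : η ∈ K.toClosedSubmodule) : (⟪J ξ, η⟫_ℂ).im = 0 := by
  have h1 := hp.group.graph_symm (h.mem_iff.1 hξ) (h.mem_iff.1 hη)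
  simp only at h1
  have h2 := inner_conj_map hp.antilinear (J ξ) η
  rw [hp.involutive, ← h1, ← inner_conj_symm η] at h2
  exact conj_eq_iff_im.1 h2.symm

/-- A unitary operator that preserves a standard subspace commutes with its modular group. For
`ξ, η` in the subspace, the pairing of the continued orbit of `ξ` under `D` with the one of
`η` under `V D V⁻¹` is bounded and real on both boundary lines of the strip, hence constant. -/
theorem IsModularPair.comm_of_image_eq (hp : IsModularPair J D) (h : IsModularData K J D)
    {V : ℋ ≃ₗᵢ[ℝ] ℋ} (hV : ∀ (c : ℂ) (v : ℋ), V (c • v) = c • V v)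
    (hVK : V '' (K.toClosedSubmodule : Set ℋ) = (K.toClosedSubmodule : Set ℋ)) (t : ℝ) (v : ℋ) :
    V (D t v) = D t (V v) := by
  have hVm {v : ℋ} (hv : v ∈ K.toClosedSubmodule) : V v ∈ K.toClosedSubmodule := by
    have : V v ∈ V '' (K.toClosedSubmodule : Set ℋ) := ⟨v, hv, rfl⟩
    rwa [hVK] at this
  have hVm' {v : ℋ} (hv : v ∈ K.toClosedSubmodule) : V.symm v ∈ K.toClosedSubmodule := by
    have : v ∈ V '' (K.toClosedSubmodule : Set ℋ) := by rwa [hVK]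
    obtain ⟨w, hw, rfl⟩ := this
    simpa using hw
  let L : ℋ →L[ℂ] ℋ :=
    { toFun := V, map_add' := V.map_add, map_smul' := hV, cont := V.continuous }
  have hVin (a b : ℋ) : ⟪a, V b⟫_ℂ = ⟪V.symm a, b⟫_ℂ := by
    let V' : ℋ ≃ₗᵢ[ℂ] ℋ :=
      { V with map_smul' := hV }
    have h1 := V'.inner_map_map (V.symm a) b
    rw [← h1]
    change _ = ⟪V (V.symm a), V b⟫_ℂ
    simp
  -- the commutation relation on vectors of `K`, tested against `J ξ`
  have key (ξ : ℋ) (hξ : ξ ∈ K.toClosedSubmodule) (η : ℋ) (hη : η ∈ K.toClosedSubmodule) (t : ℝ) :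
      ⟪D t (J ξ), V (D t η)⟫_ℂ = ⟪D t (J ξ), D t (V η)⟫_ℂ := by
    obtain ⟨F, hF, hF'⟩ := h.mem_iff.1 hξ
    obtain ⟨G, hG, hG'⟩ := h.mem_iff.1 hη
    have hG2 : StripHolo fun z => V (G z) := hG.1.clm L
    have hzre (z : ℂ) (hz : z.im = 0) : z = (z.re : ℂ) := by
      apply Complex.ext <;> simp [hz]
    have hzre' (z : ℂ) (hz : z.im = -(1 / 2)) : z = -(I / 2) + (z.re : ℂ) := by
      apply Complex.ext <;> simp [hz]
    have hval (t : ℝ) : ⟪F (conj (t : ℂ) - I / 2), V (G t)⟫_ℂ = ⟪D t (J ξ), V (D t η)⟫_ℂ := by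
      have h1 : conj (t : ℂ) - I / 2 = -(I / 2) + t := by rw [conj_ofReal]; ring
      rw [h1, hp.group.continues_add hF t half_mem_strip, hF', hG.2]
    have hconst := (hF.1.pairing hG2).eq_of_real_boundary
      (B := max ‖ξ‖ ‖J ξ‖ * max ‖η‖ ‖J η‖) (fun z hz => ?_) (fun z hz => ?_) (fun z hz => ?_)
      (z := t) (w := 0) (by simp [strip]) zero_mem_strip
    · have h0 := hval 0
      rw [hp.group.zero_apply, hp.group.zero_apply, ofReal_zero] at h0
      rw [(D t).inner_map_map, ← h0, ← hval]
      exact hconst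
    · refine (norm_inner_le_norm _ _).trans ?_
      gcongr
      · exact hp.group.norm_continues_le hF (le_max_left _ _) (by rw [hF']; exact le_max_right _ _)
          (StripHolo.conj_sub_mem hz)
      · rw [V.norm_map]
        exact hp.group.norm_continues_le hG (le_max_left _ _) (by rw [hG']; exact le_max_right _ _) hz
    · rw [hzre z hz, hval, ← hp.comm]
      exact hp.im_inner_eq_zero h (hp.apply_mem h _ hξ) (hVm (hp.apply_mem h _ hη))
    · have h1 : conj z - I / 2 = (z.re : ℂ) := by
        apply Complex.ext <;> simp [hz]
      rw [h1, hF.2, hzre' z hz, hp.group.continues_add hG _ half_mem_strip, hG', hVin, ← hp.comm]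
      have h2 := hp.im_inner_eq_zero h (hp.apply_mem h z.re hη) (hVm' (hp.apply_mem h z.re hξ))
      rw [← inner_conj_symm, conj_im]
      simpa using h2
  let M : ℝ → ℋ →L[ℂ] ℋ := fun t => ((D t).toContinuousLinearEquiv : ℋ →L[ℂ] ℋ)
  have hK (η : ℋ) (hη : η ∈ K.toClosedSubmodule) : V (D t η) = D t (V η) := by
    set u := V (D t η) - D t (V η) with hu
    have h1 : innerSL ℂ (J u) = 0 := eq_of_eqOn_standard K _ _ fun ξ hξ => by
      have h2 := key _ (hp.apply_mem h (-t) hξ) η hη t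
      have h3 : D t (J (D (-t) ξ)) = J ξ := by
        rw [← hp.comm, ← hp.group.add, add_neg_cancel, hp.group.zero_apply]
      rw [h3, ← sub_eq_zero, ← inner_sub_right, ← hu, ← inner_conj_map hp.antilinear,
        hp.involutive] at h2
      exact h2
    have h4 : ⟪J u, J u⟫_ℂ = 0 := congrArg (fun L : ℋ →L[ℂ] ℂ => L (J u)) h1
    rw [inner_self_eq_zero, map_eq_zero_iff J J.injective] at h4
    exact sub_eq_zero.1 h4
  exact congrArg (fun L : ℋ →L[ℂ] ℋ => L v) (eq_of_eqOn_standard K (L ∘L M t) (M t ∘L L) hK)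

end Modular

/-! ### The graded group -/

section GradedGroup

open Topology

variable {𝔤 : Type*} [LieRing 𝔤] [LieAlgebra ℝ 𝔤] [FiniteDimensional ℝ 𝔤] {σ : 𝔤 ≃ₗ[ℝ] 𝔤} {x : 𝔤}

namespace GradedGroup

lemma ad_lie (hx : IsEulerElement x) (hσ : IsEulerReflection x σ) (g : GradedGroup σ) (y z : 𝔤) :
    Ad g ⁅y, z⁆ = ⁅Ad g y, Ad g z⁆ := by
  obtain ⟨g, hg⟩ := g
  change g.1 ⁅y, z⁆ = ⁅g.1 y, g.1 z⁆
  induction hg using Subgroup.closure_induction generalizing y z with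
  | mem g h =>
    obtain h | rfl := h
    · exact inn_lie h.1 y z
    · exact hσ.map_lie hx y z
  | one => rfl
  | mul g g' _ _ h h' =>
    change g.1 (g'.1 _) = ⁅g.1 (g'.1 _), g.1 (g'.1 _)⁆
    rw [h', h]
  | inv g _ h =>
    change g.1.symm _ = ⁅g.1.symm _, g.1.symm _⁆
    apply g.1.injective
    rw [h]
    simp

lemma ext {g g' : GradedGroup σ} (h : Ad g = Ad g') (h' : grading g = grading g') : g = g' :=
  Subtype.ext (Prod.ext h h')

lemma grading_mul (g g' : GradedGroup σ) : grading (g * g') = grading g * grading g' := rfl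

lemma grading_inv (g : GradedGroup σ) : grading g⁻¹ = (grading g)⁻¹ := rfl

lemma ad_mul (g g' : GradedGroup σ) : Ad (g * g') = Ad g * Ad g' := rfl

lemma grading_ofInn {φ : 𝔤 ≃ₗ[ℝ] 𝔤} (hφ : φ ∈ Inn 𝔤) : grading (ofInn σ φ hφ) = 1 := rfl

lemma ad_ofInn {φ : 𝔤 ≃ₗ[ℝ] 𝔤} (hφ : φ ∈ Inn 𝔤) : Ad (ofInn σ φ hφ) = φ := rfl

lemma grading_exp (y : 𝔤) : grading (exp σ y) = 1 := rfl

lemma ad_exp (y : 𝔤) : Ad (exp σ y) = expAd y := rfl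

lemma ofInn_mul {φ ψ : 𝔤 ≃ₗ[ℝ] 𝔤} (hφ : φ ∈ Inn 𝔤) (hψ : ψ ∈ Inn 𝔤) :
    ofInn σ (φ * ψ) (mul_mem hφ hψ) = ofInn σ φ hφ * ofInn σ ψ hψ := ext rfl (by
  rw [grading_mul, grading_ofInn, grading_ofInn, grading_ofInn, one_mul])

lemma ofInn_inv {φ : 𝔤 ≃ₗ[ℝ] 𝔤} (hφ : φ ∈ Inn 𝔤) :
    ofInn σ φ⁻¹ (inv_mem hφ) = (ofInn σ φ hφ)⁻¹ := ext rfl (by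
  rw [grading_inv, grading_ofInn, grading_ofInn, inv_one])

lemma ofInn_one : ofInn σ 1 (one_mem _) = 1 := ext rfl rfl

lemma exp_add_smul (y : 𝔤) (s t : ℝ) :
    exp σ ((s + t) • y) = exp σ (s • y) * exp σ (t • y) := by
  refine ext ?_ ?_
  · rw [ad_mul, ad_exp, ad_exp, ad_exp, expAd_add_smul]
  · rw [grading_mul, grading_exp, grading_exp, grading_exp, one_mul]

/-- Conjugation of one-parameter groups is given by the adjoint action. -/
lemma mul_exp (hx : IsEulerElement x) (hσ : IsEulerReflection x σ) (g : GradedGroup σ) (y : 𝔤) :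
    g * exp σ y = exp σ (Ad g y) * g := by
  refine ext ?_ ?_
  · rw [ad_mul, ad_mul, ad_exp, ad_exp, ← conj_expAd (ad_lie hx hσ g), inv_mul_cancel_right]
  · rw [grading_mul, grading_mul, grading_exp, grading_exp, mul_comm]

lemma tendsto_nhds_of_coeff {ι : Type*} {l : Filter ι} {u : ι → GradedGroup σ} {g : GradedGroup σ}
    (h1 : ∀ i, grading (u i) = grading g)
    (h2 : ∀ (ξ : Module.Dual ℝ 𝔤) (y : 𝔤), Filter.Tendsto (fun i => ξ (Ad (u i) y)) l
      (𝓝 (ξ (Ad g y)))) : Filter.Tendsto u l (@nhds _ (topology σ) g) := by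
  rw [nhds_inf, Filter.tendsto_inf]
  constructor
  · rw [@nhds_induced _ _ ⊥, Filter.tendsto_comap_iff]
    have : grading ∘ u = fun _ => grading g := funext h1
    rw [this]
    exact Filter.tendsto_const_pure.mono_right (@pure_le_nhds _ ⊥ _)
  · simp only [nhds_iInf, nhds_induced, Filter.tendsto_iInf, Filter.tendsto_comap_iff]
    exact h2

lemma continuous_exp_smul (y : 𝔤) :
    @Continuous _ _ _ (topology σ) fun t : ℝ => exp σ (t • y) := by
  let := topology σ
  refine continuous_iff_continuousAt.2 fun t => tendsto_nhds_of_coeff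
    (fun _ => by rw [grading_exp, grading_exp]) fun ξ z => ?_
  simp only [ad_exp]
  exact (hasDerivAt_expAd y z ξ t).continuousAt

/-- Even elements are inner. -/
lemma ad_mem_inn (hx : IsEulerElement x) (hσ : IsEulerReflection x σ) {g : GradedGroup σ}
    (hg : grading g = 1) : Ad g ∈ Inn 𝔤 := by
  have hσσ : σ * σ = 1 := by
    ext y
    obtain ⟨a, b, c, ha, hb, hc, rfl⟩ := hx.decomp y
    change σ (σ (a + b + c)) = a + b + c
    simp [(hσ a).2.2 ha, (hσ b).1 hb, (hσ c).2.1 hc]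
  have hconj (φ : 𝔤 ≃ₗ[ℝ] 𝔤) (hφ : φ ∈ Inn 𝔤) : σ * φ * σ ∈ Inn 𝔤 := by
    have hinv : σ⁻¹ = σ := inv_eq_of_mul_eq_one_left hσσ
    induction hφ using Subgroup.closure_induction with
    | mem φ h =>
      obtain ⟨y, -, rfl⟩ := h
      have := conj_expAd (hσ.map_lie hx) y
      rw [hinv] at this
      rw [this]
      exact expAd_mem_inn _
    | one => rw [mul_one, hσσ]; exact one_mem _
    | mul φ ψ _ _ h h' =>
      have h1 : σ * (φ * ψ) * σ = (σ * φ * σ) * (σ * ψ * σ) := by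
        rw [show σ * φ * σ * (σ * ψ * σ) = σ * φ * (σ * σ) * ψ * σ by simp only [mul_assoc], hσσ]
        simp only [mul_assoc, one_mul]
      rw [h1]; exact mul_mem h h'
    | inv φ _ h =>
      have h1 : σ * φ⁻¹ * σ = (σ * φ * σ)⁻¹ := by
        simp only [mul_inv_rev, hinv, mul_assoc]
      rw [h1]; exact inv_mem h
  obtain ⟨g, hg'⟩ := g
  have key : (g.2 = 1 ∧ g.1 ∈ Inn 𝔤) ∨ (g.2 = -1 ∧ g.1 * σ ∈ Inn 𝔤) := by
    clear hg
    induction hg' using Subgroup.closure_induction with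
    | mem g h =>
      obtain h | rfl := h
      · exact Or.inl ⟨h.2, h.1⟩
      · exact Or.inr ⟨rfl, by change σ * σ ∈ _; rw [hσσ]; exact one_mem _⟩
    | one => exact Or.inl ⟨rfl, one_mem _⟩
    | mul g g' _ _ h h' =>
      have hodd : g.1 * g'.1 * σ = g.1 * σ * (σ * g'.1 * σ) := by
        rw [show g.1 * σ * (σ * g'.1 * σ) = g.1 * (σ * σ) * g'.1 * σ by simp only [mul_assoc], hσσ,
          mul_one]
      obtain ⟨h1, h2⟩ | ⟨h1, h2⟩ := h <;> obtain ⟨h1', h2'⟩ | ⟨h1', h2'⟩ := h'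
      · exact Or.inl ⟨by simp [h1, h1'], mul_mem h2 h2'⟩
      · refine Or.inr ⟨by simp [h1, h1'], ?_⟩
        rw [Prod.fst_mul, mul_assoc]; exact mul_mem h2 h2'
      · refine Or.inr ⟨by simp [h1, h1'], ?_⟩
        rw [Prod.fst_mul, hodd]
        exact mul_mem h2 (hconj _ h2')
      · refine Or.inl ⟨by simp [h1, h1'], ?_⟩
        have : g.1 * g'.1 = g.1 * σ * (σ * (g'.1 * σ) * σ) := by
          rw [show g.1 * σ * (σ * (g'.1 * σ) * σ) = g.1 * (σ * σ) * g'.1 * (σ * σ) by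
            simp only [mul_assoc], hσσ, mul_one, mul_one]
        rw [Prod.fst_mul, this]
        exact mul_mem h2 (hconj _ h2')
    | inv g _ h =>
      obtain ⟨h1, h2⟩ | ⟨h1, h2⟩ := h
      · exact Or.inl ⟨by simp [h1], inv_mem h2⟩
      · refine Or.inr ⟨by simp [h1], ?_⟩
        have h3 := hconj _ (inv_mem h2)
        have : σ * (g.1 * σ)⁻¹ * σ = g.1⁻¹ * σ := by
          rw [mul_inv_rev, mul_inv_cancel_left]
        rwa [this] at h3
  obtain h | h := key
  · exact h.2
  · have h1 : g.2 = 1 := hg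
    exact absurd (h1.symm.trans h.1) (by decide)

end GradedGroup

/-! ### The Brunetti-Guido-Longo net -/

variable {ℋ : Type*} [NormedAddCommGroup ℋ] [InnerProductSpace ℂ ℋ]

open GradedGroup

/-- The unitary one-parameter group `t ↦ U(exp(-2πt y))`. -/
def AntiunitaryRep.group (U : AntiunitaryRep σ ℋ) (y : 𝔤) (t : ℝ) : ℋ ≃ₗᵢ[ℂ] ℋ :=
  { U.toHom (GradedGroup.exp σ ((-(2 * Real.pi) * t) • y)) with
    map_smul' := U.unitary _ rfl }

lemma AntiunitaryRep.group_apply (U : AntiunitaryRep σ ℋ) (y : 𝔤) (t : ℝ) (v : ℋ) :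
    U.group y t v = U.toHom (GradedGroup.exp σ ((-(2 * Real.pi) * t) • y)) v := rfl

lemma AntiunitaryRep.toHom_mul (U : AntiunitaryRep σ ℋ) (g g' : GradedGroup σ) (v : ℋ) :
    U.toHom (g * g') v = U.toHom g (U.toHom g' v) := by rw [map_mul]; rfl

lemma AntiunitaryRep.isUnitaryGroup (U : AntiunitaryRep σ ℋ) (y : 𝔤) :
    IsUnitaryGroup (U.group y) where
  add s t v := by
    rw [group_apply, mul_add, exp_add_smul, U.toHom_mul]
    rfl
  continuous v := by
    let := topology σ
    exact (U.continuous v).comp ((continuous_exp_smul y).comp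
      (by fun_prop : Continuous fun t : ℝ => -(2 * Real.pi) * t))

/-- Every wedge defines a pair that is the modular data of a standard subspace. -/
lemma AntiunitaryRep.isModularPair (hx : IsEulerElement x) (hσ : IsEulerReflection x σ)
    (U : AntiunitaryRep σ ℋ) (W : Wedge σ) : IsModularPair (U.toHom W.s) (U.group W.x) where
  group := U.isUnitaryGroup W.x
  antilinear := U.antiunitary _ W.odd
  involutive v := by
    rw [← U.toHom_mul, W.sq, map_one]; rfl
  comm t v := by
    rw [group_apply, group_apply, ← U.toHom_mul, mul_exp hx hσ, U.toHom_mul, map_smul, W.fix]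

lemma IsBGLNet.isModularData [CompleteSpace ℋ] {U : AntiunitaryRep σ ℋ}
    {N : Wedge σ → StandardSubspace ℋ} (h : IsBGLNet U N) (W : Wedge σ) :
    IsModularData (N W) (U.toHom W.s) (U.group W.x) := by
  obtain ⟨D, hD, hD'⟩ := h W
  have : D = U.group W.x := by
    funext t
    ext v
    rw [AntiunitaryRep.group_apply, ← hD']
    congr 2
    have := Real.pi_ne_zero
    field_simp
  rwa [← this]

lemma existsUnique_isBGLNet [CompleteSpace ℋ] (hx : IsEulerElement x) (hσ : IsEulerReflection x σ)
    (U : AntiunitaryRep σ ℋ) : ∃! N : Wedge σ → StandardSubspace ℋ, IsBGLNet U N := by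
  refine ⟨fun W => (U.isModularPair hx hσ W).fixedSubspace, fun W =>
    ⟨U.group W.x, (U.isModularPair hx hσ W).isModularData, fun t v => ?_⟩, fun N hN => ?_⟩
  · rw [AntiunitaryRep.group_apply]
    congr 4
    have := Real.pi_ne_zero
    field_simp
  · exact funext fun W => (hN.isModularData W).eq (U.isModularPair hx hσ W).isModularData

end GradedGroup

/-! ### Kernels of representations -/

section Kernel

open Topology Filter

lemma norm_pow_sub_pow_le {𝒜 : Type*} [NormedRing 𝒜] [NormOneClass 𝒜] {X Y : 𝒜} {M : ℝ}
    (hX : ‖X‖ ≤ M) (hY : ‖Y‖ ≤ M) (hM : 1 ≤ M) (n : ℕ) :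
    ‖X ^ n - Y ^ n‖ ≤ n * M ^ n * ‖X - Y‖ := by
  induction n with
  | zero => simp
  | succ n ih =>
    have hM0 : 0 ≤ M := zero_le_one.trans hM
    have h1 : X ^ (n + 1) - Y ^ (n + 1) = X ^ n * (X - Y) + (X ^ n - Y ^ n) * Y := by
      rw [pow_succ, pow_succ]; noncomm_ring
    have h2 : ‖X ^ n‖ ≤ M ^ n := (norm_pow_le X n).trans (by gcongr)
    have h3 : M ^ n ≤ M ^ (n + 1) := pow_le_pow_right₀ hM n.le_succ
    calc ‖X ^ (n + 1) - Y ^ (n + 1)‖ ≤ ‖X ^ n‖ * ‖X - Y‖ + ‖X ^ n - Y ^ n‖ * ‖Y‖ := by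
          rw [h1]
          exact (norm_add_le _ _).trans (add_le_add (norm_mul_le _ _) (norm_mul_le _ _))
      _ ≤ M ^ (n + 1) * ‖X - Y‖ + (n * M ^ n * ‖X - Y‖) * M := by gcongr; exact h2.trans h3
      _ = (n + 1 : ℕ) * M ^ (n + 1) * ‖X - Y‖ := by push_cast; ring

/-- If a curve in a Banach algebra starts at `1` with velocity `A`, then `c(1/n)ⁿ → e^A`. -/
lemma tendsto_pow_of_hasDerivAt {𝒜 : Type*} [NormedRing 𝒜] [NormOneClass 𝒜] [NormedAlgebra ℝ 𝒜]
    [CompleteSpace 𝒜] {c : ℝ → 𝒜} {A : 𝒜} (h0 : c 0 = 1) (hc : HasDerivAt c A 0) :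
    Tendsto (fun n : ℕ => c (1 / ((n : ℝ) + 1)) ^ (n + 1)) atTop (𝓝 (NormedSpace.exp A)) := by
  have hτ : Tendsto (fun n : ℕ => 1 / ((n : ℝ) + 1)) atTop (𝓝[≠] 0) :=
    tendsto_nhdsWithin_iff.2 ⟨tendsto_one_div_add_atTop_nhds_zero_nat,
      Eventually.of_forall fun n => by
        have : (0 : ℝ) < 1 / ((n : ℝ) + 1) := by positivity
        exact this.ne'⟩
  have hlim {d : ℝ → 𝒜} (hd0 : d 0 = 1) (hd : HasDerivAt d A 0) :
      Tendsto (fun n : ℕ => ((n : ℝ) + 1) • (d (1 / ((n : ℝ) + 1)) - 1)) atTop (𝓝 A) := by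
    have := hd.tendsto_slope_zero.comp hτ
    refine this.congr fun n => ?_
    simp [hd0]
  have he : HasDerivAt (fun t : ℝ => NormedSpace.exp (t • A)) A 0 := by
    have := hasDerivAt_exp_smul_const' A (0 : ℝ) (𝕂 := ℝ)
    simpa using this
  have e1 := hlim h0 hc
  have e2 := hlim (d := fun t : ℝ => NormedSpace.exp (t • A)) (by simp) he
  have hdiff : Tendsto (fun n : ℕ => ((n : ℝ) + 1) * ‖c (1 / ((n : ℝ) + 1)) -
      NormedSpace.exp ((1 / ((n : ℝ) + 1)) • A)‖) atTop (𝓝 0) := by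
    have := (e1.sub e2).norm
    rw [sub_self, norm_zero] at this
    refine this.congr fun n => ?_
    rw [← smul_sub, norm_smul, Real.norm_of_nonneg (by positivity), sub_sub_sub_cancel_right]
  have hK : ‖A‖ < ‖A‖ + 1 := by linarith
  have hbound {d : ℝ → 𝒜} (e : Tendsto (fun n : ℕ => ((n : ℝ) + 1) • (d (1 / ((n : ℝ) + 1)) - 1))
      atTop (𝓝 A)) : ∀ᶠ n : ℕ in atTop, ‖d (1 / ((n : ℝ) + 1))‖ ≤
        Real.exp ((‖A‖ + 1) / ((n : ℝ) + 1)) := by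
    filter_upwards [e.norm.eventually_lt_const hK] with n hn
    have hn0 : (0 : ℝ) < (n : ℝ) + 1 := by positivity
    rw [norm_smul, Real.norm_of_nonneg hn0.le] at hn
    have h1 : ‖d (1 / ((n : ℝ) + 1)) - 1‖ ≤ (‖A‖ + 1) / ((n : ℝ) + 1) := by
      rw [le_div_iff₀ hn0, mul_comm]; exact hn.le
    have h2 := norm_le_norm_add_norm_sub' (d (1 / ((n : ℝ) + 1))) 1
    rw [norm_one] at h2
    have h3 := Real.add_one_le_exp ((‖A‖ + 1) / ((n : ℝ) + 1))
    linarith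
  have hexp (n : ℕ) : NormedSpace.exp ((1 / ((n : ℝ) + 1)) • A) ^ (n + 1) = NormedSpace.exp A := by
    let := NormedAlgebra.restrictScalars ℚ ℝ 𝒜
    rw [← NormedSpace.exp_nsmul, ← Nat.cast_smul_eq_nsmul ℝ, smul_smul]
    push_cast
    rw [mul_one_div_cancel (by positivity), one_smul]
  rw [tendsto_iff_norm_sub_tendsto_zero]
  have hz : Tendsto (fun n : ℕ => Real.exp (‖A‖ + 1) * (((n : ℝ) + 1) * ‖c (1 / ((n : ℝ) + 1)) -
      NormedSpace.exp ((1 / ((n : ℝ) + 1)) • A)‖)) atTop (𝓝 0) := by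
    simpa using hdiff.const_mul (Real.exp (‖A‖ + 1))
  refine squeeze_zero' (Eventually.of_forall fun n => norm_nonneg _) ?_ hz
  filter_upwards [hbound e1, hbound (d := fun t : ℝ => NormedSpace.exp (t • A)) e2] with n h1 h2
  have h3 := norm_pow_sub_pow_le h1 h2 (Real.one_le_exp (by positivity)) (n + 1)
  rw [hexp, ← Real.exp_nat_mul] at h3
  refine h3.trans_eq ?_
  have hn0 : (n : ℝ) + 1 ≠ 0 := by positivity
  push_cast
  rw [mul_div_cancel₀ _ hn0]
  ring

attribute [local instance] endNormedRing endNormedAlgebra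

variable {𝔤 : Type*} [LieRing 𝔤] [LieAlgebra ℝ 𝔤] [FiniteDimensional ℝ 𝔤]

lemma norm_one_end (V : Type*) [AddCommGroup V] [Module ℝ V] [FiniteDimensional ℝ V]
    [Nontrivial V] : NormOneClass (Module.End ℝ V) where
  norm_one := by
    have : Nonempty (Fin (Module.finrank ℝ V)) := ⟨⟨0, Module.finrank_pos⟩⟩
    let := Matrix.linftyOpNormedRing (n := Fin (Module.finrank ℝ V)) (α := ℝ)
    change ‖LinearMap.toMatrixAlgEquiv (Module.finBasis ℝ V) 1‖ = 1
    rw [map_one]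
    have := Matrix.linfty_opNormOneClass (n := Fin (Module.finrank ℝ V)) (α := ℝ)
    exact norm_one

/-- `z` is the velocity at the identity of a curve in the group `N` of linear automorphisms. -/
def IsVelocity (N : Subgroup (𝔤 ≃ₗ[ℝ] 𝔤)) (z : 𝔤) : Prop :=
  ∃ c : ℝ → 𝔤 ≃ₗ[ℝ] 𝔤, (∀ t, c t ∈ N) ∧ c 0 = 1 ∧
    HasDerivAt (fun t => ((c t : 𝔤 →ₗ[ℝ] 𝔤) : Module.End ℝ 𝔤)) (LieAlgebra.ad ℝ 𝔤 z) 0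

lemma IsVelocity.add {N : Subgroup (𝔤 ≃ₗ[ℝ] 𝔤)} {z w : 𝔤} (hz : IsVelocity N z)
    (hw : IsVelocity N w) : IsVelocity N (z + w) := by
  obtain ⟨c, hc, hc0, hcd⟩ := hz
  obtain ⟨d, hd, hd0, hdd⟩ := hw
  refine ⟨fun t => c t * d t, fun t => mul_mem (hc t) (hd t), by simp [hc0, hd0], ?_⟩
  have := hcd.fun_mul hdd
  rw [hc0, hd0] at this
  convert! this using 1
  rw [map_add]
  ext y; rfl

lemma IsVelocity.smul {N : Subgroup (𝔤 ≃ₗ[ℝ] 𝔤)} {z : 𝔤} (r : ℝ) (hz : IsVelocity N z) :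
    IsVelocity N (r • z) := by
  obtain ⟨c, hc, hc0, hcd⟩ := hz
  refine ⟨fun t => c (r * t), fun t => hc _, by simp [hc0], ?_⟩
  have h1 : HasDerivAt (fun t : ℝ => r * t) r 0 := by
    simpa using (hasDerivAt_id (0 : ℝ)).const_mul r
  have h2 := HasDerivAt.scomp (0 : ℝ) (g₁ := fun t => ((c t : 𝔤 →ₗ[ℝ] 𝔤) : Module.End ℝ 𝔤))
    (h := fun t : ℝ => r * t) (by simpa using hcd) h1
  rw [map_smul]
  exact h2

lemma IsVelocity.conj {N : Subgroup (𝔤 ≃ₗ[ℝ] 𝔤)}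
    (hN : ∀ φ ∈ N, ∀ y, expAd y * φ * (expAd y)⁻¹ ∈ N) {z : 𝔤} (hz : IsVelocity N z) (y : 𝔤) :
    IsVelocity N (expAd y z) := by
  obtain ⟨c, hc, hc0, hcd⟩ := hz
  refine ⟨fun t => expAd y * c t * (expAd y)⁻¹, fun t => hN _ (hc t) y, by simp [hc0], ?_⟩
  have h1 := (hcd.const_mul ((expAd y : 𝔤 →ₗ[ℝ] 𝔤) : Module.End ℝ 𝔤)).mul_const
    ((((expAd y)⁻¹ : 𝔤 ≃ₗ[ℝ] 𝔤) : 𝔤 →ₗ[ℝ] 𝔤) : Module.End ℝ 𝔤)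
  convert! h1 using 1
  ext w
  change ⁅expAd y z, w⁆ = expAd y ⁅z, (expAd y)⁻¹ w⁆
  exact ad_expAd y z w

lemma isVelocity_expAd {N : Subgroup (𝔤 ≃ₗ[ℝ] 𝔤)} {a b : 𝔤}
    (h : ∀ t : ℝ, expAd (t • a) * (expAd (t • b))⁻¹ ∈ N) : IsVelocity N (a - b) := by
  refine ⟨fun t => expAd (t • a) * (expAd (t • b))⁻¹, h, by simp [expAd_zero], ?_⟩
  have : CompleteSpace (Module.End ℝ 𝔤) := FiniteDimensional.complete ℝ _
  have he (y : 𝔤) : HasDerivAt (fun t : ℝ => ((expAd (t • y) : 𝔤 →ₗ[ℝ] 𝔤) : Module.End ℝ 𝔤))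
      (LieAlgebra.ad ℝ 𝔤 y) 0 := by
    have h1 := hasDerivAt_exp_smul_const' (LieAlgebra.ad ℝ 𝔤 y) (0 : ℝ) (𝕂 := ℝ)
    convert! h1 using 1
    · funext t
      ext w
      change expAd (t • y) w = _
      rw [expAd_apply, map_smul]
    · simp
  have h1 := (he a).fun_mul (he (-b))
  convert! h1 using 1
  · funext t
    rw [smul_neg, ← expAd_symm]; rfl
  · simp only [zero_smul, expAd_zero, map_sub, map_neg]
    ext w
    change ⁅a, w⁆ - ⁅b, w⁆ = ⁅a, w⁆ + -⁅b, w⁆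
    rw [sub_eq_add_neg]

/-- A closed subgroup `N`, normalized by the inner automorphisms of a simple Lie algebra, that
contains a curve with non-zero velocity contains all inner automorphisms: the velocities of curves
in `N` form an ideal, and powers along a curve converge to exponentials of its velocity. -/
theorem inn_le_of_expAd_mem [LieAlgebra.IsSimple ℝ 𝔤] (N : Subgroup (𝔤 ≃ₗ[ℝ] 𝔤))
    (hN : ∀ φ ∈ N, ∀ y, expAd y * φ * (expAd y)⁻¹ ∈ N)
    (hcl : ∀ (u : ℕ → 𝔤 ≃ₗ[ℝ] 𝔤) (φ : 𝔤 ≃ₗ[ℝ] 𝔤), (∀ n, u n ∈ N) → φ ∈ Inn 𝔤 →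
      (∀ (ξ : Module.Dual ℝ 𝔤) (y : 𝔤), Tendsto (fun n => ξ (u n y)) atTop (𝓝 (ξ (φ y)))) → φ ∈ N)
    {a b : 𝔤} (h : ∀ t : ℝ, expAd (t • a) * (expAd (t • b))⁻¹ ∈ N) (hab : a ≠ b) :
    Inn 𝔤 ≤ N := by
  have hnt : Nontrivial 𝔤 := ⟨a, b, hab⟩
  have hcomplete : CompleteSpace (Module.End ℝ 𝔤) := FiniteDimensional.complete ℝ _
  let S : Submodule ℝ 𝔤 :=
    { carrier := {z | IsVelocity N z}
      add_mem' := IsVelocity.add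
      zero_mem' := by
        simpa using (isVelocity_expAd h).smul 0
      smul_mem' := fun r _ hz => hz.smul r }
  have hlie (y z : 𝔤) (hz : z ∈ S) : ⁅y, z⁆ ∈ S := by
    by_contra hcon
    obtain ⟨ξ, hξ, hξS⟩ := Submodule.exists_le_ker_of_notMem hcon
    have h1 := hasDerivAt_expAd_zero y z ξ
    have h2 : (fun s : ℝ => ξ (expAd (s • y) z)) = fun _ => 0 :=
      funext fun s => hξS (IsVelocity.conj hN hz (s • y))
    rw [h2] at h1
    exact hξ (h1.unique (hasDerivAt_const _ _))
  let I : LieIdeal ℝ 𝔤 := { S with lie_mem := fun {y z} hz => hlie y z hz }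
  have hI : I = ⊤ := by
    refine (LieAlgebra.IsSimple.eq_bot_or_eq_top I).resolve_left fun hbot => hab ?_
    have h1 : a - b ∈ I := isVelocity_expAd h
    rw [hbot] at h1
    exact sub_eq_zero.1 ((LieSubmodule.mem_bot _).1 h1)
  refine (Subgroup.closure_le _).2 ?_
  rintro _ ⟨z, -, rfl⟩
  have hz : z ∈ I := by rw [hI]; trivial
  obtain ⟨c, hc, hc0, hcd⟩ := (hz : IsVelocity N z)
  refine hcl (fun n => c (1 / ((n : ℝ) + 1)) ^ (n + 1)) _ (fun n => pow_mem (hc _) _)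
    (expAd_mem_inn z) fun ξ y => ?_
  have hone := norm_one_end 𝔤
  have h1 := tendsto_pow_of_hasDerivAt (c := fun t => ((c t : 𝔤 →ₗ[ℝ] 𝔤) : Module.End ℝ 𝔤))
    (by rw [hc0]; rfl) hcd
  let ℓ : Module.End ℝ 𝔤 →ₗ[ℝ] ℝ := ξ ∘ₗ LinearMap.applyₗ y
  have h2 := ((LinearMap.continuous_of_finiteDimensional ℓ).tendsto _).comp h1
  have h3 : ℓ (NormedSpace.exp (LieAlgebra.ad ℝ 𝔤 z)) = ξ (expAd z y) := by
    rw [expAd_apply]; rfl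
  rw [h3] at h2
  refine h2.congr fun n => ?_
  have h4 (φ : 𝔤 ≃ₗ[ℝ] 𝔤) (k : ℕ) :
      ((φ : 𝔤 →ₗ[ℝ] 𝔤) : Module.End ℝ 𝔤) ^ k = ((φ ^ k : 𝔤 ≃ₗ[ℝ] 𝔤) : 𝔤 →ₗ[ℝ] 𝔤) := by
    induction k with
    | zero => rfl
    | succ k ih => rw [pow_succ, pow_succ, ih]; rfl
  change ξ ((((c (1 / ((n : ℝ) + 1)) : 𝔤 →ₗ[ℝ] 𝔤) : Module.End ℝ 𝔤) ^ (n + 1)) y) = _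
  rw [h4]
  rfl

open GradedGroup

variable {σ : 𝔤 ≃ₗ[ℝ] 𝔤} {x : 𝔤} {ℋ : Type*} [NormedAddCommGroup ℋ] [InnerProductSpace ℂ ℋ]

/-- A representation that is non-trivial on the even part is infinitesimally faithful. -/
theorem AntiunitaryRep.eq_of_exp_eq [LieAlgebra.IsSimple ℝ 𝔤] (hx : IsEulerElement x)
    (hσ : IsEulerReflection x σ) (U : AntiunitaryRep σ ℋ) (hU : U.NontrivialOnEven) {a b : 𝔤}
    (h : ∀ t : ℝ, U.toHom (GradedGroup.exp σ (t • a)) = U.toHom (GradedGroup.exp σ (t • b))) :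
    a = b := by
  by_contra hab
  let N : Subgroup (𝔤 ≃ₗ[ℝ] 𝔤) :=
    { carrier := {φ | ∃ hφ : φ ∈ Inn 𝔤, U.toHom (ofInn σ φ hφ) = 1}
      mul_mem' := by
        rintro φ ψ ⟨hφ, hφ'⟩ ⟨hψ, hψ'⟩
        exact ⟨mul_mem hφ hψ, by rw [ofInn_mul hφ hψ, map_mul, hφ', hψ', one_mul]⟩
      one_mem' := ⟨one_mem _, by rw [ofInn_one, map_one]⟩
      inv_mem' := by
        rintro φ ⟨hφ, hφ'⟩
        exact ⟨inv_mem hφ, by rw [ofInn_inv hφ, map_inv, hφ', inv_one]⟩ }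
  have hle : Inn 𝔤 ≤ N := by
    refine inn_le_of_expAd_mem N ?_ ?_ (a := a) (b := b) (fun t => ?_) hab
    · rintro φ ⟨hφ, hφ'⟩ y
      have hy := expAd_mem_inn y
      refine ⟨mul_mem (mul_mem hy hφ) (inv_mem hy), ?_⟩
      rw [ofInn_mul (mul_mem hy hφ) (inv_mem hy), ofInn_mul hy hφ, ofInn_inv hy, map_mul, map_mul,
        hφ', mul_one, map_inv, mul_inv_cancel]
    · intro u φ hu hφ hlim
      choose hu1 hu2 using hu
      refine ⟨hφ, ?_⟩
      ext v
      have h1 : Tendsto (fun n => ofInn σ (u n) (hu1 n)) atTop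
          (@nhds _ (GradedGroup.topology σ) (ofInn σ φ hφ)) :=
        tendsto_nhds_of_coeff (fun n => by rw [grading_ofInn, grading_ofInn]) hlim
      let := GradedGroup.topology σ
      have h2 := ((U.continuous v).tendsto _).comp h1
      have h3 : (fun g => U.toHom g v) ∘ (fun n => ofInn σ (u n) (hu1 n)) = fun _ => v :=
        funext fun n => by rw [Function.comp_apply, hu2]; rfl
      rw [h3] at h2
      exact tendsto_nhds_unique h2 tendsto_const_nhds
    · have ha := expAd_mem_inn (t • a)
      have hb := expAd_mem_inn (t • b)
      refine ⟨mul_mem ha (inv_mem hb), ?_⟩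
      rw [ofInn_mul ha (inv_mem hb), ofInn_inv hb, map_mul, map_inv]
      change U.toHom (GradedGroup.exp σ (t • a)) * (U.toHom (GradedGroup.exp σ (t • b)))⁻¹ = 1
      rw [h t, mul_inv_cancel]
  obtain ⟨g, hg, hg'⟩ := hU
  obtain ⟨h1, h2⟩ := hle (ad_mem_inn hx hσ hg)
  apply hg'
  rw [← h2]
  congr 1
  exact GradedGroup.ext rfl hg

end Kernel

/-! ### Stabilizers of wedge regions -/

section WedgeStabilizer

open Topology Filter

lemma lorentz_one (x : Fin 3 → ℝ) : lorentz 1 x = x := by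
  simp only [lorentz, Matrix.SpecialLinearGroup.coe_one, one_mul, inv_one, mul_one]
  ext i
  fin_cases i <;> simp [untilde, tilde] <;> ring

lemma lorentz_zero_add_one (g : SL(2, ℝ)) (x : Fin 3 → ℝ) :
    lorentz g x 0 = (1 / 2) * (x 1 * (2 * (g 1 0 * g 1 1 + g 0 0 * g 0 1)) +
      x 0 * (g 0 0 ^ 2 + g 0 1 ^ 2 + g 1 0 ^ 2 + g 1 1 ^ 2) +
      x 2 * (g 1 0 ^ 2 - g 1 1 ^ 2 + g 0 0 ^ 2 - g 0 1 ^ 2)) ∧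
    lorentz g x 1 = x 1 * (g 0 0 * g 1 1 + g 0 1 * g 1 0) + x 0 * (g 0 0 * g 1 0 + g 0 1 * g 1 1) +
      x 2 * (g 0 0 * g 1 0 - g 0 1 * g 1 1) := by
  simp only [lorentz, untilde, tilde, Matrix.SpecialLinearGroup.coe_inv, Matrix.adjugate_fin_two,
    Matrix.mul_apply, Fin.sum_univ_two]
  constructor <;> simp <;> ring

lemma eq_and_eq_of_quadratic {a b c d : ℝ} (hdet : a * d - b * c = 1) (e1 : a * c - b * d = 0)
    (e0 : c ^ 2 - d ^ 2 + a ^ 2 - b ^ 2 = 0) (hpos : 0 < a * d + b * c) : a = d ∧ b = c := by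
  obtain ⟨m, hm⟩ : ∃ m, m = a ^ 2 - b ^ 2 := ⟨_, rfl⟩
  have ha : a = m * d := by rw [hm]; linear_combination (-a) * hdet - b * e1
  have hb : b = m * c := by rw [hm]; linear_combination (-b) * hdet - a * e1
  have hm1 : m * m = 1 := by
    have : m * (d ^ 2 - c ^ 2) = 1 := by rw [← hdet, ha, hb]; ring
    have h2 : d ^ 2 - c ^ 2 = m := by rw [hm]; linarith
    rwa [h2] at this
  obtain h | h := mul_self_eq_one_iff.1 hm1
  · rw [h] at ha hb
    exact ⟨by linarith, by linarith⟩
  · rw [h] at ha hb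
    rw [ha, hb] at hpos
    nlinarith [sq_nonneg c, sq_nonneg d]

/-- The stabilizer of the right wedge centralizes the boost group: the points `±e₂` of its
boundary are the only ones in de Sitter space where both `x₁ + x₀` and `x₁ - x₀` vanish. -/
lemma mul_sigma1_of_image_rightWedge {g : SL(2, ℝ)}
    (h : lorentz g '' rightWedge ⊆ rightWedge) :
    (g : Matrix (Fin 2) (Fin 2) ℝ) * sigma1.1 = sigma1.1 * g := by
  have hmem (x : Fin 3 → ℝ) (hx : x ∈ rightWedge) : |lorentz g x 0| < lorentz g x 1 :=
    (h ⟨x, hx, rfl⟩).1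
  have hdet : g 0 0 * g 1 1 - g 0 1 * g 1 0 = 1 := by
    have := g.2
    rwa [Matrix.det_fin_two] at this
  -- the points `±e₂` are limits of points of the wedge
  have hlim (ε : ℝ) (hε : ε ^ 2 = 1) :
      |lorentz g ![0, 0, ε] 0| ≤ lorentz g ![0, 0, ε] 1 := by
    have hc : Continuous fun s : ℝ => ![0, s, ε * √(1 - s ^ 2)] := by
      refine continuous_pi fun i => ?_
      fin_cases i <;> simp <;> fun_prop
    have hc0 : Continuous fun s : ℝ => |lorentz g ![0, s, ε * √(1 - s ^ 2)] 0| := by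
      simp only [(lorentz_zero_add_one g _).1]
      fun_prop
    have hc1 : Continuous fun s : ℝ => lorentz g ![0, s, ε * √(1 - s ^ 2)] 1 := by
      simp only [(lorentz_zero_add_one g _).2]
      fun_prop
    have h0 : ![0, 0, ε] = ![0, (0 : ℝ), ε * √(1 - 0 ^ 2)] := by simp
    rw [h0]
    refine le_of_tendsto_of_tendsto (hc0.tendsto 0 |>.mono_left nhdsWithin_le_nhds)
      (hc1.tendsto 0 |>.mono_left (nhdsWithin_le_nhds (s := Set.Ioi 0))) ?_
    filter_upwards [Ioo_mem_nhdsGT (zero_lt_one : (0 : ℝ) < 1)] with s hs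
    refine (hmem _ ⟨?_, ?_⟩).le
    · simpa using hs.1
    · have h1 : 0 ≤ 1 - s ^ 2 := by nlinarith [hs.1, hs.2]
      have h2 := Real.sq_sqrt h1
      simp [deSitter, mul_pow, hε]
      linarith
  have hp := hlim 1 (by norm_num)
  have hm := hlim (-1) (by norm_num)
  have hp' := abs_le.1 hp
  have hm' := abs_le.1 hm
  rw [(lorentz_zero_add_one g _).1, (lorentz_zero_add_one g _).2] at hp' hm'
  simp at hp' hm'
  have e1 : g 0 0 * g 1 0 - g 0 1 * g 1 1 = 0 := by linarith [hp'.1, hp'.2, hm'.1, hm'.2]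
  have e0 : g 1 0 ^ 2 - g 1 1 ^ 2 + g 0 0 ^ 2 - g 0 1 ^ 2 = 0 := by
    linarith [hp'.1, hp'.2, hm'.1, hm'.2]
  -- the point `e₁` of the wedge excludes that `g` exchanges `e₂` and `-e₂`
  have he1 := hmem ![0, 1, 0] ⟨by simp, by simp [deSitter]⟩
  have he1' := (abs_nonneg _).trans_lt he1
  rw [(lorentz_zero_add_one g _).2] at he1'
  simp at he1'
  obtain ⟨h1, h2⟩ := eq_and_eq_of_quadratic hdet e1 e0 he1'
  ext i j
  fin_cases i <;> fin_cases j <;>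
    simp [sigma1, Matrix.mul_apply, Fin.sum_univ_two, h1, h2, mul_comm]

lemma mul_expSL_of_mul_sigma1 {g : SL(2, ℝ)}
    (h : (g : Matrix (Fin 2) (Fin 2) ℝ) * sigma1.1 = sigma1.1 * g) (t : ℝ) :
    g * expSL (t • sigma1) = expSL (t • sigma1) * g := by
  let := Matrix.linftyOpNormedRing (n := Fin 2) (α := ℝ)
  let := Matrix.linftyOpNormedAlgebra (n := Fin 2) (R := ℝ) (α := ℝ)
  apply Subtype.ext
  rw [Matrix.SpecialLinearGroup.coe_mul, Matrix.SpecialLinearGroup.coe_mul]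
  have hc : Commute (g : Matrix (Fin 2) (Fin 2) ℝ) ((t • sigma1 : sl2) : Matrix (Fin 2) (Fin 2) ℝ) :=
    (show Commute (g : Matrix (Fin 2) (Fin 2) ℝ) sigma1.1 from h).smul_right t
  exact hc.exp_right

lemma expSL_mul_sigma1 (s : ℝ) :
    ((expSL (s • sigma1) : SL(2, ℝ)) : Matrix (Fin 2) (Fin 2) ℝ) * sigma1.1 =
      sigma1.1 * (expSL (s • sigma1) : SL(2, ℝ)) := by
  let := Matrix.linftyOpNormedRing (n := Fin 2) (α := ℝ)
  let := Matrix.linftyOpNormedAlgebra (n := Fin 2) (R := ℝ) (α := ℝ)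
  have hc : Commute sigma1.1 ((expSL (s • sigma1) : SL(2, ℝ)) : Matrix (Fin 2) (Fin 2) ℝ) :=
    ((Commute.refl sigma1.1).smul_right s).exp_right
  exact hc.eq.symm

/-- The boosts `exp(sσ₁)` are symmetric with equal diagonal entries. -/
lemma expSL_smul_sigma1 (s : ℝ) :
    (expSL (s • sigma1)) 1 1 = (expSL (s • sigma1)) 0 0 ∧
      (expSL (s • sigma1)) 1 0 = (expSL (s • sigma1)) 0 1 := by
  have hc := expSL_mul_sigma1 s
  generalize (expSL (s • sigma1)) = E at hc ⊢
  have h0 := congrFun (congrFun hc 0) 0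
  have h1 := congrFun (congrFun hc 0) 1
  simp [sigma1, Matrix.mul_apply, Fin.sum_univ_two] at h0 h1
  constructor <;> linarith

lemma exists_expSL_smul_sigma1_ne_zero : ∃ s : ℝ, (expSL (s • sigma1)) 0 1 ≠ 0 := by
  by_contra! hcon
  let := Matrix.linftyOpNormedRing (n := Fin 2) (α := ℝ)
  let := Matrix.linftyOpNormedAlgebra (n := Fin 2) (R := ℝ) (α := ℝ)
  let ℓ : Matrix (Fin 2) (Fin 2) ℝ →ₗ[ℝ] ℝ := Matrix.entryLinearMap ℝ ℝ 0 1
  have h1 := hasDerivAt_exp_map ℓ sigma1.1 0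
  have h2 : HasDerivAt (fun _ : ℝ => (0 : ℝ)) _ 0 :=
    h1.congr_of_eventuallyEq (Eventually.of_forall fun s => (hcon s).symm)
  have h3 := h2.unique (hasDerivAt_const _ _)
  simp [ℓ, sigma1] at h3

/-- Boosts in the direction of a translated wedge do not commute with the boosts of the right
wedge. -/
lemma conj_expSL_not_comm {s : ℝ} (hs : (expSL (s • sigma1)) 0 1 ≠ 0) :
    ∃ g : SL(2, ℝ), ¬ Commute (g⁻¹ * (expSL (s • sigma1) * expSL (s • sigma1)) * g)
      (expSL (s • sigma1)) := by
  obtain ⟨u, hu⟩ : ∃ u : SL(2, ℝ), (u : Matrix (Fin 2) (Fin 2) ℝ) = !![1, 1; 0, 1] :=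
    ⟨⟨_, by simp⟩, rfl⟩
  refine ⟨u, fun hcon => hs ?_⟩
  obtain ⟨h1, h2⟩ := expSL_smul_sigma1 s
  have hdet := (expSL (s • sigma1)).2
  rw [Matrix.det_fin_two, h1, h2] at hdet
  generalize (expSL (s • sigma1)) = E at *
  have h3 := congrArg (fun k : SL(2, ℝ) => (k : Matrix (Fin 2) (Fin 2) ℝ) 0 1) hcon.eq
  simp only [Matrix.SpecialLinearGroup.coe_mul, Matrix.SpecialLinearGroup.coe_inv, hu,
    Matrix.adjugate_fin_two, Matrix.mul_apply, Fin.sum_univ_two] at h3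
  simp [h1, h2] at h3
  have h4 : E 0 0 * E 0 1 * E 0 1 = 0 := by linear_combination (-1 / 4) * h3
  have h5 : E 0 1 * E 0 1 * (E 0 1 * E 0 1 + 1) = 0 := by
    linear_combination E 0 0 * h4 - E 0 1 * E 0 1 * hdet
  have h6 : E 0 1 * E 0 1 + 1 ≠ 0 := ne_of_gt (by linarith [mul_self_nonneg (E 0 1)])
  exact mul_self_eq_zero.1 ((mul_eq_zero.1 h5).resolve_right h6)

end WedgeStabilizer

/-! ### The net on de Sitter space -/

section Net

open GradedGroup

variable {𝔤 : Type*} [LieRing 𝔤] [LieAlgebra ℝ 𝔤] [FiniteDimensional ℝ 𝔤] {σ : 𝔤 ≃ₗ[ℝ] 𝔤} {x h : 𝔤}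
  {ℋ : Type*} [NormedAddCommGroup ℋ] [InnerProductSpace ℂ ℋ]

namespace Gl2Datum

lemma commutatorAlgebra_le {𝔤 : Type*} [LieRing 𝔤] [LieAlgebra ℝ 𝔤] (𝔟 : LieSubalgebra ℝ 𝔤) : commutatorAlgebra 𝔟 ≤ 𝔟 := by
  refine LieSubalgebra.lieSpan_le.2 ?_
  rintro _ ⟨y, hy, z, hz, rfl⟩
  exact 𝔟.lie_mem hy hz

/-- The homomorphism `SL₂(ℝ) → G` that integrates `φ`. -/
def lift (d : Gl2Datum h) (σ : 𝔤 ≃ₗ[ℝ] 𝔤) : SL(2, ℝ) →* GradedGroup σ where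
  toFun g := ofInn σ (d.Φ g) (innSub_le _ (d.Φ g).2)
  map_one' := GradedGroup.ext (by rw [ad_ofInn, map_one]; rfl) rfl
  map_mul' g g' := GradedGroup.ext (by rw [ad_mul, ad_ofInn, ad_ofInn, ad_ofInn, map_mul]; rfl)
    (by rw [grading_mul, grading_ofInn, grading_ofInn, grading_ofInn, one_mul])

lemma restrict_eq (d : Gl2Datum h) (U : AntiunitaryRep σ ℋ) (g : SL(2, ℝ)) :
    d.restrict U g = U.toHom (d.lift σ g) := rfl

lemma ad_lift (d : Gl2Datum h) (g : SL(2, ℝ)) : Ad (d.lift σ g) = (d.Φ g : 𝔤 ≃ₗ[ℝ] 𝔤) := rfl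

lemma grading_lift (d : Gl2Datum h) (g : SL(2, ℝ)) : grading (d.lift σ g) = 1 := rfl

lemma lift_expSL (d : Gl2Datum h) (X : sl2) :
    d.lift σ (expSL X) = GradedGroup.exp σ (d.φ X : 𝔤) :=
  GradedGroup.ext (d.Φ_exp X) rfl

/-- The central component `h_c = h + h₁` of `h` is fixed by `H↑`. -/
lemma Φ_central (d : Gl2Datum h) (g : SL(2, ℝ)) :
    (d.Φ g : 𝔤 ≃ₗ[ℝ] 𝔤) (h + (d.φ sigma1 : 𝔤)) = h + (d.φ sigma1 : 𝔤) := by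
  obtain ⟨φ, hφ⟩ := d.Φ g
  change φ _ = _
  induction hφ using Subgroup.closure_induction with
  | mem φ hφ =>
    obtain ⟨y, hy, rfl⟩ := hφ
    refine expAd_apply_eq_self ?_
    rw [← lie_skew, d.central y (commutatorAlgebra_le _ hy), neg_zero]
  | one => rfl
  | mul φ ψ _ _ h1 h2 => rw [LinearEquiv.mul_apply, h2, h1]
  | inv φ _ h1 => exact (φ.symm_apply_eq).2 h1.symm

/-- `Φ(g)` fixes `h` if and only if it fixes `h₁`. -/
lemma Φ_apply_eq_iff (d : Gl2Datum h) (g : SL(2, ℝ)) :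
    (d.Φ g : 𝔤 ≃ₗ[ℝ] 𝔤) h = h ↔ (d.Φ g : 𝔤 ≃ₗ[ℝ] 𝔤) (d.φ sigma1 : 𝔤) = (d.φ sigma1 : 𝔤) := by
  have h1 := d.Φ_central g
  rw [map_add] at h1
  constructor
  · intro h2
    rw [h2] at h1
    exact add_left_cancel h1
  · intro h2
    rw [h2] at h1
    exact add_right_cancel h1

lemma φ_smul_sigma1 (d : Gl2Datum h) (s : ℝ) :
    ((d.φ (s • sigma1) : commutatorAlgebra d.𝔟) : 𝔤) = s • (d.φ sigma1 : 𝔤) := by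
  rw [map_smul]; rfl

/-- The stabilizer of `h` in `SL₂(ℝ)` is the centralizer of the boost group. -/
lemma Φ_apply_eq_iff_comm [LieAlgebra.IsSimple ℝ 𝔤] (d : Gl2Datum h) (g : SL(2, ℝ)) :
    (d.Φ g : 𝔤 ≃ₗ[ℝ] 𝔤) h = h ↔ ∀ s : ℝ, Commute g (expSL (s • sigma1)) := by
  rw [Φ_apply_eq_iff]
  have hconj (s : ℝ) := conj_expAd (inn_lie (innSub_le _ (d.Φ g).2)) (s • (d.φ sigma1 : 𝔤))
  have hexp (s : ℝ) : expAd (s • (d.φ sigma1 : 𝔤)) = (d.Φ (expSL (s • sigma1)) : 𝔤 ≃ₗ[ℝ] 𝔤) := by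
    rw [d.Φ_exp, d.φ_smul_sigma1]
  constructor
  · intro h1 s
    have h2 := hconj s
    rw [map_smul, h1, mul_inv_eq_iff_eq_mul, hexp] at h2
    have h3 : d.Φ (g * expSL (s • sigma1)) = d.Φ (expSL (s • sigma1) * g) := by
      rw [map_mul, map_mul]
      exact Subtype.ext h2
    exact d.Φ.injective h3
  · intro h1
    refine eq_of_expAd_eq fun s => ?_
    rw [← map_smul, ← hconj, mul_inv_eq_iff_eq_mul, hexp]
    have h2 := congrArg (fun k => (d.Φ k : 𝔤 ≃ₗ[ℝ] 𝔤)) (h1 s).eq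
    simpa using h2

end Gl2Datum

/-- The stabilizer in `G` of a standard subspace. -/
def AntiunitaryRep.stabilizer (U : AntiunitaryRep σ ℋ) (K : StandardSubspace ℋ) :
    Subgroup (GradedGroup σ) where
  carrier := {g | U.toHom g '' (K.toClosedSubmodule : Set ℋ) = K.toClosedSubmodule}
  mul_mem' := fun {g g'} hg hg' => by
    simp only [Set.mem_ofPred_eq] at hg hg' ⊢
    have : ⇑(U.toHom (g * g')) = U.toHom g ∘ U.toHom g' := by rw [map_mul]; rfl
    rw [this, Set.image_comp, hg', hg]
  one_mem' := by
    rw [Set.mem_ofPred_eq, map_one]; exact Set.image_id _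
  inv_mem' := fun {g} hg => by
    simp only [Set.mem_ofPred_eq] at hg ⊢
    nth_rewrite 1 [← hg]
    rw [← Set.image_comp]
    have : ⇑(U.toHom g⁻¹) ∘ U.toHom g = id := by
      funext v
      rw [Function.comp_apply, ← U.toHom_mul, inv_mul_cancel, map_one]; rfl
    rw [this, Set.image_id]

lemma AntiunitaryRep.mem_stabilizer {U : AntiunitaryRep σ ℋ} {K : StandardSubspace ℋ}
    {g : GradedGroup σ} :
    g ∈ U.stabilizer K ↔ U.toHom g '' (K.toClosedSubmodule : Set ℋ) = K.toClosedSubmodule :=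
  Iff.rfl

lemma AntiunitaryRep.image_eq_image_iff {U : AntiunitaryRep σ ℋ} {K : StandardSubspace ℋ}
    {g g' : GradedGroup σ} :
    U.toHom g '' (K.toClosedSubmodule : Set ℋ) = U.toHom g' '' (K.toClosedSubmodule : Set ℋ) ↔
      g⁻¹ * g' ∈ U.stabilizer K := by
  have h1 (k k' : GradedGroup σ) (S : Set ℋ) :
      U.toHom (k * k') '' S = U.toHom k '' (U.toHom k' '' S) := by
    rw [← Set.image_comp, map_mul]; rfl
  rw [mem_stabilizer, h1]
  constructor
  · intro h2
    rw [← h2, ← h1, inv_mul_cancel, map_one]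
    exact Set.image_id _
  · intro h2
    nth_rewrite 1 [← h2]
    rw [← h1, ← h1, mul_inv_cancel, one_mul]

lemma act_dsWedge (g g' : SL(2, ℝ)) : DSWedges.act g (dsWedge g') = dsWedge (g * g') := by
  apply Subtype.ext
  change lorentz g '' (lorentz g' '' rightWedge) = lorentz (g * g') '' rightWedge
  rw [Set.image_image]
  simp only [lorentz_mul]

lemma lorentzCovariant_of_isImage {U : AntiunitaryRep σ ℋ} {K : StandardSubspace ℋ}
    {d : Gl2Datum h} {M : DSWedges → StandardSubspace ℋ}
    (hM : ∀ g, IsImage (d.restrict U g) K (M (dsWedge g))) :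
    LorentzCovariant (d.restrict U) M := by
  rintro g ⟨V, g', rfl⟩
  change IsImage _ (M (dsWedge g')) (M (DSWedges.act g (dsWedge g')))
  rw [act_dsWedge]
  have h1 := hM (g * g')
  unfold IsImage at h1 ⊢
  rw [h1, hM g', ← Set.image_comp, d.restrict_eq, map_mul, map_mul]
  rfl

variable [CompleteSpace ℋ] [LieAlgebra.IsSimple ℝ 𝔤]

/-- Even elements of `G` stabilize the standard subspace of an Euler wedge if and only if they
fix its Lie algebra component. -/
theorem IsBGLNet.mem_stabilizer_iff (hx : IsEulerElement x) (hσ : IsEulerReflection x σ)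
    {U : AntiunitaryRep σ ℋ} (hU : U.NontrivialOnEven) {N : Wedge σ → StandardSubspace ℋ}
    (hN : IsBGLNet U N) {W : Wedge σ} (hW : W.IsEulerCouple) {g : GradedGroup σ}
    (hg : grading g = 1) : g ∈ U.stabilizer (N W) ↔ Ad g W.x = W.x := by
  have hmod := hN.isModularData W
  have hpair := U.isModularPair hx hσ W
  constructor
  · intro hstab
    have hcomm := hpair.comm_of_image_eq hmod (U.unitary g hg) hstab
    refine U.eq_of_exp_eq hx hσ hU fun t => ?_
    ext v
    have h1 := hcomm (-t / (2 * Real.pi)) (U.toHom g⁻¹ v)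
    have h2 : -(2 * Real.pi) * (-t / (2 * Real.pi)) = t := by
      have := Real.pi_ne_zero
      field_simp
    rw [U.group_apply, U.group_apply, h2, ← U.toHom_mul, ← U.toHom_mul, ← U.toHom_mul,
      ← U.toHom_mul, mul_exp hx hσ, mul_inv_cancel_right, mul_inv_cancel_right, map_smul] at h1
    exact h1
  · intro hfix
    have hmaps (k : GradedGroup σ) (hk : grading k = 1) (hk' : Ad k W.x = W.x) (v : ℋ)
        (hv : v ∈ (N W).toClosedSubmodule) : U.toHom k v ∈ (N W).toClosedSubmodule := by
      refine hmod.map_mem (U.unitary k hk) (fun v => ?_) (fun t v => ?_) hv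
      · rw [← U.toHom_mul, ← U.toHom_mul]
        have hks : k * W.s = W.s * k := GradedGroup.ext
          (by rw [ad_mul, ad_mul]; exact hW.2.comm hW.1 (ad_lie hx hσ k) hk')
          (by rw [grading_mul, grading_mul, mul_comm])
        rw [hks]
      · rw [U.group_apply, U.group_apply, ← U.toHom_mul, ← U.toHom_mul, mul_exp hx hσ, map_smul,
          hk']
    have hinv : Ad g⁻¹ W.x = W.x := ((Ad g).symm_apply_eq).2 hfix.symm
    refine Set.Subset.antisymm ?_ fun v hv => ?_
    · rintro _ ⟨v, hv, rfl⟩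
      exact hmaps g hg hfix v hv
    · refine ⟨U.toHom g⁻¹ v, hmaps g⁻¹ (by rw [grading_inv, hg, inv_one]) hinv v hv, ?_⟩
      rw [← U.toHom_mul, mul_inv_cancel, map_one]; rfl

lemma IsBGLNet.lift_mem_stabilizer_iff (hx : IsEulerElement x) (hσ : IsEulerReflection x σ)
    {U : AntiunitaryRep σ ℋ} (hU : U.NontrivialOnEven) {N : Wedge σ → StandardSubspace ℋ}
    (hN : IsBGLNet U N) {W : Wedge σ} (hW : W.IsEulerCouple) (d : Gl2Datum W.x) (g : SL(2, ℝ)) :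
    d.lift σ g ∈ U.stabilizer (N W) ↔ ∀ s : ℝ, Commute g (expSL (s • sigma1)) := by
  rw [hN.mem_stabilizer_iff hx hσ hU hW (d.grading_lift g), d.ad_lift, d.Φ_apply_eq_iff_comm]

/-- The standard subspace attached to `Λ(g) W_{x₁}` does not depend on the choice of `g`. -/
lemma IsBGLNet.image_eq_of_dsWedge_eq (hx : IsEulerElement x) (hσ : IsEulerReflection x σ)
    {U : AntiunitaryRep σ ℋ} (hU : U.NontrivialOnEven) {N : Wedge σ → StandardSubspace ℋ}
    (hN : IsBGLNet U N) {W : Wedge σ} (hW : W.IsEulerCouple) (d : Gl2Datum W.x) {g g' : SL(2, ℝ)}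
    (h : dsWedge g = dsWedge g') :
    d.restrict U g '' ((N W).toClosedSubmodule : Set ℋ) =
      d.restrict U g' '' ((N W).toClosedSubmodule : Set ℋ) := by
  rw [d.restrict_eq, d.restrict_eq, AntiunitaryRep.image_eq_image_iff, ← map_inv, ← map_mul,
    hN.lift_mem_stabilizer_iff hx hσ hU hW]
  refine fun s => mul_expSL_of_mul_sigma1 (mul_sigma1_of_image_rightWedge (le_of_eq ?_)) s
  have h1 : dsWedge (g⁻¹ * g') = dsWedge 1 := by
    rw [← act_dsWedge, ← h, act_dsWedge, inv_mul_cancel]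
  refine (congrArg Subtype.val h1).trans ?_
  change lorentz 1 '' rightWedge = rightWedge
  simp only [funext lorentz_one, Set.image_id']

theorem IsBGLNet.existsUnique_dsNet (hx : IsEulerElement x) (hσ : IsEulerReflection x σ)
    {U : AntiunitaryRep σ ℋ} (hU : U.NontrivialOnEven) {N : Wedge σ → StandardSubspace ℋ}
    (hN : IsBGLNet U N) {W : Wedge σ} (hW : W.IsEulerCouple) (d : Gl2Datum W.x) :
    ∃! M : DSWedges → StandardSubspace ℋ,
      ∀ g, IsImage (d.restrict U g) (N W) (M (dsWedge g)) := by
  have hdef (V : DSWedges) : V = dsWedge V.2.choose := Subtype.ext V.2.choose_spec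
  refine ⟨fun V => mapStandard (d.restrict U V.2.choose)
    (U.unitary _ (d.grading_lift _)) (N W), fun g => ?_, fun M hM => ?_⟩
  · have h1 := isImage_mapStandard (d.restrict U (dsWedge g).2.choose)
      (U.unitary _ (d.grading_lift _)) (N W)
    exact h1.trans (hN.image_eq_of_dsWedge_eq hx hσ hU hW d (hdef (dsWedge g)).symm)
  · funext V
    have h1 := hM V.2.choose
    rw [← hdef V] at h1
    have h2 := isImage_mapStandard (d.restrict U V.2.choose)
      (U.unitary _ (d.grading_lift _)) (N W)
    rw [← StandardSubspace.toClosedSubmodule_inj]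
    exact SetLike.coe_injective (h1.trans h2.symm)

/-- The modular group of the right wedge differs from the boosts by the group generated by the
central part of `h`. If it acted as the boosts do, then a boost in the direction of a translated
wedge would stabilize the standard subspace of the right wedge. -/
theorem IsBGLNet.not_modularCovariant (hx : IsEulerElement x) (hσ : IsEulerReflection x σ)
    {U : AntiunitaryRep σ ℋ} (hU : U.NontrivialOnEven) {N : Wedge σ → StandardSubspace ℋ}
    (hN : IsBGLNet U N) {W : Wedge σ} (hW : W.IsEulerCouple) (d : Gl2Datum W.x)
    {M : DSWedges → StandardSubspace ℋ}
    (hM : ∀ g, IsImage (d.restrict U g) (N W) (M (dsWedge g))) : ¬ ModularCovariant M := by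
  intro hcov
  obtain ⟨s, hs⟩ := exists_expSL_smul_sigma1_ne_zero
  obtain ⟨g, hg⟩ := conj_expSL_not_comm hs
  have hM1 : M (dsWedge 1) = N W := by
    rw [← StandardSubspace.toClosedSubmodule_inj]
    refine SetLike.coe_injective ((hM 1).trans ?_)
    rw [d.restrict_eq, map_one, map_one]
    exact Set.image_id _
  have hmod := hN.isModularData W
  have h1 := hcov 1 (U.toHom W.s) (U.group W.x) (by rw [hM1]; exact hmod) (dsWedge g)
    (s / (2 * Real.pi))
  have hpi := Real.pi_ne_zero
  have e1 : 2 * Real.pi * (s / (2 * Real.pi)) = s := by field_simp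
  have e2 : -(2 * Real.pi) * -(s / (2 * Real.pi)) = s := by field_simp
  rw [e1, one_mul, inv_one, mul_one, act_dsWedge, hM, hM] at h1
  set E : SL(2, ℝ) := expSL (s • sigma1) with hE
  set A : GradedGroup σ := GradedGroup.exp σ (s • W.x) with hA
  have hD : (U.group W.x (-(s / (2 * Real.pi))) : ℋ → ℋ) = U.toHom A := by
    funext v; rw [U.group_apply, e2]
  rw [hD, d.restrict_eq, d.restrict_eq, ← Set.image_comp] at h1
  have h2 : (U.toHom A ∘ U.toHom (d.lift σ g) : ℋ → ℋ) = U.toHom (A * d.lift σ g) := by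
    rw [map_mul]; rfl
  rw [h2, AntiunitaryRep.image_eq_image_iff, mul_inv_rev] at h1
  -- `C` is the exponential of the central part of `s h`
  set C : GradedGroup σ := GradedGroup.exp σ (s • (W.x + (d.φ sigma1 : 𝔤))) with hC
  have hCA : C = A * d.lift σ E := by
    have hbr : ⁅s • W.x, s • (d.φ sigma1 : 𝔤)⁆ = 0 := by
      have := d.central _ (Gl2Datum.commutatorAlgebra_le _ (d.φ sigma1).2)
      rw [add_lie, lie_self, add_zero] at this
      rw [smul_lie, lie_smul, this, smul_zero, smul_zero]
    refine GradedGroup.ext ?_ ?_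
    · rw [ad_mul, ad_exp, ad_exp, hE, d.lift_expSL, ad_exp, d.φ_smul_sigma1, smul_add,
        expAd_add hbr]
    · rw [grading_mul, grading_exp, grading_exp, d.grading_lift, one_mul]
  have hCcomm (k : SL(2, ℝ)) : d.lift σ k * C = C * d.lift σ k := by
    rw [hC, mul_exp hx hσ, map_smul, d.ad_lift, d.Φ_central]
  have hAmem : A ∈ U.stabilizer (N W) := by
    rw [hN.mem_stabilizer_iff hx hσ hU hW (grading_exp _), ad_exp]
    exact expAd_apply_eq_self (by simp)
  have hEmem : d.lift σ E ∈ U.stabilizer (N W) := by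
    rw [hN.lift_mem_stabilizer_iff hx hσ hU hW d]
    exact mul_expSL_of_mul_sigma1 (expSL_mul_sigma1 s)
  have hCmem : C ∈ U.stabilizer (N W) := hCA ▸ mul_mem hAmem hEmem
  have h3 : d.lift σ (g⁻¹ * (E * E) * g) ∈ U.stabilizer (N W) := by
    have hA' : A = C * (d.lift σ E)⁻¹ := by rw [hCA, mul_inv_cancel_right]
    have h4 : d.lift σ (g⁻¹ * (E * E) * g) =
        C * ((d.lift σ g)⁻¹ * A⁻¹ * d.lift σ (E * g)) := by
      have h5 := (show Commute (d.lift σ (g⁻¹ * E)) C from hCcomm _).inv_right.eq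
      rw [hA', mul_inv_rev, inv_inv, ← mul_assoc (d.lift σ g)⁻¹, ← map_inv, ← map_mul, h5,
        mul_assoc C⁻¹, mul_inv_cancel_left, ← map_mul]
      simp only [mul_assoc]
    rw [h4]
    exact mul_mem hCmem h1
  exact hg ((hN.lift_mem_stabilizer_iff hx hσ hU hW d _).1 h3 s)

end Net

end ModCov

end

theorem mainTheorem1
    {𝔤 : Type*} [LieRing 𝔤] [LieAlgebra ℝ 𝔤] [FiniteDimensional ℝ 𝔤] [LieAlgebra.IsSimple ℝ 𝔤]
    (x : 𝔤) (hx : ModCov.IsEulerElement x)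
    (σ : 𝔤 ≃ₗ[ℝ] 𝔤) (hσ : ModCov.IsEulerReflection x σ)
    {ℋ : Type*} [NormedAddCommGroup ℋ] [InnerProductSpace ℂ ℋ] [CompleteSpace ℋ]
    (U : ModCov.AntiunitaryRep σ ℋ) (hU : U.NontrivialOnEven)
    (Wh : ModCov.Wedge σ) (hWh : Wh.IsEulerCouple) (hns : ¬ ModCov.IsSymmetricElement Wh.x) :
    Nonempty (ModCov.Gl2Datum Wh.x) ∧
    (∃! NU : ModCov.Wedge σ → StandardSubspace ℋ, ModCov.IsBGLNet U NU) ∧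
    ∀ d : ModCov.Gl2Datum Wh.x, ∀ NU : ModCov.Wedge σ → StandardSubspace ℋ,
      ModCov.IsBGLNet U NU →
      (∃! N : ModCov.DSWedges → StandardSubspace ℋ,
        ∀ g, ModCov.IsImage (d.restrict U g) (NU Wh) (N (ModCov.dsWedge g))) ∧
      ∀ N : ModCov.DSWedges → StandardSubspace ℋ,
        (∀ g, ModCov.IsImage (d.restrict U g) (NU Wh) (N (ModCov.dsWedge g))) →
        ModCov.LorentzCovariant (d.restrict U) N ∧ ¬ ModCov.ModularCovariant N := by
  obtain ⟨e, k, f, v, T, hv, hkv, hne⟩ := ModCov.GradedTriple.exists_odd_weight hWh.1 hns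
  refine ⟨ModCov.GradedTriple.nonempty_gl2Datum hWh.1 T hv hkv hne,
    ModCov.existsUnique_isBGLNet hx hσ U, fun d NU hNU =>
    ⟨hNU.existsUnique_dsNet hx hσ hU hWh d, fun N hN =>
      ⟨ModCov.lorentzCovariant_of_isImage hN, hNU.not_modularCovariant hx hσ hU hWh d hN⟩⟩⟩
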